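/- **Setting (contrastive pretraining with linear regression downstream).** Let $\mathbb P(x)$ be a probability distribution on $\mathcal X$ with density $p$ with respect to a $\sigma$-finite reference measure $dx$. Let $\{f_\theta:\mathcal X\to\mathbb R^r\}_{\theta\in\Theta}$ be a class of measurable functions with $\|f_\theta(x)\|_2\le 1$ for all $\theta,x$, and let $\mathcal B\subseteq\{\beta\in\mathbb R^r:\|\beta\|_2\le D\}$ be invariant under orthogonal transformations of $\mathbb R^r$ (for instance the whole ball). Let $\theta^*\in\Theta$ and $\beta^*\in\mathcal B$ be the true parameters. For $t\in\{1,-1\}$ put $$p_{f_\theta}(x,x',t)=\frac{p(x)\,p(x')}{1+e^{-t f_\theta(x)^Tf_\theta(x')}}$$ (density with respect to $dx\,dx'$ and counting measure in $t$). Under the parameters $(\theta,\beta)$ a labeled pair $(x,y)$ has law $\mathbb P_{\theta,\beta}(x,y)$ given by $x\sim\mathbb P(x)$, $z=f_\theta(x)+\mu$, $y=\beta^Tz+\nu$, where $\mu\sim N(0,I_r)$, $\nu\sim N(0,1)$ and $x,\mu,\nu$ are independent. Let $g_{\theta,\beta}(x)=\mathbb E_{\theta,\beta}[y\mid x]=\beta^Tf_\theta(x)$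 be the optimal predictor for the squared loss $\ell(a,y)=(y-a)^2$, let $${\rm Error}_\ell(\theta,\beta)=\mathbb E_{\theta^*,\beta^*}\big[\ell(g_{\theta,\beta}(x),y)\big]-\mathbb E_{\theta^*,\beta^*}\big[\ell(g_{\theta^*,\beta^*}(x),y)\big],$$ and let $\tilde\ell(a,y)=\min\{(y-a)^2,L\}$ be the truncated loss with $L=36(D^2+1)\log n$. **Algorithm.** From $m\ge1$ i.i.d. unlabeled triples $(x_i,x_i',t_i)\sim p_{f_{\theta^*}}$, the first phase outputs $\hat\theta\in\arg\max_{\theta\in\Theta}\sum_{i=1}^m\log p_{f_\theta}(x_i,x_i',t_i)$, a function of the unlabeled data only, such that $f_{\hat\theta}(x)$ is jointly measurable in the data and $x$. From $n\ge2$ i.i.d. labeled pairs $(x_j,y_j)\sim\mathbb P_{\theta^*,\beta^*}(x,y)$, independent of the unlabeled data, the second phase outputs $\hat\beta\in\arg\min_{\beta\in\mathcal B}\sum_{j=1}^n\tilde\ell(g_{\hat\theta,\beta}(x_j),y_j)$. **Complexity and conditioning.** Let $N=N_{[\,]}(\mathbf P(\mathcal F_\theta),1/m^2)$ be the bracketing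 number of $\mathbf P(\mathcal F_\theta)=\{p_{f_\theta}:\theta\in\Theta\}$, i.e. the least cardinality of a set of integrable functions such that every $p_{f_\theta}$ has a member $\bar p$ of the set with $\bar p\ge p_{f_\theta}$ everywhere and $\|\bar p-p_{f_\theta}\|_1\le 1/m^2$; assume $N<\infty$. Assume that the smallest singular value $\sigma_{\min}$ of $\mathbb E[f_{\theta^*}(x)f_{\theta^*}(x)^T]$ is positive, and put $\kappa=\sqrt{1/\sigma_{\min}}$. **Theorem.** There are absolute constants $C>0$ and $k\in\mathbb N$ such that in every such setting, if $m\ge n$ or $N\ge2$, then for every $\delta\in(0,1)$, with probability at least $1-\delta$, $${\rm Error}_\ell(\hat\theta,\hat\beta)\le C\,\big(1+\log\tfrac1\delta\big)^k\left(\kappa L\sqrt{\frac{\log N}{m}}+L\sqrt{\frac1n}\right).$$ -/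

import Mathlib

open MeasureTheory ProbabilityTheory
open scoped ENNReal RealInnerProductSpace

noncomputable section

namespace Contrastive

/-- The representation space `ℝ^r` with the Euclidean norm. -/
abbrev Rep (r : ℕ) : Type := EuclideanSpace ℝ (Fin r)

/-- One unlabeled observation `(x, x', t)`; `true` stands for the label `t = 1` and `false` for
the label `t = -1`. -/
abbrev Triple (X : Type*) : Type _ := X × X × Bool

/-- The numerical value in `{1, -1}` of a similarity label. -/
def signOf (t : Bool) : ℝ := if t then 1 else -1

section Model

variable {X : Type*} [MeasurableSpace X] {r : ℕ}

/-- The distribution `ℙ(x)` of the inputs, which has density `p` with respect to the reference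
measure `ρ` (written `dx`). -/
def inputLaw (ρ : Measure X) (p : X → ℝ) : Measure X :=
  ρ.withDensity (fun x => ENNReal.ofReal (p x))

/-- The reference measure `dx dx' dt` on triples (`dt` is the counting measure on labels). -/
def refMeasure (ρ : Measure X) : Measure (Triple X) :=
  ρ.prod (ρ.prod Measure.count)

/-- The density `p_f(x, x', t) = p(x) p(x') / (1 + exp (- t f(x)ᵀ f(x')))`. -/
def tripleDensity (p : X → ℝ) (f : X → Rep r) (s : Triple X) : ℝ :=
  p s.1 * p s.2.1 * (1 / (1 + Real.exp (-(signOf s.2.2 * ⟪f s.1, f s.2.1⟫))))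

/-- The distribution `ℙ_f(x, x', t)` of one unlabeled observation. -/
def tripleLaw (ρ : Measure X) (p : X → ℝ) (f : X → Rep r) : Measure (Triple X) :=
  (refMeasure ρ).withDensity (fun s => ENNReal.ofReal (tripleDensity p f s))

/-- The law of the independent pair of noises `μ ∼ N(0, I_r)` and `ν ∼ N(0, 1)`. -/
def noiseLaw (r : ℕ) : Measure (Rep r × ℝ) :=
  (stdGaussian (Rep r)).prod (gaussianReal 0 1)

/-- The distribution `ℙ_{f, β}(x, y)` of one labeled observation: `x ∼ ℙ(x)`, the latent variable
is `z = f(x) + μ`, and `y = βᵀ z + ν`. -/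
def labeledLaw (P : Measure X) (f : X → Rep r) (β : Rep r) : Measure (X × ℝ) :=
  (P.prod (noiseLaw r)).map (fun q => (q.1, ⟪β, f q.1 + q.2.1⟫ + q.2.2))

/-- The conditional distribution `ℙ_{f, β}(y | x)`. -/
def responseLaw (f : X → Rep r) (β : Rep r) (x : X) : Measure ℝ :=
  (noiseLaw r).map (fun e => ⟪β, f x + e.1⟫ + e.2)

/-- The predictor `g_{f, β}(x) = 𝔼_{f, β}[y | x]`. -/
def predictor (f : X → Rep r) (β : Rep r) (x : X) : ℝ :=
  ∫ y, y ∂(responseLaw f β x)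

/-- The squared loss. -/
def sqLoss (a y : ℝ) : ℝ := (y - a) ^ 2

/-- The squared loss truncated at level `L`. -/
def truncLoss (L a y : ℝ) : ℝ := if (y - a) ^ 2 ≤ L then (y - a) ^ 2 else L

/-- The conditional mean is linear in the representation. -/
theorem predictor_eq {X : Type*} {r : ℕ} (f : X → Rep r) (β : Rep r) (x : X) : predictor f β x = ⟪β, f x⟫ := by
  have h1 : Integrable (fun e : Rep r × ℝ => ⟪β, e.1⟫) (noiseLaw r) := by
    have : Integrable (fun e : Rep r => ⟪β, e⟫) (stdGaussian (Rep r)) :=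
      (IsGaussian.integrable_id (μ := stdGaussian (Rep r))).const_inner β
    exact this.comp_fst _
  have h2 : Integrable (fun e : Rep r × ℝ => e.2) (noiseLaw r) :=
    (IsGaussian.integrable_id (μ := gaussianReal 0 1)).comp_snd _
  have i1 : ∫ e, ⟪β, e.1⟫ ∂(noiseLaw r) = 0 := by
    rw [noiseLaw, integral_fun_fst (f := fun e : Rep r => ⟪β, e⟫)]
    have := integral_strongDual_stdGaussian (E := Rep r) (innerSL ℝ β)
    simp only [innerSL_apply_apply] at this
    simp [this]
  have i2 : ∫ e, e.2 ∂(noiseLaw r) = 0 := by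
    rw [noiseLaw, integral_fun_snd (f := fun e : ℝ => e)]
    simp
  have : IsProbabilityMeasure (noiseLaw r) := by unfold noiseLaw; infer_instance
  rw [predictor, responseLaw, integral_map (by fun_prop) (by fun_prop)]
  simp only [inner_add_right]
  rw [integral_add (by fun_prop) h2, integral_add (by fun_prop) h1, i1, i2]
  simp

/-- `predictor f β` minimizes the risk of the squared loss under `ℙ_{f, β}` among all measurable
functions of the input. -/
theorem predictor_optimal (P : Measure X) [IsProbabilityMeasure P] (f : X → Rep r)
    (hf : Measurable f) (β : Rep r) (g : X → ℝ) (hg : Measurable g) :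
    ∫⁻ q, ENNReal.ofReal (sqLoss (predictor f β q.1) q.2) ∂(labeledLaw P f β) ≤
      ∫⁻ q, ENNReal.ofReal (sqLoss (g q.1) q.2) ∂(labeledLaw P f β) := by
  have hN : IsProbabilityMeasure (noiseLaw r) := by unfold noiseLaw; infer_instance
  have hp : Measurable (predictor f β) := by
    have : predictor f β = fun x => ⟪β, f x⟫ := funext (predictor_eq f β)
    rw [this]; fun_prop
  have hmap : Measurable (fun q : X × (Rep r × ℝ) => (q.1, ⟪β, f q.1 + q.2.1⟫ + q.2.2)) := by
    fun_prop
  have hL2 : ∀ x, MemLp (fun y : ℝ => y) 2 (responseLaw f β x) := by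
    intro x
    rw [responseLaw, memLp_map_measure_iff (by fun_prop) (by fun_prop)]
    have h1 : MemLp (fun e : Rep r × ℝ => ⟪β, e.1⟫) 2 (noiseLaw r) := by
      have : MemLp (fun e : Rep r => ⟪β, e⟫) 2 (stdGaussian (Rep r)) :=
        (IsGaussian.memLp_two_id (μ := stdGaussian (Rep r))).const_inner β
      exact this.comp_fst _
    have h2 : MemLp (fun e : Rep r × ℝ => e.2) 2 (noiseLaw r) :=
      (IsGaussian.memLp_two_id (μ := gaussianReal 0 1)).comp_snd _
    have h3 := ((memLp_const (μ := noiseLaw r) (p := 2) ⟪β, f x⟫).add h1).add h2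
    refine h3.congr_norm (by fun_prop) (Filter.Eventually.of_forall fun e => ?_)
    simp [inner_add_right]
  have key : ∀ (x : X) (c : ℝ), ∫⁻ y, ENNReal.ofReal (sqLoss (predictor f β x) y)
      ∂(responseLaw f β x) ≤ ∫⁻ y, ENNReal.ofReal (sqLoss c y) ∂(responseLaw f β x) := by
    intro x c
    have : IsProbabilityMeasure (responseLaw f β x) :=
      Measure.isProbabilityMeasure_map (by fun_prop)
    have hi : ∀ c : ℝ, Integrable (fun y => sqLoss c y) (responseLaw f β x) := fun c =>
      ((hL2 x).sub (memLp_const c)).integrable_sq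
    rw [← ofReal_integral_eq_lintegral_ofReal (hi _)
      (Filter.Eventually.of_forall fun y => sq_nonneg _),
      ← ofReal_integral_eq_lintegral_ofReal (hi _)
      (Filter.Eventually.of_forall fun y => sq_nonneg _)]
    apply ENNReal.ofReal_le_ofReal
    have hv := variance_le_expectation_sq (μ := responseLaw f β x) (X := fun y : ℝ => y + -c)
      (by fun_prop)
    rw [variance_add_const (by fun_prop), variance_eq_integral (by fun_prop)] at hv
    simpa [sqLoss, predictor, sub_eq_add_neg] using hv
  have hsplit : ∀ h : X → ℝ, Measurable h →
      ∫⁻ q, ENNReal.ofReal (sqLoss (h q.1) q.2) ∂(labeledLaw P f β) =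
        ∫⁻ x, ∫⁻ y, ENNReal.ofReal (sqLoss (h x) y) ∂(responseLaw f β x) ∂P := by
    intro h hh
    have hm : Measurable (fun q : X × ℝ => ENNReal.ofReal (sqLoss (h q.1) q.2)) := by
      unfold sqLoss; fun_prop
    have hc := (hm.comp hmap).aemeasurable (μ := P.prod (noiseLaw r))
    simp only [Function.comp_def] at hc
    rw [labeledLaw, lintegral_map hm hmap, lintegral_prod _ hc]
    refine lintegral_congr fun x => ?_
    rw [responseLaw, lintegral_map (by unfold sqLoss; fun_prop) (by fun_prop)]
  rw [hsplit _ hp, hsplit _ hg]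
  exact lintegral_mono fun x => key x (g x)

/-- The excess risk, under the squared loss and the true parameters `(fs, βs)`, of the predictor
with parameters `(f, β)`. -/
def excessRisk (P : Measure X) (fs : X → Rep r) (βs : Rep r) (f : X → Rep r) (β : Rep r) : ℝ :=
  (∫ q, sqLoss (predictor f β q.1) q.2 ∂(labeledLaw P fs βs)) -
    ∫ q, sqLoss (predictor fs βs q.1) q.2 ∂(labeledLaw P fs βs)

/-- `θ` maximizes the log-likelihood `∑ i, log p_θ(x_i, x'_i, t_i)` of the unlabeled sample. -/
def IsMLE {Θ : Type*} (p : X → ℝ) (f : Θ → X → Rep r) {m : ℕ} (u : Fin m → Triple X) (θ : Θ) :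
    Prop :=
  ∀ θ' : Θ, ∑ i, Real.log (tripleDensity p (f θ') (u i)) ≤
    ∑ i, Real.log (tripleDensity p (f θ) (u i))

/-- `β ∈ 𝓑` minimizes the empirical truncated squared loss of `g_{f, β}` over `𝓑`. -/
def IsERM (L : ℝ) (f : X → Rep r) (𝓑 : Set (Rep r)) {n : ℕ} (l : Fin n → X × ℝ) (β : Rep r) :
    Prop :=
  β ∈ 𝓑 ∧ ∀ β' ∈ 𝓑, ∑ j, truncLoss L (predictor f β (l j).1) (l j).2 ≤
    ∑ j, truncLoss L (predictor f β' (l j).1) (l j).2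

/-- The second moment matrix `𝔼[f(x) f(x)ᵀ]`. -/
def secondMoment (P : Measure X) (f : X → Rep r) : Matrix (Fin r) (Fin r) ℝ :=
  Matrix.of fun i j => ∫ x, f x i * f x j ∂P

end Model

/-- The smallest singular value of an `r × r` matrix (singular values are listed in decreasing
order, starting from index `0`). -/
def sigmaMin {r : ℕ} (M : Matrix (Fin r) (Fin r) ℝ) : ℝ :=
  (Matrix.toEuclideanLin M).singularValues (r - 1)

section Bracketing

variable {S : Type*} [MeasurableSpace S]

/-- `𝓝` is an `ε`-bracket of the class `𝓟` of functions on `S` in `L¹(μ)`. -/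
def IsBracket (μ : Measure S) (𝓟 : Set (S → ℝ)) (ε : ℝ) (𝓝 : Set (S → ℝ)) : Prop :=
  ∀ q ∈ 𝓟, ∃ b ∈ 𝓝, Integrable b μ ∧ (∀ s, q s ≤ b s) ∧ ∫ s, |b s - q s| ∂μ ≤ ε

/-- The bracketing number: the least cardinality of an `ε`-bracket (`⊤` if none is finite). -/
def bracketingNumber (μ : Measure S) (𝓟 : Set (S → ℝ)) (ε : ℝ) : ℕ∞ :=
  ⨅ (𝓝 : Set (S → ℝ)) (_ : IsBracket μ 𝓟 ε 𝓝), 𝓝.encard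

end Bracketing

end Contrastive

end

/-! ### Polar decomposition, and an operator inequality passing from squares to the operators
themselves. -/

section LinearAlgebra

variable {E : Type*} [NormedAddCommGroup E] [InnerProductSpace ℝ E] [FiniteDimensional ℝ E]

/-! The noise is centered and independent of `x`, so the excess risk of `(f, β)` is the squared
`L²(P)` distance between `⟪β, f x⟫` and `⟪βs, fs x⟫` (`excessRisk_eq`). Three estimates control it
at the output of the algorithm.

Pretraining. A triple density depends on `f` only through the kernel `⟪f x, f x'⟫`, and the sigmoid
has slope bounded below on `[-1, 1]`. Hence the Hellinger affinity of two triple densities is at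
most `1 - kernelDist / 9216`. A likelihood ratio argument applied to upper brackets, with a union
bound over the `N` brackets, shows that the maximum likelihood kernel is within `ε` of the true one
in `L²(P × P)`, where `ε²` is of order `(1 + log (N / δ)) / m` (`measure_kernelDist_mle_le`). If `N
≤ 1`, the class lies under one bracket and all its kernels are within `O(1 / m)` deterministically.

Transfer. Kernels determine representations only up to rotation. The polar decomposition of the
cross moment of `f` and `fs` gives a rotation `O` after which this moment is symmetric and positive.
Comparing it with the two second moments yields `∫ (⟪O u, f x⟫ - ⟪u, fs x⟫)² ≤ 2 ε ‖u‖²` for every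
`u` (`exists_isometry_integral_inner_sub_sq_le`). By invariance of `𝓑`, the parameter `O βs` is
admissible, and its excess risk is at most `2 ε D²`. This bound involves neither the dimension nor
the conditioning of the second moment; `κ` enters the final estimate only through `κ ≥ 1`.

Regression. Conditionally on the unlabeled sample the representation is fixed. The truncated loss
takes values in `[0, L]` and is `2 √L`-Lipschitz in the prediction, so symmetrization, contraction
and McDiarmid's inequality bound the uniform deviation by `O(L (1 + log (1 / δ)) / √n)`, again
without the dimension (`measure_exists_le_sum_le`). Gaussian tails make the cost of truncation
`O((D² + 1) / n)`. Comparing the empirical minimizer with `O βs` finishes the proof. -/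

/-- Polar decomposition of an endomorphism of a finite-dimensional real inner product space. -/
theorem LinearMap.exists_polar_decomposition (A : E →ₗ[ℝ] E) :
    ∃ O : E ≃ₗᵢ[ℝ] E, ∃ T : E →ₗ[ℝ] E, T.IsSymmetric ∧ (∀ v, 0 ≤ ⟪T v, v⟫) ∧
      ∀ v, A v = O (T v) := by
  have hS := A.isPositive_adjoint_comp_self.isSymmetric
  set e := hS.eigenvectorBasis rfl
  set l := hS.eigenvalues rfl
  have hAA : ∀ i j, ⟪A (e i), A (e j)⟫ = if i = j then l j else 0 := by
    intro i j
    rw [← LinearMap.adjoint_inner_right]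
    have : (LinearMap.adjoint A) (A (e j)) = l j • e j := by
      exact hS.apply_eigenvectorBasis rfl j
    rw [this, inner_smul_right, e.inner_eq_ite]
    split_ifs <;> simp
  have hl : ∀ i, 0 ≤ l i := fun i => by
    have := hAA i i
    rw [if_pos rfl] at this
    rw [← this]; exact real_inner_self_nonneg
  -- The normalized images of the eigenvectors with nonzero eigenvalue are orthonormal. On the
  -- remaining eigenvectors `A` vanishes, so any completion `g` to an orthonormal basis works; `O`
  -- sends `e i` to `g i`, and `T = O⁻¹ A` is diagonal with entries `√(l i)`.
  have horth : Orthonormal ℝ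
      (({i | l i ≠ 0} : Set _).domRestrict fun i => (Real.sqrt (l i))⁻¹ • A (e i)) := by
    rw [orthonormal_iff_ite]
    rintro ⟨i, hi⟩ ⟨j, hj⟩
    simp only [Set.domRestrict_apply, inner_smul_left, inner_smul_right, hAA, Subtype.mk.injEq]
    split_ifs with h
    · subst h
      have h1 : Real.sqrt (l i) * Real.sqrt (l i) = l i := Real.mul_self_sqrt (hl i)
      have h2 : Real.sqrt (l i) ≠ 0 := (Real.sqrt_ne_zero (hl i)).2 hi
      simp only [conj_trivial]
      field_simp
      nlinarith
    · simp
  obtain ⟨g, hg⟩ := horth.exists_orthonormalBasis_extension_of_card_eq (by simp)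
  have hAe : ∀ i, A (e i) = Real.sqrt (l i) • g i := by
    intro i
    by_cases h : l i = 0
    · have := hAA i i
      rw [if_pos rfl, h, inner_self_eq_zero] at this
      rw [this, h]; simp
    · rw [hg i h, smul_smul, mul_inv_cancel₀ ((Real.sqrt_ne_zero (hl i)).2 h), one_smul]
  have hO : ∀ i, (e.equiv g (Equiv.refl _)).symm (g i) = e i := by
    intro i; rw [LinearIsometryEquiv.symm_apply_eq]; simp
  set O := e.equiv g (Equiv.refl _)
  let T : E →ₗ[ℝ] E := O.symm.toLinearEquiv.toLinearMap ∘ₗ A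
  have hT : ∀ u v, ⟪T u, v⟫ = ∑ i, Real.sqrt (l i) * (⟪e i, u⟫ * ⟪e i, v⟫) := by
    intro u v
    have : T u = ∑ i, ⟪e i, u⟫ • (Real.sqrt (l i) • e i) := by
      conv_lhs => rw [← e.sum_repr' u]
      rw [map_sum]
      refine Finset.sum_congr rfl fun i _ => ?_
      rw [map_smul]
      simp [T, hAe, hO]
    rw [this, sum_inner]
    refine Finset.sum_congr rfl fun i _ => ?_
    rw [inner_smul_left, inner_smul_left]
    simp; ring
  refine ⟨O, T, fun u v => ?_, fun v => ?_, fun v => by simp [T]⟩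
  · rw [real_inner_comm (T v) u, hT, hT]
    exact Finset.sum_congr rfl fun i _ => by ring
  · rw [hT]
    exact Finset.sum_nonneg fun i _ => mul_nonneg (Real.sqrt_nonneg _) (mul_self_nonneg _)

/-- If `P² ≤ M² + ε P` with `P` symmetric and `M` positive, then `P ≤ M + ε`. -/
theorem LinearMap.IsSymmetric.inner_sub_le_of_sq_le {P M : E →ₗ[ℝ] E} (hP : P.IsSymmetric)
    (hM : M.IsSymmetric) (hM0 : ∀ v, 0 ≤ ⟪M v, v⟫) {ε : ℝ}
    (h : ∀ v, ‖P v‖ ^ 2 ≤ ‖M v‖ ^ 2 + ε * ⟪P v, v⟫) (hε : 0 ≤ ε) (v : E) :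
    ⟪P v, v⟫ - ⟪M v, v⟫ ≤ ε * ‖v‖ ^ 2 := by
  have hS : (P - M).IsSymmetric := hP.sub hM
  set e := hS.eigenvectorBasis rfl
  set l := hS.eigenvalues rfl
  have he : ∀ i, (P - M) (e i) = l i • e i := fun i => by
    simpa using hS.apply_eigenvectorBasis rfl i
  have hl : ∀ i, l i ≤ ε := by
    intro i
    -- On a unit eigenvector with eigenvalue `l > ε`, substituting `P e = M e + l e` into the
    -- hypothesis gives `(2 l - ε) ⟪M e, e⟫ + l (l - ε) ≤ 0`, which is impossible because `⟪M e, e⟫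
    -- ≥ 0`.
    by_contra! hlt
    have h1 : P (e i) = M (e i) + l i • e i := by
      rw [← he i]; simp
    have h2 := h (e i)
    have hn : ⟪e i, e i⟫ = 1 := by rw [e.inner_eq_ite]; simp
    rw [h1, ← real_inner_self_eq_norm_sq, ← real_inner_self_eq_norm_sq] at h2
    simp only [inner_add_left, inner_add_right, inner_smul_left, inner_smul_right, hn,
      conj_trivial] at h2
    rw [real_inner_comm (M (e i)) (e i)] at h2
    have h3 := hM0 (e i)
    rw [real_inner_comm] at h3
    simp only [real_inner_comm (e i) (M (e i))] at h2 h3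
    nlinarith [mul_nonneg h3 (sub_nonneg.2 hlt.le), mul_pos (lt_of_le_of_lt hε hlt) (sub_pos.2 hlt)]
  have hexp : ⟪(P - M) v, v⟫ = ∑ i, l i * ⟪e i, v⟫ ^ 2 := by
    conv_lhs => rw [← e.sum_repr' v]
    rw [map_sum, sum_inner]
    refine Finset.sum_congr rfl fun i _ => ?_
    rw [map_smul, he, inner_smul_left, inner_smul_left, e.sum_repr' v]
    simp; ring
  have hnorm : ‖v‖ ^ 2 = ∑ i, ⟪e i, v⟫ ^ 2 := by
    rw [← e.sum_sq_norm_inner_right v]; simp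
  rw [← inner_sub_left, ← LinearMap.sub_apply, hexp, hnorm, Finset.mul_sum]
  exact Finset.sum_le_sum fun i _ => mul_le_mul_of_nonneg_right (hl i) (sq_nonneg _)

end LinearAlgebra

/-! ### From closeness of kernels to closeness of representations up to a rotation. -/

section SecondMoments

variable {X : Type*} [MeasurableSpace X] {E : Type*} [NormedAddCommGroup E]
  [InnerProductSpace ℝ E]

theorem abs_inner_le_norm_of_norm_le_one {a : E} (ha : ‖a‖ ≤ 1) (v : E) : |⟪a, v⟫| ≤ ‖v‖ :=
  (abs_real_inner_le_norm a v).trans (mul_le_of_le_one_left (norm_nonneg v) ha)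

theorem abs_inner_le_one {a b : E} (ha : ‖a‖ ≤ 1) (hb : ‖b‖ ≤ 1) : |⟪a, b⟫| ≤ 1 :=
  (abs_inner_le_norm_of_norm_le_one ha b).trans hb

variable [FiniteDimensional ℝ E] [MeasurableSpace E] [BorelSpace E]

theorem integrable_inner_smul_of_norm_le_one (P : Measure X) [IsFiniteMeasure P] {a b : X → E}
    (ha : Measurable a) (hb : Measurable b) (ha1 : ∀ x, ‖a x‖ ≤ 1) (hb1 : ∀ x, ‖b x‖ ≤ 1) (v : E) :
    Integrable (fun x => ⟪b x, v⟫ • a x) P := by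
  refine Integrable.of_bound (by fun_prop) ‖v‖ (Filter.Eventually.of_forall fun x => ?_)
  rw [norm_smul, Real.norm_eq_abs]
  exact (mul_le_of_le_one_right (abs_nonneg _) (ha1 x)).trans
    (abs_inner_le_norm_of_norm_le_one (hb1 x) v)

/-- The cross moment operator `v ↦ 𝔼[⟪b, v⟫ a]`. -/
noncomputable def crossMoment (P : Measure X) [IsFiniteMeasure P] {a b : X → E}
    (ha : Measurable a) (hb : Measurable b) (ha1 : ∀ x, ‖a x‖ ≤ 1) (hb1 : ∀ x, ‖b x‖ ≤ 1) :
    E →ₗ[ℝ] E where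
  toFun v := ∫ x, ⟪b x, v⟫ • a x ∂P
  map_add' u v := by
    rw [← integral_add (integrable_inner_smul_of_norm_le_one P ha hb ha1 hb1 u)
      (integrable_inner_smul_of_norm_le_one P ha hb ha1 hb1 v)]
    simp only [inner_add_right, add_smul]
  map_smul' c v := by
    simp only [inner_smul_right, mul_smul, integral_smul, RingHom.id_apply]

theorem inner_crossMoment (P : Measure X) [IsFiniteMeasure P] {a b : X → E}
    (ha : Measurable a) (hb : Measurable b) (ha1 : ∀ x, ‖a x‖ ≤ 1) (hb1 : ∀ x, ‖b x‖ ≤ 1)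
    (u v : E) :
    ⟪crossMoment P ha hb ha1 hb1 v, u⟫ = ∫ x, ⟪b x, v⟫ * ⟪a x, u⟫ ∂P := by
  rw [real_inner_comm, crossMoment, LinearMap.coe_mk, AddHom.coe_mk,
    ← integral_inner (integrable_inner_smul_of_norm_le_one P ha hb ha1 hb1 v)]
  refine integral_congr_ae (Filter.Eventually.of_forall fun x => ?_)
  simp only [inner_smul_right, real_inner_comm u]

/-- Writing the square as a double integral shows that, once the weights `⟪b, v⟫` are fixed, the
norm depends on `a` only through its kernel. Changing the kernel therefore changes this norm by a
kernel quadratic form. -/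
theorem norm_crossMoment_sq (P : Measure X) [IsFiniteMeasure P] {a b : X → E}
    (ha : Measurable a) (hb : Measurable b) (ha1 : ∀ x, ‖a x‖ ≤ 1) (hb1 : ∀ x, ‖b x‖ ≤ 1)
    (v : E) :
    ‖crossMoment P ha hb ha1 hb1 v‖ ^ 2 =
      ∫ q : X × X, ⟪b q.1, v⟫ * ⟪b q.2, v⟫ * ⟪a q.1, a q.2⟫ ∂(P.prod P) := by
  have hint : Integrable (fun q : X × X => ⟪b q.1, v⟫ * ⟪b q.2, v⟫ * ⟪a q.1, a q.2⟫)
      (P.prod P) := by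
    refine Integrable.of_bound (by fun_prop) (‖v‖ * ‖v‖)
      (Filter.Eventually.of_forall fun q => ?_)
    rw [Real.norm_eq_abs, abs_mul, abs_mul]
    have h1 := abs_inner_le_norm_of_norm_le_one (hb1 q.1) v
    have h2 := abs_inner_le_norm_of_norm_le_one (hb1 q.2) v
    have h3 := (abs_inner_le_norm_of_norm_le_one (ha1 q.1) (a q.2)).trans (ha1 q.2)
    refine (mul_le_of_le_one_right (by positivity) h3).trans ?_
    gcongr
  rw [integral_prod _ hint, ← real_inner_self_eq_norm_sq, inner_crossMoment]
  refine integral_congr_ae (Filter.Eventually.of_forall fun x => ?_)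
  simp only
  rw [real_inner_comm (crossMoment P ha hb ha1 hb1 v), inner_crossMoment, ← integral_const_mul]
  refine integral_congr_ae (Filter.Eventually.of_forall fun x' => ?_)
  simp only [real_inner_comm (a x) (a x')]
  ring

/-- A kernel operator is bounded by the Hilbert-Schmidt norm of its kernel. -/
theorem integral_mul_mul_kernel_le (P : Measure X) [IsFiniteMeasure P] {h : X → ℝ}
    {K : X × X → ℝ} (hh : Measurable h) (hK : Measurable K) {c d ε : ℝ} (hc : ∀ x, |h x| ≤ c)
    (hd : ∀ q, |K q| ≤ d) (hε : 0 ≤ ε) (hKε : ∫ q, K q ^ 2 ∂(P.prod P) ≤ ε ^ 2) :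
    ∫ q : X × X, h q.1 * h q.2 * K q ∂(P.prod P) ≤ ε * ∫ x, h x ^ 2 ∂P := by
  have bd : ∀ g : X × X → ℝ, Measurable g → ∀ C : ℝ, (∀ q, |g q| ≤ C) → Integrable g (P.prod P) :=
    fun g hg C hC => Integrable.of_bound hg.aestronglyMeasurable C
      (Filter.Eventually.of_forall hC)
  have hhh : ∀ q : X × X, |h q.1 * h q.2| ≤ c * c := fun q => by
    rw [abs_mul]
    exact mul_le_mul (hc _) (hc _) (abs_nonneg _) ((abs_nonneg _).trans (hc q.1))
  have i1 : Integrable (fun q : X × X => (h q.1 * h q.2) ^ 2) (P.prod P) :=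
    bd _ (by fun_prop) ((c * c) ^ 2) fun q => by
      rw [abs_pow]; exact pow_le_pow_left₀ (abs_nonneg _) (hhh q) 2
  have i2 : Integrable (fun q : X × X => h q.1 * h q.2 * K q) (P.prod P) :=
    bd _ (by fun_prop) (c * c * d) fun q => by
      rw [abs_mul]
      exact mul_le_mul (hhh q) (hd q) (abs_nonneg _) ((abs_nonneg _).trans (hhh q))
  have i3 : Integrable (fun q : X × X => K q ^ 2) (P.prod P) :=
    bd _ (by fun_prop) (d ^ 2) fun q => by
      rw [abs_pow]; exact pow_le_pow_left₀ (abs_nonneg _) (hd q) 2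
  have hA : ∫ q : X × X, (h q.1 * h q.2) ^ 2 ∂(P.prod P) = (∫ x, h x ^ 2 ∂P) ^ 2 := by
    simp only [mul_pow]
    rw [integral_prod_mul (fun x => h x ^ 2) (fun x => h x ^ 2), sq]
  have hV : 0 ≤ ∫ x, h x ^ 2 ∂P := integral_nonneg fun x => sq_nonneg _
  -- Cauchy–Schwarz on `P × P`, obtained from the nonnegative quadratic `s ↦ ∫ (s h(x) h(x') - K)²`.
  have hdis := discrim_le_zero (a := (∫ x, h x ^ 2 ∂P) ^ 2)
    (b := -(2 * ∫ q : X × X, h q.1 * h q.2 * K q ∂(P.prod P)))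
    (c := ∫ q, K q ^ 2 ∂(P.prod P)) (fun s => by
      have h0 : 0 ≤ ∫ q : X × X, (s * (h q.1 * h q.2) - K q) ^ 2 ∂(P.prod P) :=
        integral_nonneg fun q => sq_nonneg _
      have : ∀ q : X × X, (s * (h q.1 * h q.2) - K q) ^ 2 = s * s * (h q.1 * h q.2) ^ 2
          + (-2 * s) * (h q.1 * h q.2 * K q) + K q ^ 2 := fun q => by ring
      simp only [this] at h0
      have i12 : Integrable (fun q : X × X => s * s * (h q.1 * h q.2) ^ 2
          + (-2 * s) * (h q.1 * h q.2 * K q)) (P.prod P) :=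
        (i1.const_mul _).add (i2.const_mul _)
      rw [integral_add i12 i3, integral_add (i1.const_mul _) (i2.const_mul _), integral_const_mul, integral_const_mul,
        hA] at h0
      linarith)
  rw [discrim] at hdis
  refine (le_abs_self _).trans (abs_le_of_sq_le_sq ?_ (mul_nonneg hε hV))
  nlinarith [mul_le_mul_of_nonneg_left hKε (sq_nonneg (∫ x, h x ^ 2 ∂P))]

/-- If the cross moment of `a` and `b` is symmetric and positive, closeness of the kernels of `a`
and `b` implies closeness of `a` and `b` in every direction. -/
theorem integral_inner_sub_sq_le_of_crossMoment_symmetric (P : Measure X) [IsFiniteMeasure P]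
    {a b : X → E} (ha : Measurable a) (hb : Measurable b) (ha1 : ∀ x, ‖a x‖ ≤ 1)
    (hb1 : ∀ x, ‖b x‖ ≤ 1) (hM : (crossMoment P ha hb ha1 hb1).IsSymmetric)
    (hM0 : ∀ v, 0 ≤ ⟪crossMoment P ha hb ha1 hb1 v, v⟫) {ε : ℝ} (hε : 0 ≤ ε)
    (hK : ∫ q : X × X, (⟪a q.1, a q.2⟫ - ⟪b q.1, b q.2⟫) ^ 2 ∂(P.prod P) ≤ ε ^ 2) (u : E) :
    ∫ x, (⟪a x, u⟫ - ⟪b x, u⟫) ^ 2 ∂P ≤ 2 * ε * ‖u‖ ^ 2 := by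
  have bd : ∀ g : X → ℝ, Measurable g → ∀ C : ℝ, (∀ q, |g q| ≤ C) → Integrable g P :=
    fun g hg C hC => Integrable.of_bound hg.aestronglyMeasurable C
      (Filter.Eventually.of_forall hC)
  have bd2 : ∀ g : X × X → ℝ, Measurable g → ∀ C : ℝ, (∀ q, |g q| ≤ C) → Integrable g (P.prod P) :=
    fun g hg C hC => Integrable.of_bound hg.aestronglyMeasurable C
      (Filter.Eventually.of_forall hC)
  have hMba : ∀ v, crossMoment P hb ha hb1 ha1 v = crossMoment P ha hb ha1 hb1 v := by
    intro v
    refine ext_inner_right ℝ fun w => ?_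
    rw [hM v w, real_inner_comm _ v, inner_crossMoment, inner_crossMoment]
    exact integral_congr_ae (Filter.Eventually.of_forall fun x => mul_comm _ _)
  have hsymm : ∀ {d : X → E} (hd : Measurable d) (hd1 : ∀ x, ‖d x‖ ≤ 1),
      (crossMoment P hd hd hd1 hd1).IsSymmetric := by
    intro d hd hd1 v w
    rw [← real_inner_comm v, inner_crossMoment, inner_crossMoment]
    exact integral_congr_ae (Filter.Eventually.of_forall fun x => mul_comm _ _)
  -- With the weights `⟪d, v⟫` in both norms, the difference of squares is a quadratic form in the
  -- difference of the kernels. It is at most `ε ∫ ⟪d, v⟫²`, which is `ε` times the second moment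
  -- form of `d`.
  have key : ∀ {d e : X → E} (hd : Measurable d) (he : Measurable e) (hd1 : ∀ x, ‖d x‖ ≤ 1)
      (he1 : ∀ x, ‖e x‖ ≤ 1),
      ∫ q : X × X, (⟪d q.1, d q.2⟫ - ⟪e q.1, e q.2⟫) ^ 2 ∂(P.prod P) ≤ ε ^ 2 →
      ∀ v, ‖crossMoment P hd hd hd1 hd1 v‖ ^ 2 ≤ ‖crossMoment P he hd he1 hd1 v‖ ^ 2
        + ε * ⟪crossMoment P hd hd hd1 hd1 v, v⟫ := by
    intro d e hd he hd1 he1 hde v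
    have hb : ∀ x, |⟪d x, v⟫| ≤ ‖v‖ := fun x => abs_inner_le_norm_of_norm_le_one (hd1 x) v
    have hbb : ∀ q : X × X, |⟪d q.1, v⟫ * ⟪d q.2, v⟫| ≤ ‖v‖ * ‖v‖ := fun q => by
      rw [abs_mul]; exact mul_le_mul (hb _) (hb _) (abs_nonneg _) (norm_nonneg _)
    have hi : ∀ {c : X → E}, Measurable c → (∀ x, ‖c x‖ ≤ 1) →
        Integrable (fun q : X × X => ⟪d q.1, v⟫ * ⟪d q.2, v⟫ * ⟪c q.1, c q.2⟫) (P.prod P) :=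
      fun {c} hc hc1 => bd2 _ (by fun_prop) (‖v‖ * ‖v‖) fun q => by
        rw [abs_mul]
        exact (mul_le_of_le_one_right (abs_nonneg _) (abs_inner_le_one (hc1 _) (hc1 _))).trans
          (hbb q)
    have := integral_mul_mul_kernel_le P (h := fun x => ⟪d x, v⟫)
      (K := fun q : X × X => ⟪d q.1, d q.2⟫ - ⟪e q.1, e q.2⟫) (by fun_prop) (by fun_prop)
      (c := ‖v‖) (d := 2) hb (fun q => (abs_sub _ _).trans (by
        linarith [abs_inner_le_one (hd1 q.1) (hd1 q.2), abs_inner_le_one (he1 q.1) (he1 q.2)]))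
      hε hde
    rw [norm_crossMoment_sq, norm_crossMoment_sq, inner_crossMoment, ← sub_le_iff_le_add',
      ← integral_sub (hi hd hd1) (hi he he1)]
    simpa only [mul_sub, sq] using this
  have h1 := (hsymm ha ha1).inner_sub_le_of_sq_le hM hM0 (fun v => by
    rw [← hMba]; exact key ha hb ha1 hb1 hK v) hε u
  have h2 := (hsymm hb hb1).inner_sub_le_of_sq_le hM hM0 (fun v => by
    refine key hb ha hb1 ha1 ?_ v
    refine le_of_eq_of_le (integral_congr_ae (Filter.Eventually.of_forall fun x => ?_)) hK
    simp only; ring) hε u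
  rw [inner_crossMoment, inner_crossMoment] at h1 h2
  have hi : ∀ {c d : X → E}, Measurable c → Measurable d → (∀ x, ‖c x‖ ≤ 1) → (∀ x, ‖d x‖ ≤ 1) →
      Integrable (fun x => ⟪c x, u⟫ * ⟪d x, u⟫) P :=
    fun hc hd hc1 hd1 => bd _ (by fun_prop) (‖u‖ * ‖u‖) fun x => by
      rw [abs_mul]
      exact mul_le_mul (abs_inner_le_norm_of_norm_le_one (hc1 x) u)
        (abs_inner_le_norm_of_norm_le_one (hd1 x) u) (abs_nonneg _) (norm_nonneg _)
  -- The expanded integral is `⟪A u, u⟫ + ⟪B u, u⟫ - 2 ⟪M u, u⟫`, with `A`, `B` the second moments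
  -- and `M` the cross moment; `h1` and `h2` each contribute `ε ‖u‖²`.
  have hexp : ∀ x, (⟪a x, u⟫ - ⟪b x, u⟫) ^ 2 = ⟪a x, u⟫ * ⟪a x, u⟫ + ⟪b x, u⟫ * ⟪b x, u⟫
      + (-2) * (⟪b x, u⟫ * ⟪a x, u⟫) := fun x => by ring
  simp only [hexp]
  have hi2 : Integrable (fun x => ⟪a x, u⟫ * ⟪a x, u⟫ + ⟪b x, u⟫ * ⟪b x, u⟫) P :=
    (hi ha ha ha1 ha1).add (hi hb hb hb1 hb1)
  rw [integral_add hi2 ((hi hb ha hb1 ha1).const_mul _),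
    integral_add (hi ha ha ha1 ha1) (hi hb hb hb1 hb1), integral_const_mul]
  linarith

/-- If the kernels of `a` and `b` are close in `L²`, then `a` is close to `b` in every direction
up to an orthogonal transformation. -/
theorem exists_isometry_integral_inner_sub_sq_le (P : Measure X) [IsFiniteMeasure P]
    {a b : X → E} (ha : Measurable a) (hb : Measurable b) (ha1 : ∀ x, ‖a x‖ ≤ 1)
    (hb1 : ∀ x, ‖b x‖ ≤ 1) {ε : ℝ} (hε : 0 ≤ ε)
    (hK : ∫ q : X × X, (⟪a q.1, a q.2⟫ - ⟪b q.1, b q.2⟫) ^ 2 ∂(P.prod P) ≤ ε ^ 2) :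
    ∃ O : E ≃ₗᵢ[ℝ] E, ∀ u, ∫ x, (⟪O u, a x⟫ - ⟪u, b x⟫) ^ 2 ∂P ≤ 2 * ε * ‖u‖ ^ 2 := by
  obtain ⟨O, T, hT, hT0, hOT⟩ := (crossMoment P ha hb ha1 hb1).exists_polar_decomposition
  -- Replacing `a` by `O⁻¹ a` leaves its kernel unchanged and turns the cross moment into the
  -- positive factor `T`.
  have ha' : Measurable fun x => O.symm (a x) := O.symm.continuous.measurable.comp ha
  have ha1' : ∀ x, ‖O.symm (a x)‖ ≤ 1 := fun x => by rw [LinearIsometryEquiv.norm_map]; exact ha1 x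
  have hC : crossMoment P ha' hb ha1' hb1 = T := by
    ext v
    refine ext_inner_right ℝ fun w => ?_
    rw [inner_crossMoment, ← O.inner_map_map (T v) w, ← hOT, inner_crossMoment]
    refine integral_congr_ae (Filter.Eventually.of_forall fun x => ?_)
    simp only
    rw [← O.inner_map_map (O.symm (a x)) w, O.apply_symm_apply]
  refine ⟨O, fun u => ?_⟩
  have := integral_inner_sub_sq_le_of_crossMoment_symmetric P ha' hb ha1' hb1 (hC ▸ hT)
    (hC ▸ hT0) hε (by simpa only [LinearIsometryEquiv.inner_map_map] using hK) u
  refine le_of_eq_of_le (integral_congr_ae (Filter.Eventually.of_forall fun x => ?_)) this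
  simp only
  rw [← O.inner_map_map (O.symm (a x)) u, O.apply_symm_apply, real_inner_comm (a x),
    real_inner_comm (b x)]

end SecondMoments

/-! ### Exponential moments and tails of functions with bounded differences. -/

section BoundedDifferences

variable {Z : Type*} [MeasurableSpace Z]

theorem measurable_finCons {n : ℕ} :
    Measurable fun q : Z × (Fin n → Z) => (Fin.cons q.1 q.2 : Fin (n + 1) → Z) := by
  rw [measurable_pi_iff]
  intro i
  refine Fin.cases ?_ (fun j => ?_) i
  · simpa using measurable_fst
  · simp only [Fin.cons_succ]
    fun_prop

/-- Fubini for a power of a probability measure, splitting off the first coordinate. -/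
theorem integral_pi_succ (μ : Measure Z) [IsProbabilityMeasure μ] {n : ℕ}
    {g : (Fin (n + 1) → Z) → ℝ} (hg : Measurable g) {B : ℝ} (hB : ∀ z, |g z| ≤ B) :
    ∫ z, g z ∂(Measure.pi fun _ : Fin (n + 1) => μ) =
      ∫ z, ∫ z₀, g (Fin.cons z₀ z) ∂μ ∂(Measure.pi fun _ : Fin n => μ) := by
  have h := ((measurePreserving_piFinSuccAbove (fun _ : Fin (n + 1) => μ) 0).symm).integral_comp'
    (g := g)
  rw [← h]
  have h2 : ∀ q : Z × (Fin n → Z),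
      (MeasurableEquiv.piFinSuccAbove (fun _ : Fin (n + 1) => Z) 0).symm q = Fin.cons q.1 q.2 := by
    intro q
    simp [MeasurableEquiv.piFinSuccAbove, Fin.insertNthEquiv]
  simp only [h2]
  rw [integral_prod_symm]
  exact Integrable.of_bound (hg.comp measurable_finCons).aestronglyMeasurable B
    (Filter.Eventually.of_forall fun q => hB _)

/-- McDiarmid's inequality for the moment generating function. -/
theorem integral_exp_sub_integral_le (μ : Measure Z) [IsProbabilityMeasure μ] {c : ℝ} {n : ℕ}
    {g : (Fin n → Z) → ℝ} (hg : Measurable g) {B : ℝ} (hB : ∀ z, |g z| ≤ B)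
    (hc : ∀ z i w, |g (Function.update z i w) - g z| ≤ c) (t : ℝ) :
    ∫ z, Real.exp (t * (g z - ∫ z', g z' ∂(Measure.pi fun _ : Fin n => μ)))
      ∂(Measure.pi fun _ : Fin n => μ) ≤ Real.exp (n * (c / 2) ^ 2 * t ^ 2 / 2) := by
  induction n with
  | zero =>
    have : ∀ z z' : Fin 0 → Z, g z = g z' := fun z z' => by rw [Subsingleton.elim z z']
    have h0 : ∀ z : Fin 0 → Z, g z - ∫ z', g z' ∂(Measure.pi fun _ : Fin 0 => μ) = 0 := by
      intro z
      rw [integral_congr_ae (Filter.Eventually.of_forall fun z' => this z' z)]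
      simp
    simp [h0]
  | succ n ih =>
    set m := ∫ z', g z' ∂(Measure.pi fun _ : Fin (n + 1) => μ)
    -- Averaging out the first coordinate preserves the bound and the bounded differences. The
    -- induction applies to `h`, and the fluctuation of the first coordinate is treated
    -- conditionally on the others.
    set h : (Fin n → Z) → ℝ := fun z => ∫ z₀, g (Fin.cons z₀ z) ∂μ
    have hgc : Measurable fun q : Z × (Fin n → Z) => g (Fin.cons q.1 q.2) :=
      hg.comp measurable_finCons
    have hgc' : ∀ z : Fin n → Z, Measurable fun z₀ : Z => g (Fin.cons z₀ z) := fun z =>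
      hgc.comp (measurable_id.prodMk measurable_const)
    have hgi : ∀ z : Fin n → Z, Integrable (fun z₀ : Z => g (Fin.cons z₀ z)) μ := fun z =>
      Integrable.of_bound (hgc' z).aestronglyMeasurable B (Filter.Eventually.of_forall fun q => hB _)
    have hh : Measurable h := by
      have : StronglyMeasurable (Function.uncurry fun (z : Fin n → Z) (z₀ : Z) =>
          g (Fin.cons z₀ z)) := (hgc.comp measurable_swap).stronglyMeasurable
      exact this.integral_prod_right.measurable
    have hhB : ∀ z, |h z| ≤ B := fun z => by
      have := norm_integral_le_of_norm_le_const (μ := μ) (f := fun z₀ => g (Fin.cons z₀ z))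
        (Filter.Eventually.of_forall fun z₀ => hB (Fin.cons z₀ z))
      simpa using this
    have hhc : ∀ z i w, |h (Function.update z i w) - h z| ≤ c := by
      intro z i w
      rw [← integral_sub (hgi _) (hgi _)]
      have := norm_integral_le_of_norm_le_const (μ := μ)
        (f := fun z₀ => g (Fin.cons z₀ (Function.update z i w)) - g (Fin.cons z₀ z)) (C := c)
        (Filter.Eventually.of_forall fun z₀ => by
          rw [Fin.cons_update]; exact hc _ _ _)
      simpa using this
    have hm : m = ∫ z, h z ∂(Measure.pi fun _ : Fin n => μ) := integral_pi_succ μ hg hB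
    have hinner : ∀ z, ∫ z₀, Real.exp (t * (g (Fin.cons z₀ z) - h z)) ∂μ ≤
        Real.exp ((c / 2) ^ 2 * t ^ 2 / 2) := by
      intro z
      have hne : Nonempty Z := μ.nonempty_of_neZero
      set a := ⨅ z₀, g (Fin.cons z₀ z)
      have hbd : BddBelow (Set.range fun z₀ => g (Fin.cons z₀ z)) :=
        ⟨-B, by rintro _ ⟨z₀, rfl⟩; exact (abs_le.1 (hB _)).1⟩
      -- For fixed remaining coordinates the values lie in an interval of length `c`, so Hoeffding's
      -- lemma gives variance proxy `(c / 2)²`.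
      have hmem : ∀ z₀, g (Fin.cons z₀ z) ∈ Set.Icc a (a + c) := by
        intro z₀
        refine ⟨ciInf_le hbd z₀, ?_⟩
        rw [← sub_le_iff_le_add]
        refine le_ciInf fun z₁ => ?_
        have := hc (Fin.cons z₁ z : Fin (n + 1) → Z) 0 z₀
        rw [Fin.update_cons_zero] at this
        linarith [(abs_le.1 this).2]
      have hs := (hasSubgaussianMGF_of_mem_Icc (μ := μ) (hgc' z).aemeasurable
        (Filter.Eventually.of_forall hmem)).mgf_le t
      refine hs.trans (le_of_eq ?_)
      simp only [add_sub_cancel_left, NNReal.coe_pow, NNReal.coe_div, coe_nnnorm,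
        Real.norm_eq_abs, NNReal.coe_ofNat, div_pow, sq_abs]
    have hM : ∀ z, Real.exp (t * (g z - m)) ≤ Real.exp (|t| * (B + |m|)) := fun z => by
      refine Real.exp_le_exp.2 ((le_abs_self _).trans ?_)
      rw [abs_mul]
      exact mul_le_mul_of_nonneg_left ((abs_sub _ _).trans (by linarith [hB z])) (abs_nonneg _)
    have hM' : ∀ z, Real.exp (t * (h z - m)) ≤ Real.exp (|t| * (B + |m|)) := fun z => by
      refine Real.exp_le_exp.2 ((le_abs_self _).trans ?_)
      rw [abs_mul]
      exact mul_le_mul_of_nonneg_left ((abs_sub _ _).trans (by linarith [hhB z])) (abs_nonneg _)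
    rw [integral_pi_succ μ (B := Real.exp (|t| * (B + |m|))) (by fun_prop)
      (fun z => by rw [abs_of_pos (Real.exp_pos _)]; exact hM z)]
    have hsplit : ∀ z, ∫ z₀, Real.exp (t * (g (Fin.cons z₀ z) - m)) ∂μ ≤
        Real.exp ((c / 2) ^ 2 * t ^ 2 / 2) * Real.exp (t * (h z - m)) := by
      intro z
      have : ∀ z₀, Real.exp (t * (g (Fin.cons z₀ z) - m)) =
          Real.exp (t * (g (Fin.cons z₀ z) - h z)) * Real.exp (t * (h z - m)) := fun z₀ => by
        rw [← Real.exp_add]; ring_nf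
      simp only [this, integral_mul_const]
      exact mul_le_mul_of_nonneg_right (hinner z) (Real.exp_pos _).le
    refine (integral_mono_of_nonneg (Filter.Eventually.of_forall fun z =>
      integral_nonneg fun _ => (Real.exp_pos _).le) ?_ (Filter.Eventually.of_forall hsplit)).trans ?_
    · refine Integrable.const_mul (Integrable.of_bound (by fun_prop) (Real.exp (|t| * (B + |m|)))
        (Filter.Eventually.of_forall fun z => ?_)) _
      rw [Real.norm_eq_abs, abs_of_pos (Real.exp_pos _)]; exact hM' z
    · rw [integral_const_mul, hm]
      refine (mul_le_mul_of_nonneg_left (ih hh hhB hhc) (Real.exp_pos _).le).trans (le_of_eq ?_)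
      rw [← Real.exp_add]
      push_cast
      ring_nf

/-- McDiarmid's bounded differences inequality. -/
theorem measureReal_add_integral_le_of_bounded_differences (μ : Measure Z)
    [IsProbabilityMeasure μ] {c : ℝ} {n : ℕ} {g : (Fin n → Z) → ℝ} (hg : Measurable g) {B : ℝ}
    (hB : ∀ z, |g z| ≤ B) (hc : ∀ z i w, |g (Function.update z i w) - g z| ≤ c) {s : ℝ}
    (hs : 0 ≤ s) :
    (Measure.pi fun _ : Fin n => μ).real
      {z | s ≤ g z - ∫ z', g z' ∂(Measure.pi fun _ : Fin n => μ)} ≤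
        Real.exp (-(2 * s ^ 2 / (n * c ^ 2))) := by
  set m := ∫ z', g z' ∂(Measure.pi fun _ : Fin n => μ)
  have hsub : HasSubgaussianMGF (fun z => g z - m) ⟨n * (c / 2) ^ 2, by positivity⟩
      (Measure.pi fun _ : Fin n => μ) := by
    refine ⟨fun t => ?_, fun t => integral_exp_sub_integral_le μ hg hB hc t⟩
    refine Integrable.of_bound (by fun_prop) (Real.exp (|t| * (B + |m|)))
      (Filter.Eventually.of_forall fun z => ?_)
    rw [Real.norm_eq_abs, abs_of_pos (Real.exp_pos _)]
    refine Real.exp_le_exp.2 ((le_abs_self _).trans ?_)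
    rw [abs_mul]
    exact mul_le_mul_of_nonneg_left ((abs_sub _ _).trans (by linarith [hB z])) (abs_nonneg _)
  refine (hsub.measure_ge_le hs).trans (le_of_eq ?_)
  congr 1
  change -s ^ 2 / (2 * (n * (c / 2) ^ 2)) = _
  rw [neg_div]
  congr 1
  by_cases h : (n : ℝ) * c ^ 2 = 0
  · have : (n : ℝ) * (c / 2) ^ 2 = 0 := by linarith
    simp [this, h]
  · have : (n : ℝ) * (c / 2) ^ 2 ≠ 0 := fun h' => h (by linarith)
    rw [div_eq_div_iff (by simpa using this) h]
    ring

end BoundedDifferences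

/-! ### Uniform deviations for Lipschitz losses of linear predictors, by symmetrization one
coordinate at a time. -/

section UniformDeviation

theorem Finset.abs_sup'_le {ι : Type*} {F : Finset ι} (hF : F.Nonempty) {f : ι → ℝ} {C : ℝ}
    (h : ∀ i ∈ F, |f i| ≤ C) : |F.sup' hF f| ≤ C := by
  obtain ⟨i, hi, h'⟩ := F.exists_mem_eq_sup' hF f
  rw [h']; exact h i hi

theorem Finset.abs_sup'_sub_sup'_le {ι : Type*} {F : Finset ι} (hF : F.Nonempty) {f g : ι → ℝ}
    {C : ℝ} (h : ∀ i ∈ F, |f i - g i| ≤ C) : |F.sup' hF f - F.sup' hF g| ≤ C := by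
  rw [abs_le]
  constructor
  · have : F.sup' hF g ≤ F.sup' hF f + C := Finset.sup'_le hF _ fun i hi => by
      linarith [(abs_le.1 (h i hi)).1, Finset.le_sup' f hi]
    linarith
  · have : F.sup' hF f ≤ F.sup' hF g + C := Finset.sup'_le hF _ fun i hi => by
      linarith [(abs_le.1 (h i hi)).2, Finset.le_sup' g hi]
    linarith

theorem Finset.measurable_sup'_apply {Z ι : Type*} [MeasurableSpace Z] {F : Finset ι}
    (hF : F.Nonempty) {f : ι → Z → ℝ} (hf : ∀ i ∈ F, Measurable (f i)) :
    Measurable fun z => F.sup' hF fun i => f i z := by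
  have := Finset.measurable_sup' hF hf
  convert this using 1
  ext z
  simp

theorem abs_integral_le_of_abs_le {Z : Type*} [MeasurableSpace Z] (μ : Measure Z)
    [IsProbabilityMeasure μ] {f : Z → ℝ} {B : ℝ} (hB : ∀ z, |f z| ≤ B) : |∫ z, f z ∂μ| ≤ B := by
  have := norm_integral_le_of_norm_le_const (μ := μ) (f := f) (Filter.Eventually.of_forall hB)
  simpa using this

theorem abs_sum_integral_sub_le {Z : Type*} [MeasurableSpace Z] (μ : Measure Z)
    [IsProbabilityMeasure μ] {f : Z → ℝ} {B : ℝ} (hB : ∀ z, |f z| ≤ B) {n : ℕ} (z : Fin n → Z) :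
    |∑ j, (∫ w, f w ∂μ - f (z j))| ≤ n * (B + B) := by
  refine (Finset.abs_sum_le_sum_abs _ _).trans ?_
  refine (Finset.sum_le_card_nsmul _ _ (B + B) fun j _ => (abs_sub _ _).trans
    (add_le_add (abs_integral_le_of_abs_le μ hB) (hB _))).trans (le_of_eq ?_)
  rw [Finset.card_univ, Fintype.card_fin, nsmul_eq_mul]

variable {Z : Type*} [MeasurableSpace Z] {E : Type*} [NormedAddCommGroup E]
  [InnerProductSpace ℝ E] [MeasurableSpace E] [BorelSpace E] [FiniteDimensional ℝ E]

/-- One step of symmetrization and contraction: the centered loss at a random point is replaced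
by a random sign times the linear function that controls its oscillation. -/
theorem integral_sup'_add_sub_le (μ : Measure Z) [IsProbabilityMeasure μ] {φ : Z → E}
    (hφ : Measurable φ) (hφ1 : ∀ z, ‖φ z‖ ≤ 1) {F : Finset E} (hF : F.Nonempty) {D K B : ℝ}
    (hD : ∀ β ∈ F, ‖β‖ ≤ D) (hK : 0 ≤ K) {ℓ : E → Z → ℝ} (hℓ : ∀ β, Measurable (ℓ β))
    (hB : ∀ β z, |ℓ β z| ≤ B)
    (hlip : ∀ β β' z, |ℓ β z - ℓ β' z| ≤ K * |⟪β - β', φ z⟫|) (a : E → ℝ) :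
    ∫ z, F.sup' hF (fun β => a β + (∫ w, ℓ β w ∂μ - ℓ β z)) ∂μ ≤
      ∫ z, (F.sup' hF (fun β => a β + ⟪β, (2 * K) • φ z⟫) +
        F.sup' hF (fun β => a β + ⟪β, -((2 * K) • φ z)⟫)) / 2 ∂μ := by
  obtain ⟨A, hA⟩ : ∃ A, ∀ β ∈ F, |a β| ≤ A :=
    ⟨F.sup' hF fun β => |a β|, fun β hβ => Finset.le_sup' (fun β => |a β|) hβ⟩
  have hint : ∀ (f : E → Z → ℝ) (C : ℝ), (∀ β, Measurable (f β)) → (∀ β ∈ F, ∀ z, |f β z| ≤ C) →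
      Integrable (fun z => F.sup' hF (fun β => f β z)) μ := fun f C hf hC =>
    Integrable.of_bound (Finset.measurable_sup'_apply hF fun β _ => hf β).aestronglyMeasurable C
      (Filter.Eventually.of_forall fun z => Finset.abs_sup'_le hF fun β hβ => hC β hβ z)
  have hℓi : ∀ β, Integrable (ℓ β) μ := fun β =>
    Integrable.of_bound (hℓ β).aestronglyMeasurable B (Filter.Eventually.of_forall (hB β))
  have hEB : ∀ β, |∫ w, ℓ β w ∂μ| ≤ B := fun β => abs_integral_le_of_abs_le μ (hB β)
  have iL : Integrable (fun z => F.sup' hF (fun β => a β + (∫ w, ℓ β w ∂μ - ℓ β z))) μ :=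
    hint (fun β z => a β + (∫ w, ℓ β w ∂μ - ℓ β z)) (A + (B + B)) (fun β => by fun_prop)
      fun β hβ z => (abs_add_le _ _).trans (add_le_add (hA β hβ)
        ((abs_sub _ _).trans (add_le_add (hEB β) (hB β z))))
  have iP : Integrable (fun z => F.sup' hF (fun β => a β + 2 * ℓ β z)) μ :=
    hint (fun β z => a β + 2 * ℓ β z) (A + 2 * B) (fun β => by fun_prop)
      fun β hβ z => (abs_add_le _ _).trans (add_le_add (hA β hβ) (by
        rw [abs_mul, abs_two]; linarith [hB β z]))
  have iN : Integrable (fun z => F.sup' hF (fun β => a β - 2 * ℓ β z)) μ :=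
    hint (fun β z => a β - 2 * ℓ β z) (A + 2 * B) (fun β => by fun_prop)
      fun β hβ z => (abs_sub _ _).trans (add_le_add (hA β hβ) (by
        rw [abs_mul, abs_two]; linarith [hB β z]))
  have hin : ∀ β ∈ F, ∀ z, |⟪β, (2 * K) • φ z⟫| ≤ D * (2 * K) := fun β hβ z => by
    refine (abs_real_inner_le_norm _ _).trans ?_
    rw [norm_smul, Real.norm_eq_abs, abs_of_nonneg (by positivity)]
    exact mul_le_mul (hD β hβ) (mul_le_of_le_one_right (by positivity) (hφ1 z)) (by positivity)
      ((norm_nonneg β).trans (hD β hβ))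
  have iR1 : Integrable (fun z => F.sup' hF (fun β => a β + ⟪β, (2 * K) • φ z⟫)) μ :=
    hint (fun β z => a β + ⟪β, (2 * K) • φ z⟫) (A + D * (2 * K)) (fun β => by fun_prop)
      fun β hβ z => (abs_add_le _ _).trans (add_le_add (hA β hβ) (hin β hβ z))
  have iR2 : Integrable (fun z => F.sup' hF (fun β => a β + ⟪β, -((2 * K) • φ z)⟫)) μ :=
    hint (fun β z => a β + ⟪β, -((2 * K) • φ z)⟫) (A + D * (2 * K)) (fun β => by fun_prop)
      fun β hβ z => (abs_add_le _ _).trans (add_le_add (hA β hβ) (by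
        rw [inner_neg_right, abs_neg]; exact hin β hβ z))
  -- Symmetrization without a ghost sample: `a + 𝔼ℓ - ℓ` is the average of `a + 2 𝔼ℓ`, which is at
  -- most `S`, and `a - 2 ℓ`. After integration, the two suprema are those for the signs `+` and
  -- `-`.
  set S := ∫ z, F.sup' hF (fun β => a β + 2 * ℓ β z) ∂μ
  calc ∫ z, F.sup' hF (fun β => a β + (∫ w, ℓ β w ∂μ - ℓ β z)) ∂μ
      ≤ ∫ z, (S + F.sup' hF (fun β => a β - 2 * ℓ β z)) / 2 ∂μ := by
        refine integral_mono iL (((integrable_const S).add iN).div_const 2) fun z => ?_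
        refine Finset.sup'_le hF _ fun β hβ => ?_
        have h1 : a β + 2 * ∫ w, ℓ β w ∂μ ≤ S := by
          have : a β + 2 * ∫ w, ℓ β w ∂μ = ∫ w, (a β + 2 * ℓ β w) ∂μ := by
            rw [integral_add (integrable_const _) ((hℓi β).const_mul 2), integral_const_mul]
            simp
          rw [this]
          exact integral_mono ((integrable_const _).add ((hℓi β).const_mul 2)) iP fun w =>
            Finset.le_sup' (fun β => a β + 2 * ℓ β w) hβ
        have h2 := Finset.le_sup' (fun β => a β - 2 * ℓ β z) hβ
        linarith
    _ = ∫ z, (F.sup' hF (fun β => a β + 2 * ℓ β z) +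
          F.sup' hF (fun β => a β - 2 * ℓ β z)) / 2 ∂μ := by
        rw [integral_div, integral_div, integral_add (integrable_const S) iN, integral_add iP iN]
        simp [S]
    _ ≤ _ := by
        refine integral_mono ((iP.add iN).div_const 2) ((iR1.add iR2).div_const 2) fun z => ?_
        -- Contraction: at the maximizers `β`, `γ` of the two suprema, only `ℓ β z - ℓ γ z ≤ K |⟪β -
        -- γ, φ z⟫|` matters. The sign of the inner product decides which of the two parameters is
        -- paired with `+φ` and which with `-φ`.
        obtain ⟨β, hβ, h1⟩ := F.exists_mem_eq_sup' hF (fun β => a β + 2 * ℓ β z)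
        obtain ⟨γ, hγ, h2⟩ := F.exists_mem_eq_sup' hF (fun β => a β - 2 * ℓ β z)
        simp only [h1, h2]
        have h3 := (le_abs_self _).trans (hlip β γ z)
        have b1 := Finset.le_sup' (fun β => a β + ⟪β, (2 * K) • φ z⟫) hβ
        have b2 := Finset.le_sup' (fun β => a β + ⟪β, -((2 * K) • φ z)⟫) hβ
        have b3 := Finset.le_sup' (fun β => a β + ⟪β, (2 * K) • φ z⟫) hγ
        have b4 := Finset.le_sup' (fun β => a β + ⟪β, -((2 * K) • φ z)⟫) hγ
        simp only [inner_neg_right, inner_smul_right] at b1 b2 b3 b4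
        simp only [inner_neg_right, inner_smul_right]
        rw [inner_sub_left] at h3
        rcases abs_cases (⟪β, φ z⟫ - ⟪γ, φ z⟫) with ⟨h4, _⟩ | ⟨h4, _⟩ <;> rw [h4] at h3 <;> linarith

/-- Dimension-free bound on the expected uniform deviation of a class of losses that are Lipschitz
functions of a linear predictor. -/
theorem integral_sup'_inner_add_sum_le (μ : Measure Z) [IsProbabilityMeasure μ] {φ : Z → E}
    (hφ : Measurable φ) (hφ1 : ∀ z, ‖φ z‖ ≤ 1) {F : Finset E} (hF : F.Nonempty) {D K B : ℝ}
    (hD0 : 0 ≤ D) (hD : ∀ β ∈ F, ‖β‖ ≤ D) (hK : 0 ≤ K) {ℓ : E → Z → ℝ}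
    (hℓ : ∀ β, Measurable (ℓ β)) (hB : ∀ β z, |ℓ β z| ≤ B)
    (hlip : ∀ β β' z, |ℓ β z - ℓ β' z| ≤ K * |⟪β - β', φ z⟫|) (n : ℕ) (S : E) :
    ∫ z, F.sup' hF (fun β => ⟪β, S⟫ + ∑ j, (∫ w, ℓ β w ∂μ - ℓ β (z j)))
      ∂(Measure.pi fun _ : Fin n => μ) ≤ D * Real.sqrt (‖S‖ ^ 2 + 4 * K ^ 2 * n) := by
  -- The vector `S` accumulates the signed features `± 2 K φ` of the coordinates already processed,
  -- so the induction must cover every `S`.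
  induction n generalizing S with
  | zero =>
    simp only [Finset.univ_eq_empty, Finset.sum_empty, add_zero, integral_const, CharP.cast_eq_zero,
      mul_zero, Real.sqrt_sq (norm_nonneg S)]
    simp only [probReal_univ, one_smul]
    refine Finset.sup'_le hF _ fun β hβ => (real_inner_le_norm _ _).trans ?_
    exact mul_le_mul_of_nonneg_right (hD β hβ) (norm_nonneg _)
  | succ n ih =>
    have hsumB : ∀ (N : ℕ) (β : E) (z : Fin N → Z),
        |∑ j, (∫ w, ℓ β w ∂μ - ℓ β (z j))| ≤ N * (B + B) := fun N β z =>
      abs_sum_integral_sub_le μ (hB β) z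
    have hinB : ∀ β ∈ F, ∀ T : E, |⟪β, T⟫| ≤ D * ‖T‖ := fun β hβ T =>
      (abs_real_inner_le_norm _ _).trans (mul_le_mul_of_nonneg_right (hD β hβ) (norm_nonneg _))
    have hsupB : ∀ (N : ℕ) (T : E) (z : Fin N → Z),
        |F.sup' hF (fun β => ⟪β, T⟫ + ∑ j, (∫ w, ℓ β w ∂μ - ℓ β (z j)))| ≤
          D * ‖T‖ + N * (B + B) := fun N T z =>
      Finset.abs_sup'_le hF fun β hβ => (abs_add_le _ _).trans
        (add_le_add (hinB β hβ T) (hsumB N β z))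
    have hmeas : ∀ (N : ℕ), Measurable fun q : E × (Fin N → Z) =>
        F.sup' hF (fun β => ⟪β, q.1⟫ + ∑ j, (∫ w, ℓ β w ∂μ - ℓ β (q.2 j))) := fun N =>
      Finset.measurable_sup'_apply hF fun β _ => by fun_prop
    have hmS : Measurable fun z : Fin (n + 1) → Z =>
        F.sup' hF (fun β => ⟪β, S⟫ + ∑ j, (∫ w, ℓ β w ∂μ - ℓ β (z j))) :=
      (hmeas (n + 1)).comp (measurable_const.prodMk measurable_id)
    rw [integral_pi_succ μ hmS (hsupB (n + 1) S)]
    set H : Z × (Fin n → Z) → ℝ := fun q =>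
      (F.sup' hF (fun β => ⟪β, S + (2 * K) • φ q.1⟫ + ∑ j, (∫ w, ℓ β w ∂μ - ℓ β (q.2 j))) +
        F.sup' hF (fun β => ⟪β, S + -((2 * K) • φ q.1)⟫ +
          ∑ j, (∫ w, ℓ β w ∂μ - ℓ β (q.2 j)))) / 2
    have hvn : ∀ z, ‖(2 * K) • φ z‖ ≤ 2 * K := fun z => by
      rw [norm_smul, Real.norm_eq_abs, abs_of_nonneg (by positivity)]
      exact mul_le_of_le_one_right (by positivity) (hφ1 z)
    have hHm : Measurable H := by
      have h1 := (hmeas n).comp (f := fun q : Z × (Fin n → Z) => (S + (2 * K) • φ q.1, q.2))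
        (by fun_prop)
      have h2 := (hmeas n).comp (f := fun q : Z × (Fin n → Z) => (S + -((2 * K) • φ q.1), q.2))
        (by fun_prop)
      exact (h1.add h2).div_const 2
    have hHb : ∀ q, |H q| ≤ D * (‖S‖ + 2 * K) + n * (B + B) := fun q => by
      have h1 := hsupB n (S + (2 * K) • φ q.1) q.2
      have h2 := hsupB n (S + -((2 * K) • φ q.1)) q.2
      have h3 : D * ‖S + (2 * K) • φ q.1‖ ≤ D * (‖S‖ + 2 * K) :=
        mul_le_mul_of_nonneg_left ((norm_add_le _ _).trans (by linarith [hvn q.1])) hD0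
      have h4 : D * ‖S + -((2 * K) • φ q.1)‖ ≤ D * (‖S‖ + 2 * K) :=
        mul_le_mul_of_nonneg_left ((norm_add_le _ _).trans (by
          rw [norm_neg]; linarith [hvn q.1])) hD0
      simp only [H]
      rw [abs_div, abs_two, div_le_iff₀ two_pos]
      exact (abs_add_le _ _).trans (by linarith)
    have hHi : Integrable H (μ.prod (Measure.pi fun _ : Fin n => μ)) :=
      Integrable.of_bound hHm.aestronglyMeasurable _ (Filter.Eventually.of_forall hHb)
    calc _ ≤ ∫ z, ∫ z₀, H (z₀, z) ∂μ ∂(Measure.pi fun _ : Fin n => μ) := by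
          refine integral_mono ?_ hHi.swap.integral_prod_left fun z => ?_
          · have hm : Measurable fun q : (Fin n → Z) × Z => F.sup' hF (fun β => ⟪β, S⟫ +
                ∑ j, (∫ w, ℓ β w ∂μ - ℓ β ((Fin.cons q.2 q.1 : Fin (n + 1) → Z) j))) :=
              (hmeas (n + 1)).comp
                (measurable_const.prodMk (measurable_finCons.comp measurable_swap))
            have : Integrable (fun q : (Fin n → Z) × Z => F.sup' hF (fun β => ⟪β, S⟫ +
                ∑ j, (∫ w, ℓ β w ∂μ - ℓ β ((Fin.cons q.2 q.1 : Fin (n + 1) → Z) j))))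
                ((Measure.pi fun _ : Fin n => μ).prod μ) :=
              Integrable.of_bound hm.aestronglyMeasurable _
                (Filter.Eventually.of_forall fun q => hsupB (n + 1) S _)
            exact this.integral_prod_left
          · have := integral_sup'_add_sub_le μ hφ hφ1 hF hD hK hℓ hB hlip
              (fun β => ⟪β, S⟫ + ∑ j, (∫ w, ℓ β w ∂μ - ℓ β (z j)))
            refine le_trans (le_of_eq ?_) (this.trans (le_of_eq ?_))
            · refine integral_congr_ae (Filter.Eventually.of_forall fun z₀ => ?_)
              refine Finset.sup'_congr hF rfl fun β _ => ?_
              simp only [Fin.sum_univ_succ, Fin.cons_zero, Fin.cons_succ]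
              ring
            · refine integral_congr_ae (Filter.Eventually.of_forall fun z₀ => ?_)
              simp only [H, inner_add_right]
              congr 2 <;> refine Finset.sup'_congr hF rfl fun β _ => ?_ <;> ring
      _ = ∫ z₀, ∫ z, H (z₀, z) ∂(Measure.pi fun _ : Fin n => μ) ∂μ :=
          (integral_integral_swap (f := fun z₀ z => H (z₀, z)) hHi).symm
      _ ≤ ∫ _z₀, D * Real.sqrt (‖S‖ ^ 2 + 4 * K ^ 2 * (n + 1 : ℕ)) ∂μ := by
          refine integral_mono hHi.integral_prod_left (integrable_const _) fun z₀ => ?_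
          have hi : ∀ T : E, Integrable (fun z => F.sup' hF (fun β => ⟪β, T⟫ +
              ∑ j, (∫ w, ℓ β w ∂μ - ℓ β (z j)))) (Measure.pi fun _ : Fin n => μ) := fun T =>
            Integrable.of_bound ((hmeas n).comp
              (measurable_const.prodMk measurable_id)).aestronglyMeasurable _
              (Filter.Eventually.of_forall fun z => hsupB n T z)
          simp only [H]
          rw [integral_div, integral_add (hi _) (hi _)]
          have h1 := ih (S + (2 * K) • φ z₀)
          have h2 := ih (S + -((2 * K) • φ z₀))
          set v := (2 * K) • φ z₀
          -- Averaging over the sign, the parallelogram law replaces `‖S ± v‖²` by `‖S‖² + ‖v‖²`,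
          -- and concavity of the square root passes this average inside. Each coordinate thus adds
          -- at most `4 K²` under the root.
          have hpar : ‖S + v‖ ^ 2 + ‖S + -v‖ ^ 2 = 2 * (‖S‖ ^ 2 + ‖v‖ ^ 2) := by
            have := parallelogram_law_with_norm ℝ S v
            rw [← sub_eq_add_neg]; nlinarith
          have hv : ‖v‖ ^ 2 ≤ 4 * K ^ 2 := by
            have := pow_le_pow_left₀ (norm_nonneg v) (hvn z₀) 2
            nlinarith
          set p := ‖S + v‖ ^ 2 + 4 * K ^ 2 * n
          set q := ‖S + -v‖ ^ 2 + 4 * K ^ 2 * n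
          have hp : 0 ≤ p := by positivity
          have hq : 0 ≤ q := by positivity
          have hsq : (Real.sqrt p + Real.sqrt q) / 2 ≤
              Real.sqrt (‖S‖ ^ 2 + 4 * K ^ 2 * (n + 1 : ℕ)) := by
            apply Real.le_sqrt_of_sq_le
            have e1 := Real.sq_sqrt hp
            have e2 := Real.sq_sqrt hq
            have e3 : p + q = ‖S + v‖ ^ 2 + ‖S + -v‖ ^ 2 + 8 * K ^ 2 * n := by
              simp only [p, q]; ring
            push_cast
            nlinarith [sq_nonneg (Real.sqrt p - Real.sqrt q)]
          have := mul_le_mul_of_nonneg_left hsq hD0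
          linarith
      _ = _ := by simp

/-- Uniform one-sided deviation inequality with a dimension-free bound. -/
theorem measure_exists_le_sum_le (μ : Measure Z) [IsProbabilityMeasure μ] {φ : Z → E}
    (hφ : Measurable φ) (hφ1 : ∀ z, ‖φ z‖ ≤ 1) {F : Finset E} {D K B L : ℝ}
    (hD0 : 0 ≤ D) (hD : ∀ β ∈ F, ‖β‖ ≤ D) (hK : 0 ≤ K) {ℓ : E → Z → ℝ}
    (hℓ : ∀ β, Measurable (ℓ β)) (hB : ∀ β z, |ℓ β z| ≤ B) (hL : ∀ β z w, |ℓ β z - ℓ β w| ≤ L)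
    (hlip : ∀ β β' z, |ℓ β z - ℓ β' z| ≤ K * |⟪β - β', φ z⟫|) {n : ℕ} {s : ℝ} (hs : 0 ≤ s) :
    (Measure.pi fun _ : Fin n => μ) {z | ∃ β ∈ F,
        2 * K * D * Real.sqrt n + s ≤ ∑ j, (∫ w, ℓ β w ∂μ - ℓ β (z j))} ≤
      ENNReal.ofReal (Real.exp (-(2 * s ^ 2 / (n * L ^ 2)))) := by
  rcases F.eq_empty_or_nonempty with rfl | hF
  · simp
  set g : (Fin n → Z) → ℝ := fun z => F.sup' hF (fun β => ∑ j, (∫ w, ℓ β w ∂μ - ℓ β (z j)))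
  have hg : Measurable g := Finset.measurable_sup'_apply hF fun β _ => by fun_prop
  have hgB : ∀ z, |g z| ≤ n * (B + B) := fun z => Finset.abs_sup'_le hF fun β _ =>
    abs_sum_integral_sub_le μ (hB β) z
  have hgc : ∀ z i w, |g (Function.update z i w) - g z| ≤ L := by
    intro z i w
    refine Finset.abs_sup'_sub_sup'_le hF fun β _ => ?_
    rw [← Finset.sum_sub_distrib, Finset.sum_eq_single i]
    · rw [Function.update_self]
      have := hL β (z i) w
      convert this using 2
      ring
    · intro j _ hj
      rw [Function.update_of_ne hj]; ring
    · simp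
  have hE : ∫ z, g z ∂(Measure.pi fun _ : Fin n => μ) ≤ 2 * K * D * Real.sqrt n := by
    have := integral_sup'_inner_add_sum_le μ hφ hφ1 hF hD0 hD hK hℓ hB hlip n 0
    simp only [inner_zero_right, zero_add, norm_zero] at this
    refine this.trans (le_of_eq ?_)
    rw [show (0 : ℝ) ^ 2 + 4 * K ^ 2 * n = (2 * K) ^ 2 * n by ring,
      Real.sqrt_mul (sq_nonneg _), Real.sqrt_sq (by positivity)]
    ring
  have hmc := measureReal_add_integral_le_of_bounded_differences μ hg hgB hgc hs
  refine le_trans (measure_mono ?_) ((ENNReal.le_ofReal_iff_toReal_le (measure_ne_top _ _)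
    (Real.exp_pos _).le).2 hmc)
  rintro z ⟨β, hβ, h⟩
  have := Finset.le_sup' (fun β => ∑ j, (∫ w, ℓ β w ∂μ - ℓ β (z j))) hβ
  change s ≤ g z - _
  linarith

end UniformDeviation

/-! ### Quantitative injectivity of the sigmoid on `[-1, 1]` and the affinity of two labels. -/

section Sigmoid

/-- On `[-1, 1]` the exponentials lie in `[1/3, 3]`. In the difference of sigmoids the numerator is
then at least `(k - l) / 3` and the denominator at most `(1 + 3)² = 16`, whence `48 = 3 · 16`. -/
theorem abs_sub_le_abs_sigmoid_sub {k l : ℝ} (hk : |k| ≤ 1) (hl : |l| ≤ 1) :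
    |k - l| ≤ 48 * |Real.sigmoid k - Real.sigmoid l| := by
  wlog h : l ≤ k generalizing k l
  · rw [abs_sub_comm k, abs_sub_comm (Real.sigmoid k)]
    exact this hl hk (not_le.1 h).le
  have he : Real.exp 1 < 3 := Real.exp_one_lt_d9.trans (by norm_num)
  have bound : ∀ z : ℝ, |z| ≤ 1 → 1 / 3 ≤ Real.exp (-z) ∧ Real.exp (-z) ≤ 3 := fun z hz => by
    have h1 : Real.exp (-z) ≤ Real.exp 1 := Real.exp_le_exp.2 (by linarith [(abs_le.1 hz).1])
    have h2 : Real.exp (-1) ≤ Real.exp (-z) := Real.exp_le_exp.2 (by linarith [(abs_le.1 hz).2])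
    have h3 : Real.exp (-1) * Real.exp 1 = 1 := by rw [← Real.exp_add]; simp
    constructor
    · nlinarith [Real.exp_pos (-1)]
    · linarith
  obtain ⟨hk1, hk3⟩ := bound k hk
  obtain ⟨hl1, hl3⟩ := bound l hl
  have hexp : Real.exp (-l) = Real.exp (-k) * Real.exp (k - l) := by
    rw [← Real.exp_add]; ring_nf
  have hgrow : k - l ≤ Real.exp (k - l) - 1 := by linarith [Real.add_one_le_exp (k - l)]
  have hdiff : (k - l) / 3 ≤ Real.exp (-l) - Real.exp (-k) := by
    rw [hexp]
    nlinarith [mul_le_mul hk1 hgrow (sub_nonneg.2 h) (Real.exp_pos (-k)).le]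
  have hsig : Real.sigmoid k - Real.sigmoid l =
      (Real.exp (-l) - Real.exp (-k)) / ((1 + Real.exp (-k)) * (1 + Real.exp (-l))) := by
    rw [Real.sigmoid_def, Real.sigmoid_def]
    field_simp
    ring
  rw [abs_of_nonneg (sub_nonneg.2 h), abs_of_nonneg (sub_nonneg.2 (Real.sigmoid_le h)), hsig,
    ← mul_div_assoc, le_div_iff₀ (by positivity)]
  have : (1 + Real.exp (-k)) * (1 + Real.exp (-l)) ≤ 16 := by nlinarith
  nlinarith [mul_le_mul_of_nonneg_left this (sub_nonneg.2 h)]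

/-- The gap in the arithmetic-geometric mean inequality is `(√a - √b)² / 2`, while `(a - b)² = (√a -
√b)² (√a + √b)² ≤ 4 (√a - √b)²`. -/
theorem sqrt_mul_le_of_mem_Icc {a b : ℝ} (ha : 0 ≤ a) (hb : 0 ≤ b) (ha1 : a ≤ 1) (hb1 : b ≤ 1) :
    Real.sqrt (a * b) ≤ (a + b) / 2 - (a - b) ^ 2 / 8 := by
  have e1 := Real.sq_sqrt ha
  have e2 := Real.sq_sqrt hb
  have h1 := Real.sqrt_le_one.2 ha1
  have h2 := Real.sqrt_le_one.2 hb1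
  have h3 := Real.sqrt_nonneg a
  have h4 := Real.sqrt_nonneg b
  rw [Real.sqrt_mul ha]
  set u := Real.sqrt a
  set v := Real.sqrt b
  have h5 : (a - b) ^ 2 = (u - v) ^ 2 * (u + v) ^ 2 := by rw [← e1, ← e2]; ring
  have h6 : (u + v) ^ 2 ≤ 4 := by nlinarith
  have h7 := mul_le_mul_of_nonneg_left h6 (sq_nonneg (u - v))
  nlinarith

/-- The two label probabilities sum to one and differ by the same amount for both labels, so the
total gap is at least a quarter of the squared sigmoid difference; `9216 = 4 · 48²`. -/
theorem sqrt_sigmoid_add_sqrt_sigmoid_neg_le {k l : ℝ} (hk : |k| ≤ 1) (hl : |l| ≤ 1) :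
    Real.sqrt (Real.sigmoid k * Real.sigmoid l) +
      Real.sqrt (Real.sigmoid (-k) * Real.sigmoid (-l)) ≤ 1 - (k - l) ^ 2 / 9216 := by
  have h1 := sqrt_mul_le_of_mem_Icc (Real.sigmoid_nonneg k) (Real.sigmoid_nonneg l)
    (Real.sigmoid_le_one k) (Real.sigmoid_le_one l)
  have h2 := sqrt_mul_le_of_mem_Icc (Real.sigmoid_nonneg (-k)) (Real.sigmoid_nonneg (-l))
    (Real.sigmoid_le_one _) (Real.sigmoid_le_one _)
  have h3 := pow_le_pow_left₀ (abs_nonneg _) (abs_sub_le_abs_sigmoid_sub hk hl) 2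
  rw [mul_pow, sq_abs, sq_abs] at h3
  rw [Real.sigmoid_neg, Real.sigmoid_neg] at h2 ⊢
  nlinarith

end Sigmoid

namespace Contrastive

/-! ### The law of an unlabeled triple: normalization, Hellinger affinity and `L¹` distance in terms
of kernels. -/

section TripleLaw

variable {X : Type*} {r : ℕ}

theorem signOf_cases (t : Bool) (z : ℝ) :
    signOf t * z = if t then z else -z := by
  cases t <;> simp [signOf]

theorem tripleDensity_eq (p : X → ℝ) (f : X → Rep r) (s : Triple X) :
    tripleDensity p f s = p s.1 * p s.2.1 * Real.sigmoid (signOf s.2.2 * ⟪f s.1, f s.2.1⟫) := by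
  rw [tripleDensity, Real.sigmoid_def, one_div]

theorem tripleDensity_nonneg {p : X → ℝ} (hp : ∀ x, 0 ≤ p x) (f : X → Rep r) (s : Triple X) :
    0 ≤ tripleDensity p f s := by
  rw [tripleDensity_eq]
  exact mul_nonneg (mul_nonneg (hp _) (hp _)) (Real.sigmoid_nonneg _)

theorem tripleDensity_pos {p : X → ℝ} (f : X → Rep r) {s : Triple X} (h1 : 0 < p s.1)
    (h2 : 0 < p s.2.1) : 0 < tripleDensity p f s := by
  rw [tripleDensity_eq]
  exact mul_pos (mul_pos h1 h2) (Real.sigmoid_pos _)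

theorem abs_kernel_sub_le {f g : X → Rep r} (hf1 : ∀ x, ‖f x‖ ≤ 1) (hg1 : ∀ x, ‖g x‖ ≤ 1)
    (x x' : X) : |⟪f x, f x'⟫ - ⟪g x, g x'⟫| ≤ 2 :=
  (abs_sub _ _).trans (by
    linarith [abs_inner_le_one (hf1 x) (hf1 x'), abs_inner_le_one (hg1 x) (hg1 x')])

variable [MeasurableSpace X]

/-- The squared `L²` distance between the similarity kernels of two representations. -/
noncomputable def kernelDist (P : Measure X) (f g : X → Rep r) : ℝ :=
  ∫ q : X × X, (⟪f q.1, f q.2⟫ - ⟪g q.1, g q.2⟫) ^ 2 ∂(P.prod P)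

theorem measurable_signOf : Measurable signOf := measurable_of_countable _

theorem measurable_tripleDensity {p : X → ℝ} (hp : Measurable p) {f : X → Rep r}
    (hf : Measurable f) : Measurable (tripleDensity p f) := by
  have h : Measurable fun s : Triple X => signOf s.2.2 := measurable_signOf.comp (by fun_prop)
  unfold tripleDensity
  fun_prop

theorem isProbabilityMeasure_inputLaw {ρ : Measure X} {p : X → ℝ}
    (h1 : ∫⁻ x, ENNReal.ofReal (p x) ∂ρ = 1) : IsProbabilityMeasure (inputLaw ρ p) :=
  ⟨by rw [inputLaw, withDensity_apply _ MeasurableSet.univ, Measure.restrict_univ, h1]⟩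

/-- Integrals against the reference measure on triples in terms of the input law. -/
theorem lintegral_refMeasure (ρ : Measure X) [SigmaFinite ρ] {p : X → ℝ} (hp : Measurable p)
    {G : Triple X → ℝ≥0∞} (hG : Measurable G) :
    ∫⁻ s, ENNReal.ofReal (p s.1) * (ENNReal.ofReal (p s.2.1) * G s) ∂(refMeasure ρ) =
      ∫⁻ x, ∫⁻ x', (G (x, x', true) + G (x, x', false)) ∂(inputLaw ρ p) ∂(inputLaw ρ p) := by
  have hpm : Measurable fun x => ENNReal.ofReal (p x) := by fun_prop
  have hin : ∀ x : X, ∫⁻ y : X × Bool, ENNReal.ofReal (p y.1) * G (x, y)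
      ∂(ρ.prod Measure.count) =
      ∫⁻ x', (G (x, x', true) + G (x, x', false)) ∂(inputLaw ρ p) := by
    intro x
    have hm : Measurable fun x' => G (x, x', true) + G (x, x', false) := by fun_prop
    rw [lintegral_prod _ (by fun_prop), inputLaw,
      lintegral_withDensity_eq_lintegral_mul _ hpm hm]
    refine lintegral_congr fun x' => ?_
    rw [lintegral_count, tsum_bool, Pi.mul_apply, mul_add, add_comm]
  have hm2 : Measurable fun x => ∫⁻ x', (G (x, x', true) + G (x, x', false)) ∂(inputLaw ρ p) := by
    have : SFinite (inputLaw ρ p) := by unfold inputLaw; infer_instance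
    exact Measurable.lintegral_prod_right' (f := fun q : X × X =>
      G (q.1, q.2, true) + G (q.1, q.2, false)) (by fun_prop)
  rw [refMeasure, lintegral_prod _ (by fun_prop)]
  rw [show ∫⁻ x, ∫⁻ x', (G (x, x', true) + G (x, x', false)) ∂(inputLaw ρ p) ∂(inputLaw ρ p) = _
    from lintegral_withDensity_eq_lintegral_mul ρ hpm hm2]
  refine lintegral_congr fun x => ?_
  simp only [Pi.mul_apply]
  rw [lintegral_const_mul _ (by fun_prop), hin]

variable (ρ : Measure X) [SigmaFinite ρ] {p : X → ℝ} {f g : X → Rep r}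

theorem lintegral_tripleDensity (hp : Measurable p) (hp0 : ∀ x, 0 ≤ p x)
    (hp1 : ∫⁻ x, ENNReal.ofReal (p x) ∂ρ = 1) (hf : Measurable f) :
    ∫⁻ s, ENNReal.ofReal (tripleDensity p f s) ∂(refMeasure ρ) = 1 := by
  have hP := isProbabilityMeasure_inputLaw hp1
  have hs : Measurable fun s : Triple X =>
      ENNReal.ofReal (Real.sigmoid (signOf s.2.2 * ⟪f s.1, f s.2.1⟫)) := by
    have h : Measurable fun s : Triple X => signOf s.2.2 := measurable_signOf.comp (by fun_prop)
    have h2 := continuous_sigmoid.measurable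
    fun_prop
  have : ∀ s : Triple X, ENNReal.ofReal (tripleDensity p f s) = ENNReal.ofReal (p s.1) *
      (ENNReal.ofReal (p s.2.1) *
        ENNReal.ofReal (Real.sigmoid (signOf s.2.2 * ⟪f s.1, f s.2.1⟫))) := fun s => by
    rw [tripleDensity_eq, ENNReal.ofReal_mul (mul_nonneg (hp0 _) (hp0 _)),
      ENNReal.ofReal_mul (hp0 _), mul_assoc]
  simp only [this]
  rw [lintegral_refMeasure ρ hp hs]
  have h1 : ∀ x x' : X,
      ENNReal.ofReal (Real.sigmoid (signOf true * ⟪f x, f x'⟫)) +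
        ENNReal.ofReal (Real.sigmoid (signOf false * ⟪f x, f x'⟫)) = 1 := fun x x' => by
    rw [← ENNReal.ofReal_add (Real.sigmoid_nonneg _) (Real.sigmoid_nonneg _), signOf_cases,
      signOf_cases, if_pos rfl, if_neg (by simp), Real.sigmoid_neg]
    simp
  simp [h1]

theorem isProbabilityMeasure_tripleLaw (hp : Measurable p) (hp0 : ∀ x, 0 ≤ p x)
    (hp1 : ∫⁻ x, ENNReal.ofReal (p x) ∂ρ = 1) (hf : Measurable f) :
    IsProbabilityMeasure (tripleLaw ρ p f) :=
  ⟨by rw [tripleLaw, withDensity_apply _ MeasurableSet.univ, Measure.restrict_univ,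
    lintegral_tripleDensity ρ hp hp0 hp1 hf]⟩

theorem integrable_tripleDensity (hp : Measurable p) (hp0 : ∀ x, 0 ≤ p x)
    (hp1 : ∫⁻ x, ENNReal.ofReal (p x) ∂ρ = 1) (hf : Measurable f) :
    Integrable (tripleDensity p f) (refMeasure ρ) := by
  refine ⟨(measurable_tripleDensity hp hf).aestronglyMeasurable, ?_⟩
  rw [hasFiniteIntegral_iff_ofReal (Filter.Eventually.of_forall fun s => tripleDensity_nonneg hp0 f s),
    lintegral_tripleDensity ρ hp hp0 hp1 hf]
  exact ENNReal.one_lt_top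

theorem integral_tripleDensity (hp : Measurable p) (hp0 : ∀ x, 0 ≤ p x)
    (hp1 : ∫⁻ x, ENNReal.ofReal (p x) ∂ρ = 1) (hf : Measurable f) :
    ∫ s, tripleDensity p f s ∂(refMeasure ρ) = 1 := by
  rw [integral_eq_lintegral_of_nonneg_ae
    (Filter.Eventually.of_forall fun s => tripleDensity_nonneg hp0 f s)
    (measurable_tripleDensity hp hf).aestronglyMeasurable,
    lintegral_tripleDensity ρ hp hp0 hp1 hf]
  rfl

theorem integrable_kernel_sub_sq (P : Measure X) [IsFiniteMeasure P] (hf : Measurable f)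
    (hg : Measurable g) (hf1 : ∀ x, ‖f x‖ ≤ 1) (hg1 : ∀ x, ‖g x‖ ≤ 1) :
    Integrable (fun q : X × X => (⟪f q.1, f q.2⟫ - ⟪g q.1, g q.2⟫) ^ 2) (P.prod P) :=
  Integrable.of_bound (by fun_prop) (2 ^ 2) (Filter.Eventually.of_forall fun q => by
    rw [Real.norm_eq_abs, abs_pow]
    exact pow_le_pow_left₀ (abs_nonneg _) (abs_kernel_sub_le hf1 hg1 _ _) 2)

/-- The Hellinger affinity of two triple densities is controlled by the distance of the kernels. -/
theorem lintegral_sqrt_tripleDensity_mul_le (hp : Measurable p) (hp0 : ∀ x, 0 ≤ p x)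
    (hp1 : ∫⁻ x, ENNReal.ofReal (p x) ∂ρ = 1) (hf : Measurable f) (hg : Measurable g)
    (hf1 : ∀ x, ‖f x‖ ≤ 1) (hg1 : ∀ x, ‖g x‖ ≤ 1) :
    ∫⁻ s, ENNReal.ofReal (Real.sqrt (tripleDensity p f s * tripleDensity p g s)) ∂(refMeasure ρ) ≤
      ENNReal.ofReal (1 - kernelDist (inputLaw ρ p) f g / 9216) := by
  have hP := isProbabilityMeasure_inputLaw hp1
  set P := inputLaw ρ p
  set G : Triple X → ℝ := fun s => Real.sqrt (Real.sigmoid (signOf s.2.2 * ⟪f s.1, f s.2.1⟫) *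
    Real.sigmoid (signOf s.2.2 * ⟪g s.1, g s.2.1⟫))
  have hG : Measurable fun s => ENNReal.ofReal (G s) := by
    have h : Measurable fun s : Triple X => signOf s.2.2 := measurable_signOf.comp (by fun_prop)
    have h2 := continuous_sigmoid.measurable
    fun_prop
  have hfac : ∀ s : Triple X,
      ENNReal.ofReal (Real.sqrt (tripleDensity p f s * tripleDensity p g s)) =
        ENNReal.ofReal (p s.1) * (ENNReal.ofReal (p s.2.1) * ENNReal.ofReal (G s)) := fun s => by
    rw [← mul_assoc, ← ENNReal.ofReal_mul (hp0 _),
      ← ENNReal.ofReal_mul (mul_nonneg (hp0 _) (hp0 _)), tripleDensity_eq, tripleDensity_eq]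
    congr 1
    rw [mul_mul_mul_comm, Real.sqrt_mul (mul_self_nonneg _),
      Real.sqrt_mul_self (mul_nonneg (hp0 _) (hp0 _))]
  simp only [hfac]
  rw [lintegral_refMeasure ρ hp hG]
  have hint := integrable_kernel_sub_sq P hf hg hf1 hg1
  have hle : ∀ q : X × X, (⟪f q.1, f q.2⟫ - ⟪g q.1, g q.2⟫) ^ 2 ≤ 4 := fun q => by
    have := abs_le.1 (abs_kernel_sub_le hf1 hg1 q.1 q.2)
    nlinarith
  calc ∫⁻ x, ∫⁻ x', (ENNReal.ofReal (G (x, x', true)) + ENNReal.ofReal (G (x, x', false))) ∂P ∂P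
      ≤ ∫⁻ x, ∫⁻ x', ENNReal.ofReal (1 - (⟪f x, f x'⟫ - ⟪g x, g x'⟫) ^ 2 / 9216) ∂P ∂P := by
        refine lintegral_mono fun x => lintegral_mono fun x' => ?_
        rw [← ENNReal.ofReal_add (Real.sqrt_nonneg _) (Real.sqrt_nonneg _)]
        refine ENNReal.ofReal_le_ofReal ?_
        have := sqrt_sigmoid_add_sqrt_sigmoid_neg_le (abs_inner_le_one (hf1 x) (hf1 x'))
          (abs_inner_le_one (hg1 x) (hg1 x'))
        simpa [G, signOf_cases] using this
    _ = ∫⁻ q : X × X, ENNReal.ofReal (1 - (⟪f q.1, f q.2⟫ - ⟪g q.1, g q.2⟫) ^ 2 / 9216)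
          ∂(P.prod P) :=
        (lintegral_prod (fun q : X × X =>
          ENNReal.ofReal (1 - (⟪f q.1, f q.2⟫ - ⟪g q.1, g q.2⟫) ^ 2 / 9216)) (by fun_prop)).symm
    _ = ENNReal.ofReal (1 - kernelDist P f g / 9216) := by
        have hi : Integrable (fun q : X × X =>
            1 - (⟪f q.1, f q.2⟫ - ⟪g q.1, g q.2⟫) ^ 2 / 9216) (P.prod P) :=
          (integrable_const _).sub (hint.div_const _)
        rw [← ofReal_integral_eq_lintegral_ofReal hi
          (Filter.Eventually.of_forall fun q => by
            have := hle q
            simp only [Pi.zero_apply]; linarith),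
          integral_sub (integrable_const _) (hint.div_const _), integral_div, kernelDist]
        simp

/-- The `L¹` distance of two triple densities controls the distance of the kernels. -/
theorem kernelDist_le_integral_abs_sub (hp : Measurable p) (hp0 : ∀ x, 0 ≤ p x)
    (hp1 : ∫⁻ x, ENNReal.ofReal (p x) ∂ρ = 1) (hf : Measurable f) (hg : Measurable g)
    (hf1 : ∀ x, ‖f x‖ ≤ 1) (hg1 : ∀ x, ‖g x‖ ≤ 1) :
    kernelDist (inputLaw ρ p) f g ≤
      48 * ∫ s, |tripleDensity p f s - tripleDensity p g s| ∂(refMeasure ρ) := by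
  have hP := isProbabilityMeasure_inputLaw hp1
  set P := inputLaw ρ p
  set G : Triple X → ℝ := fun s => |Real.sigmoid (signOf s.2.2 * ⟪f s.1, f s.2.1⟫) -
    Real.sigmoid (signOf s.2.2 * ⟪g s.1, g s.2.1⟫)|
  have hG : Measurable fun s => ENNReal.ofReal (G s) := by
    have h : Measurable fun s : Triple X => signOf s.2.2 := measurable_signOf.comp (by fun_prop)
    have h2 := continuous_sigmoid.measurable
    fun_prop
  have hfac : ∀ s : Triple X,
      ENNReal.ofReal (|tripleDensity p f s - tripleDensity p g s|) =
        ENNReal.ofReal (p s.1) * (ENNReal.ofReal (p s.2.1) * ENNReal.ofReal (G s)) := fun s => by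
    rw [← mul_assoc, ← ENNReal.ofReal_mul (hp0 _),
      ← ENNReal.ofReal_mul (mul_nonneg (hp0 _) (hp0 _)), tripleDensity_eq, tripleDensity_eq,
      ← mul_sub, abs_mul, abs_of_nonneg (mul_nonneg (hp0 _) (hp0 _))]
  have hint := integrable_kernel_sub_sq P hf hg hf1 hg1
  have hI : Integrable (fun s => tripleDensity p f s - tripleDensity p g s) (refMeasure ρ) :=
    (integrable_tripleDensity ρ hp hp0 hp1 hf).sub (integrable_tripleDensity ρ hp hp0 hp1 hg)
  have hmain : ENNReal.ofReal (kernelDist P f g) ≤ ENNReal.ofReal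
      (48 * ∫ s, |tripleDensity p f s - tripleDensity p g s| ∂(refMeasure ρ)) := by
    rw [ENNReal.ofReal_mul (by norm_num),
      ofReal_integral_eq_lintegral_ofReal hI.abs (Filter.Eventually.of_forall fun s =>
        abs_nonneg _)]
    simp only [hfac]
    rw [lintegral_refMeasure ρ hp hG, kernelDist, ofReal_integral_eq_lintegral_ofReal hint
      (Filter.Eventually.of_forall fun q => sq_nonneg _), lintegral_prod _ (by fun_prop),
      ← lintegral_const_mul' _ _ ENNReal.ofReal_ne_top]
    refine lintegral_mono fun x => ?_
    rw [← lintegral_const_mul' _ _ ENNReal.ofReal_ne_top]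
    refine lintegral_mono fun x' => ?_
    rw [← ENNReal.ofReal_add (abs_nonneg _) (abs_nonneg _), ← ENNReal.ofReal_mul (by norm_num)]
    refine ENNReal.ofReal_le_ofReal ?_
    have h1 := abs_sub_le_abs_sigmoid_sub (abs_inner_le_one (hf1 x) (hf1 x'))
      (abs_inner_le_one (hg1 x) (hg1 x'))
    have h2 := abs_kernel_sub_le hf1 hg1 x x'
    have h3 : G (x, x', true) = |Real.sigmoid ⟪f x, f x'⟫ - Real.sigmoid ⟪g x, g x'⟫| := by
      simp [G, signOf_cases]
    have h4 : G (x, x', false) = |Real.sigmoid ⟪f x, f x'⟫ - Real.sigmoid ⟪g x, g x'⟫| := by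
      simp only [G, signOf_cases, Bool.false_eq_true, if_false, Real.sigmoid_neg]
      rw [sub_sub_sub_cancel_left, abs_sub_comm]
    -- With `Δ` the kernel difference, `Δ² ≤ 2 |Δ|` because `|Δ| ≤ 2`; the factor `2` is absorbed by
    -- the sum over the two labels.
    change _ ≤ 48 * (G (x, x', true) + G (x, x', false))
    rw [h3, h4, ← sq_abs]
    nlinarith [abs_nonneg (⟪f x, f x'⟫ - ⟪g x, g x'⟫)]
  exact (ENNReal.ofReal_le_ofReal_iff (mul_nonneg (by norm_num)
    (integral_nonneg fun s => abs_nonneg _))).1 hmain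

end TripleLaw

end Contrastive

/-! ### Maximum likelihood with brackets. -/

theorem Real.mul_sqrt_div_le_sqrt_mul {a c : ℝ} (hc : 0 ≤ c) :
    c * Real.sqrt (a / c) ≤ Real.sqrt (a * c) := by
  rcases hc.eq_or_lt with rfl | hc
  · simp
  · refine le_of_eq ?_
    rw [← Real.sqrt_sq hc.le, ← Real.sqrt_mul (sq_nonneg _), Real.sqrt_sq hc.le]
    congr 1
    field_simp

/-- Separates the affinity with a bracket `b` into the affinity with the density `a` below it and an
error linear in `b - a`. The parameter `t` is free in the arithmetic-geometric mean inequality; it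
is later taken to be the sample size. -/
theorem Real.sqrt_mul_le_add_half {a b c t : ℝ} (ha : 0 ≤ a) (hab : a ≤ b) (hc : 0 ≤ c)
    (ht : 0 < t) : Real.sqrt (b * c) ≤ Real.sqrt (a * c) + (t * (b - a) + c / t) / 2 := by
  have h1 : Real.sqrt (b * c) ≤ Real.sqrt (a * c) + Real.sqrt ((b - a) * c) := by
    have : b * c = a * c + (b - a) * c := by ring
    rw [this]
    have e1 := mul_nonneg ha hc
    have e2 := mul_nonneg (sub_nonneg.2 hab) hc
    refine Real.sqrt_le_iff.2 ⟨by positivity, ?_⟩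
    have := mul_nonneg (Real.sqrt_nonneg (a * c)) (Real.sqrt_nonneg ((b - a) * c))
    nlinarith [Real.sq_sqrt e1, Real.sq_sqrt e2]
  have h2 : Real.sqrt ((b - a) * c) ≤ (t * (b - a) + c / t) / 2 := by
    have hd := sub_nonneg.2 hab
    refine Real.sqrt_le_iff.2 ⟨by positivity, ?_⟩
    have : (b - a) * c = (t * (b - a)) * (c / t) := by field_simp
    rw [this]
    nlinarith [sq_nonneg (t * (b - a) - c / t)]
  linarith

/-- Markov's inequality for a product of independent identically distributed factors. -/
theorem measure_pi_one_le_prod_le {Z : Type*} [MeasurableSpace Z] (μ : Measure Z)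
    [IsProbabilityMeasure μ] {φ : Z → ℝ≥0∞} (hφ : Measurable φ) (m : ℕ) :
    (Measure.pi fun _ : Fin m => μ) {z | 1 ≤ ∏ i, φ (z i)} ≤ (∫⁻ z, φ z ∂μ) ^ m := by
  have h := mul_meas_ge_le_lintegral (μ := Measure.pi fun _ : Fin m => μ)
    (f := fun z => ∏ i, φ (z i)) (by fun_prop) 1
  rw [one_mul] at h
  refine h.trans (le_of_eq ?_)
  have hprod := lintegral_prod_eq_prod_lintegral_of_indepFun Finset.univ
    (fun (i : Fin m) (z : Fin m → Z) => φ (z i))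
    (iIndepFun_pi (μ := fun _ : Fin m => μ) (X := fun _ => φ) fun _ => hφ.aemeasurable)
    (fun i => by fun_prop)
  rw [hprod]
  have : ∀ i : Fin m, ∫⁻ z, φ (z i) ∂(Measure.pi fun _ : Fin m => μ) = ∫⁻ z, φ z ∂μ := fun i =>
    (measurePreserving_eval (fun _ : Fin m => μ) i).lintegral_comp hφ
  simp [this]

namespace Contrastive

section MaximumLikelihood

variable {X : Type*} [MeasurableSpace X] {r : ℕ} (ρ : Measure X) [SigmaFinite ρ] {p : X → ℝ}

/-- The Hellinger affinity of the true density and an upper bracket of a density `p_f`. -/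
theorem lintegral_sqrt_bracket_le {f g : X → Rep r} (hp : Measurable p) (hp0 : ∀ x, 0 ≤ p x)
    (hp1 : ∫⁻ x, ENNReal.ofReal (p x) ∂ρ = 1) (hf : Measurable f) (hg : Measurable g)
    (hf1 : ∀ x, ‖f x‖ ≤ 1) (hg1 : ∀ x, ‖g x‖ ≤ 1) {b b' : Triple X → ℝ}
    (hb : Integrable b (refMeasure ρ)) (hb' : Measurable b') (hbb : b =ᵐ[refMeasure ρ] b')
    {t : ℝ} (ht : 0 < t) (hfb : ∀ s, tripleDensity p f s ≤ b s)
    (hd : ∫ s, |b s - tripleDensity p f s| ∂(refMeasure ρ) ≤ 1 / t ^ 2) :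
    ∫⁻ s, ENNReal.ofReal (Real.sqrt (b' s / tripleDensity p g s)) ∂(tripleLaw ρ p g) ≤
      ENNReal.ofReal (1 - kernelDist (inputLaw ρ p) f g / 9216) + ENNReal.ofReal (1 / t) := by
  have mf := measurable_tripleDensity hp hf
  have mg := measurable_tripleDensity hp hg
  have hIf := integrable_tripleDensity ρ hp hp0 hp1 hf
  have hIg := integrable_tripleDensity ρ hp hp0 hp1 hg
  have hI : Integrable (fun s => (t * |b s - tripleDensity p f s| + tripleDensity p g s / t) / 2)
      (refMeasure ρ) := (((hb.sub hIf).abs.const_mul t).add (hIg.div_const t)).div_const 2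
  -- A bracket of width `1 / t²` makes both halves of the error integrate to at most `1 / t`. With
  -- `t = m`, the loss over `m` samples is only a factor `e`, which is why the bracketing scale is
  -- `1 / m²`.
  have hrest : ∫⁻ s, ENNReal.ofReal ((t * |b s - tripleDensity p f s| + tripleDensity p g s / t) / 2)
      ∂(refMeasure ρ) ≤ ENNReal.ofReal (1 / t) := by
    rw [← ofReal_integral_eq_lintegral_ofReal hI (Filter.Eventually.of_forall fun s => by
      have := tripleDensity_nonneg hp0 g s
      positivity)]
    refine ENNReal.ofReal_le_ofReal ?_
    have hA : Integrable (fun s => t * |b s - tripleDensity p f s|) (refMeasure ρ) :=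
      (hb.sub hIf).abs.const_mul t
    rw [integral_div, integral_add hA (hIg.div_const t), integral_const_mul, integral_div,
      integral_tripleDensity ρ hp hp0 hp1 hg]
    have := mul_le_mul_of_nonneg_left hd ht.le
    have h2 : t * (1 / t ^ 2) = 1 / t := by field_simp
    linarith
  have hpt : ∀ᵐ s ∂(refMeasure ρ), ENNReal.ofReal (tripleDensity p g s) *
      ENNReal.ofReal (Real.sqrt (b' s / tripleDensity p g s)) ≤
      ENNReal.ofReal (Real.sqrt (tripleDensity p f s * tripleDensity p g s)) +
        ENNReal.ofReal ((t * |b s - tripleDensity p f s| + tripleDensity p g s / t) / 2) := by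
    filter_upwards [hbb] with s hs
    have h0 := tripleDensity_nonneg hp0 g s
    have h1 := tripleDensity_nonneg hp0 f s
    rw [← hs, ← ENNReal.ofReal_mul h0, ← ENNReal.ofReal_add (Real.sqrt_nonneg _) (by positivity)]
    refine ENNReal.ofReal_le_ofReal ((Real.mul_sqrt_div_le_sqrt_mul h0).trans ?_)
    rw [abs_of_nonneg (sub_nonneg.2 (hfb s))]
    exact Real.sqrt_mul_le_add_half h1 (hfb s) h0 ht
  rw [tripleLaw, lintegral_withDensity_eq_lintegral_mul _ (by fun_prop) (by fun_prop)]
  calc _ ≤ ∫⁻ s, (ENNReal.ofReal (Real.sqrt (tripleDensity p f s * tripleDensity p g s)) +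
        ENNReal.ofReal ((t * |b s - tripleDensity p f s| + tripleDensity p g s / t) / 2))
        ∂(refMeasure ρ) := lintegral_mono_ae hpt
    _ ≤ _ := by
      rw [lintegral_add_left (by fun_prop)]
      exact add_le_add (lintegral_sqrt_tripleDensity_mul_le ρ hp hp0 hp1 hf hg hf1 hg1) hrest

/-- All sampled inputs have positive density. -/
theorem ae_pi_tripleLaw_pos {g : X → Rep r} (hp : Measurable p) (hp0 : ∀ x, 0 ≤ p x)
    (hp1 : ∫⁻ x, ENNReal.ofReal (p x) ∂ρ = 1) (hg : Measurable g) (m : ℕ) :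
    ∀ᵐ u ∂(Measure.pi fun _ : Fin m => tripleLaw ρ p g), ∀ i, 0 < p (u i).1 ∧ 0 < p (u i).2.1 := by
  have hT := isProbabilityMeasure_tripleLaw ρ hp hp0 hp1 hg
  have h : ∀ᵐ s ∂(tripleLaw ρ p g), 0 < p s.1 ∧ 0 < p s.2.1 := by
    rw [tripleLaw, ae_withDensity_iff (measurable_tripleDensity hp hg).ennreal_ofReal]
    refine Filter.Eventually.of_forall fun s hs => ?_
    have hpos : 0 < tripleDensity p g s := by
      by_contra! h
      exact hs (ENNReal.ofReal_eq_zero.2 h)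
    rw [tripleDensity_eq] at hpos
    have h1 : p s.1 ≠ 0 := fun h => by simp [h] at hpos
    have h2 : p s.2.1 ≠ 0 := fun h => by simp [h] at hpos
    exact ⟨lt_of_le_of_ne (hp0 _) h1.symm, lt_of_le_of_ne (hp0 _) h2.symm⟩
  exact Filter.eventually_all.2 fun i =>
    (Measure.tendsto_eval_ae_ae (μ := fun _ : Fin m => tripleLaw ρ p g) (i := i)).eventually h

/-- It is unlikely that a density under a given bracket is far from the truth and at least as
likely as the truth. -/
theorem measure_exists_bracketed_le {Θ : Type*} {f : Θ → X → Rep r} {θs : Θ} (hp : Measurable p)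
    (hp0 : ∀ x, 0 ≤ p x) (hp1 : ∫⁻ x, ENNReal.ofReal (p x) ∂ρ = 1) (hf : ∀ θ, Measurable (f θ))
    (hf1 : ∀ θ x, ‖f θ x‖ ≤ 1) {m : ℕ} (hm : 1 ≤ m) {b : Triple X → ℝ}
    (hb : Integrable b (refMeasure ρ)) (h : ℝ) :
    (Measure.pi fun _ : Fin m => tripleLaw ρ p (f θs))
      {u | (∀ i, 0 < p (u i).1 ∧ 0 < p (u i).2.1) ∧ ∃ θ, (∀ s, tripleDensity p (f θ) s ≤ b s) ∧
        ∫ s, |b s - tripleDensity p (f θ) s| ∂(refMeasure ρ) ≤ 1 / (m : ℝ) ^ 2 ∧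
        ∑ i, Real.log (tripleDensity p (f θs) (u i)) ≤ ∑ i, Real.log (tripleDensity p (f θ) (u i)) ∧
        h < kernelDist (inputLaw ρ p) (f θ) (f θs)} ≤
      ENNReal.ofReal (Real.exp (1 - m * h / 9216)) := by
  have hT := isProbabilityMeasure_tripleLaw ρ hp hp0 hp1 (hf θs)
  have hP := isProbabilityMeasure_inputLaw hp1
  -- If no far density lies under `b`, the event is empty. Otherwise one such `θ₀` suffices to bound
  -- the affinity of `b` with the truth, and this bound serves every competing `θ` under `b`.
  by_cases hex : ∃ θ, (∀ s, tripleDensity p (f θ) s ≤ b s) ∧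
      ∫ s, |b s - tripleDensity p (f θ) s| ∂(refMeasure ρ) ≤ 1 / (m : ℝ) ^ 2 ∧
      h < kernelDist (inputLaw ρ p) (f θ) (f θs)
  swap
  · refine (measure_mono_null (t := ∅) (Set.subset_empty_iff.2 ?_) measure_empty).le.trans zero_le
    rw [Set.eq_empty_iff_forall_notMem]
    rintro u ⟨-, θ, h1, h2, -, h3⟩
    exact hex ⟨θ, h1, h2, h3⟩
  obtain ⟨θ₀, hb₀, hd₀, hh₀⟩ := hex
  have hm0 : (0 : ℝ) < m := by exact_mod_cast hm
  -- A bracket is only almost everywhere strongly measurable, whereas Markov's inequality is applied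
  -- to a measurable function.
  set b' := hb.1.mk b
  have hb' : Measurable b' := hb.1.stronglyMeasurable_mk.measurable
  have hbb : b =ᵐ[refMeasure ρ] b' := hb.1.ae_eq_mk
  set φ : Triple X → ℝ≥0∞ := fun s => ENNReal.ofReal (Real.sqrt (b' s / tripleDensity p (f θs) s))
  have hφ : Measurable φ := by
    have := measurable_tripleDensity hp (hf θs)
    fun_prop
  have haff : ∫⁻ s, φ s ∂(tripleLaw ρ p (f θs)) ≤
      ENNReal.ofReal (Real.exp (1 / m - h / 9216)) := by
    refine (lintegral_sqrt_bracket_le ρ hp hp0 hp1 (hf θ₀) (hf θs) (hf1 θ₀) (hf1 θs) hb hb' hbb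
      hm0 hb₀ hd₀).trans ?_
    have hQ : kernelDist (inputLaw ρ p) (f θ₀) (f θs) ≤ 4 := by
      have : ∀ q : X × X, (⟪f θ₀ q.1, f θ₀ q.2⟫ - ⟪f θs q.1, f θs q.2⟫) ^ 2 ≤ 4 := fun q => by
        have := abs_le.1 (abs_kernel_sub_le (hf1 θ₀) (hf1 θs) q.1 q.2)
        nlinarith
      refine (integral_mono (integrable_kernel_sub_sq _ (hf θ₀) (hf θs) (hf1 θ₀) (hf1 θs))
        (integrable_const 4) this).trans (by simp)
    rw [← ENNReal.ofReal_add (by linarith) (by positivity)]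
    refine ENNReal.ofReal_le_ofReal ?_
    have := Real.add_one_le_exp (1 / (m : ℝ) - h / 9216)
    linarith
  have hsub : (Measure.pi fun _ : Fin m => tripleLaw ρ p (f θs))
      {u | (∀ i, 0 < p (u i).1 ∧ 0 < p (u i).2.1) ∧ ∃ θ, (∀ s, tripleDensity p (f θ) s ≤ b s) ∧
        ∫ s, |b s - tripleDensity p (f θ) s| ∂(refMeasure ρ) ≤ 1 / (m : ℝ) ^ 2 ∧
        ∑ i, Real.log (tripleDensity p (f θs) (u i)) ≤ ∑ i, Real.log (tripleDensity p (f θ) (u i)) ∧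
        h < kernelDist (inputLaw ρ p) (f θ) (f θs)} ≤
      (Measure.pi fun _ : Fin m => tripleLaw ρ p (f θs)) {u | 1 ≤ ∏ i, φ (u i)} := by
    refine measure_mono_ae ?_
    have hbb' : ∀ᵐ s ∂(tripleLaw ρ p (f θs)), b s = b' s :=
      (withDensity_absolutelyContinuous _ _).ae_le hbb
    have hall : ∀ᵐ u ∂(Measure.pi fun _ : Fin m => tripleLaw ρ p (f θs)), ∀ i, b (u i) = b' (u i) :=
      Filter.eventually_all.2 fun i => (Measure.tendsto_eval_ae_ae
        (μ := fun _ : Fin m => tripleLaw ρ p (f θs)) (i := i)).eventually hbb'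
    filter_upwards [hall] with u hu
    rintro ⟨hpos, θ, h1, -, h3, -⟩
    change 1 ≤ ∏ i, φ (u i)
    -- Halving the log-likelihood ratio produces the square roots whose mean is the affinity.
    -- Positivity of the sampled densities matters here, since `Real.log 0 = 0` would break the
    -- exponentiation.
    have h4 : ∀ i, Real.exp ((Real.log (tripleDensity p (f θ) (u i)) -
        Real.log (tripleDensity p (f θs) (u i))) / 2) ≤
        Real.sqrt (b' (u i) / tripleDensity p (f θs) (u i)) := by
      intro i
      have p1 := tripleDensity_pos (f θ) (hpos i).1 (hpos i).2
      have p2 := tripleDensity_pos (f θs) (hpos i).1 (hpos i).2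
      refine Real.le_sqrt_of_sq_le ?_
      rw [← Real.exp_nat_mul, Nat.cast_ofNat, mul_div_cancel₀ _ two_ne_zero, Real.exp_sub,
        Real.exp_log p1, Real.exp_log p2, ← hu i]
      exact div_le_div_of_nonneg_right (h1 _) p2.le
    have h5 : (1 : ℝ) ≤ ∏ i, Real.sqrt (b' (u i) / tripleDensity p (f θs) (u i)) := by
      refine le_trans ?_ (Finset.prod_le_prod (fun i _ => (Real.exp_pos _).le) fun i _ => h4 i)
      rw [← Real.exp_sum, ← Finset.sum_div, Finset.sum_sub_distrib]
      exact Real.one_le_exp (by linarith)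
    rw [← ENNReal.ofReal_prod_of_nonneg fun i _ => Real.sqrt_nonneg _]
    exact ENNReal.one_le_ofReal.2 h5
  refine hsub.trans ((measure_pi_one_le_prod_le _ hφ m).trans ((pow_le_pow_left' haff m).trans ?_))
  rw [← ENNReal.ofReal_pow (Real.exp_pos _).le, ← Real.exp_nat_mul]
  refine le_of_eq ?_
  congr 2
  field_simp

/-- The infimum of cardinalities is attained when finite: otherwise every bracket would have at
least `N + 1` elements. -/
theorem exists_isBracket_encard_le {S : Type*} [MeasurableSpace S] {μ : Measure S}
    {𝓟 : Set (S → ℝ)} {ε : ℝ} {N : ℕ} (h : bracketingNumber μ 𝓟 ε = (N : ℕ∞)) :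
    ∃ 𝓝 : Set (S → ℝ), IsBracket μ 𝓟 ε 𝓝 ∧ 𝓝.encard ≤ N := by
  by_contra! hlt
  have : ((N : ℕ∞) + 1) ≤ bracketingNumber μ 𝓟 ε :=
    le_iInf₂ fun 𝓝 h𝓝 => Order.add_one_le_of_lt (hlt 𝓝 h𝓝)
  rw [h] at this
  norm_cast at this
  omega

variable {Θ : Type*} {f : Θ → X → Rep r} {θs : Θ} {m N : ℕ}

/-- The maximum likelihood estimator recovers the similarity kernel at rate `log N / m`. -/
theorem measure_kernelDist_mle_le (hp : Measurable p) (hp0 : ∀ x, 0 ≤ p x)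
    (hp1 : ∫⁻ x, ENNReal.ofReal (p x) ∂ρ = 1) (hf : ∀ θ, Measurable (f θ))
    (hf1 : ∀ θ x, ‖f θ x‖ ≤ 1) (hm : 1 ≤ m) (hN : 1 ≤ N)
    (hbr : bracketingNumber (refMeasure ρ) (Set.range fun θ => tripleDensity p (f θ))
      (1 / (m : ℝ) ^ 2) = (N : ℕ∞)) {θhat : (Fin m → Triple X) → Θ}
    (hmle : ∀ᵐ u ∂(Measure.pi fun _ : Fin m => tripleLaw ρ p (f θs)), IsMLE p f u (θhat u))
    {δ : ℝ} (hδ : 0 < δ) :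
    (Measure.pi fun _ : Fin m => tripleLaw ρ p (f θs))
      {u | 9216 * (1 + Real.log (N / δ)) / m <
        kernelDist (inputLaw ρ p) (f (θhat u)) (f θs)} ≤ ENNReal.ofReal δ := by
  have hT := isProbabilityMeasure_tripleLaw ρ hp hp0 hp1 (hf θs)
  have hm0 : (0 : ℝ) < m := by exact_mod_cast hm
  have hN0 : (0 : ℝ) < N := by exact_mod_cast hN
  classical
  obtain ⟨𝓝, h𝓝, hcard⟩ := exists_isBracket_encard_le hbr
  have hfin : 𝓝.Finite := Set.finite_of_encard_le_coe hcard
  set h := 9216 * (1 + Real.log (N / δ)) / m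
  set bad : (Triple X → ℝ) → Set (Fin m → Triple X) := fun b =>
    {u | (∀ i, 0 < p (u i).1 ∧ 0 < p (u i).2.1) ∧ ∃ θ, (∀ s, tripleDensity p (f θ) s ≤ b s) ∧
      ∫ s, |b s - tripleDensity p (f θ) s| ∂(refMeasure ρ) ≤ 1 / (m : ℝ) ^ 2 ∧
      ∑ i, Real.log (tripleDensity p (f θs) (u i)) ≤ ∑ i, Real.log (tripleDensity p (f θ) (u i)) ∧
      h < kernelDist (inputLaw ρ p) (f θ) (f θs)}
  -- A bracketing set may contain useless non-integrable members; discarding them does not increase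
  -- its cardinality.
  set T := hfin.toFinset.filter fun b => Integrable b (refMeasure ρ)
  have hTcard : T.card ≤ N := by
    refine (Finset.card_filter_le _ _).trans ?_
    rw [hfin.encard_eq_coe_toFinset_card] at hcard
    exact_mod_cast hcard
  calc _ ≤ (Measure.pi fun _ : Fin m => tripleLaw ρ p (f θs)) (⋃ b ∈ T, bad b) := by
        refine measure_mono_ae ?_
        filter_upwards [hmle, ae_pi_tripleLaw_pos ρ hp hp0 hp1 (hf θs) m] with u hu hpos
        intro hlt
        obtain ⟨b, hb, hbi, hle, hd⟩ := h𝓝 _ ⟨θhat u, rfl⟩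
        exact Set.mem_biUnion (show b ∈ (T : Set _) by simp [T, hb, hbi])
          ⟨hpos, θhat u, hle, hd, hu θs, hlt⟩
    _ ≤ ∑ b ∈ T, (Measure.pi fun _ : Fin m => tripleLaw ρ p (f θs)) (bad b) :=
        measure_biUnion_finset_le _ _
    _ ≤ ∑ _b ∈ T, ENNReal.ofReal (δ / N) := by
        refine Finset.sum_le_sum fun b hb => ?_
        -- The threshold `h` is chosen so that the exponential bound for each bracket is exactly `δ
        -- / N`.
        refine (measure_exists_bracketed_le ρ hp hp0 hp1 hf hf1 hm
          (Finset.mem_filter.1 hb).2 h).trans (ENNReal.ofReal_le_ofReal (le_of_eq ?_))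
        have : 1 - m * h / 9216 = -Real.log (N / δ) := by
          simp only [h]; field_simp; ring
        rw [this, ← Real.log_inv, Real.exp_log (by positivity), inv_div]
    _ ≤ ENNReal.ofReal δ := by
        rw [Finset.sum_const, nsmul_eq_mul, ← ENNReal.ofReal_natCast,
          ← ENNReal.ofReal_mul (Nat.cast_nonneg _)]
        refine ENNReal.ofReal_le_ofReal ?_
        have : (T.card : ℝ) ≤ N := by exact_mod_cast hTcard
        calc (T.card : ℝ) * (δ / N) ≤ N * (δ / N) := by gcongr
          _ = δ := by field_simp

/-- If a single bracket covers the class, all kernels are close to each other. -/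
theorem kernelDist_le_of_bracketingNumber_le_one (hp : Measurable p) (hp0 : ∀ x, 0 ≤ p x)
    (hp1 : ∫⁻ x, ENNReal.ofReal (p x) ∂ρ = 1) (hf : ∀ θ, Measurable (f θ))
    (hf1 : ∀ θ x, ‖f θ x‖ ≤ 1) (hN : N ≤ 1)
    (hbr : bracketingNumber (refMeasure ρ) (Set.range fun θ => tripleDensity p (f θ))
      (1 / (m : ℝ) ^ 2) = (N : ℕ∞)) (θ θ' : Θ) :
    kernelDist (inputLaw ρ p) (f θ) (f θ') ≤ 96 / (m : ℝ) ^ 2 := by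
  obtain ⟨𝓝, h𝓝, hcard⟩ := exists_isBracket_encard_le hbr
  have hsub : 𝓝.Subsingleton := Set.encard_le_one_iff_subsingleton.1
    (hcard.trans (by exact_mod_cast hN))
  obtain ⟨b, hb, hbi, -, hd⟩ := h𝓝 _ ⟨θ, rfl⟩
  obtain ⟨b₂, hb₂, -, -, hd'⟩ := h𝓝 _ ⟨θ', rfl⟩
  obtain rfl := hsub hb hb₂
  have i1 := integrable_tripleDensity ρ hp hp0 hp1 (hf θ)
  have i2 := integrable_tripleDensity ρ hp hp0 hp1 (hf θ')
  have j1 : Integrable (fun s => |b s - tripleDensity p (f θ) s|) (refMeasure ρ) := (hbi.sub i1).abs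
  have j2 : Integrable (fun s => |b s - tripleDensity p (f θ') s|) (refMeasure ρ) :=
    (hbi.sub i2).abs
  have htri : ∫ s, |tripleDensity p (f θ) s - tripleDensity p (f θ') s| ∂(refMeasure ρ) ≤
      1 / (m : ℝ) ^ 2 + 1 / (m : ℝ) ^ 2 := by
    calc _ ≤ ∫ s, (|b s - tripleDensity p (f θ) s| + |b s - tripleDensity p (f θ') s|)
          ∂(refMeasure ρ) := by
          refine integral_mono (i1.sub i2).abs (j1.add j2) fun s => ?_
          have := abs_sub_le (tripleDensity p (f θ) s) (b s) (tripleDensity p (f θ') s)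
          rwa [abs_sub_comm _ (b s)] at this
      _ ≤ _ := by
          rw [integral_add j1 j2]
          exact add_le_add hd hd'
  refine (kernelDist_le_integral_abs_sub ρ hp hp0 hp1 (hf θ) (hf θ') (hf1 θ) (hf1 θ')).trans ?_
  have : (96 : ℝ) / (m : ℝ) ^ 2 = 48 * (1 / (m : ℝ) ^ 2 + 1 / (m : ℝ) ^ 2) := by ring
  rw [this]
  exact mul_le_mul_of_nonneg_left htri (by norm_num)

end MaximumLikelihood

end Contrastive

/-! ### Exponential moments of squared Gaussians. -/

section GaussianMoments

theorem integrable_exp_sq_div_gaussianReal :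
    Integrable (fun z : ℝ => Real.exp (z ^ 2 / 12)) (gaussianReal 0 1) := by
  rw [gaussianReal_of_var_ne_zero _ one_ne_zero, integrable_withDensity_iff_integrable_smul'
    (measurable_gaussianPDF _ _) (Filter.Eventually.of_forall fun x => ENNReal.ofReal_lt_top)]
  -- The exponent left after multiplying by the Gaussian density is `5 / 12 = 1 / 2 - 1 / 12`.
  have h := (integrable_exp_neg_mul_sq (b := 5 / 12) (by norm_num)).const_mul
    (Real.sqrt (2 * Real.pi))⁻¹
  refine h.congr (Filter.Eventually.of_forall fun x => ?_)
  simp only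
  rw [gaussianPDF, ENNReal.toReal_ofReal (gaussianPDFReal_nonneg _ _ _), gaussianPDFReal,
    smul_eq_mul, mul_assoc, ← Real.exp_add]
  congr 2
  · simp
  · simp only [NNReal.coe_one]
    ring

/-- The value `𝔼[exp (Z² / 12)]` for a standard normal `Z`. -/
noncomputable def gaussianExpSqMoment : ℝ := ∫ z, Real.exp (z ^ 2 / 12) ∂(gaussianReal 0 1)

theorem exp_mul_sq_le_of_le {s : ℝ} (hs : s ≤ 1 / 12) (z : ℝ) :
    Real.exp (s * z ^ 2) ≤ Real.exp (z ^ 2 / 12) :=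
  Real.exp_le_exp.2 (by nlinarith [sq_nonneg z])

theorem integrable_exp_mul_sq_gaussianReal {s : ℝ} (hs : s ≤ 1 / 12) :
    Integrable (fun z : ℝ => Real.exp (s * z ^ 2)) (gaussianReal 0 1) :=
  integrable_exp_sq_div_gaussianReal.mono (by fun_prop) (Filter.Eventually.of_forall fun z => by
    rw [Real.norm_of_nonneg (Real.exp_pos _).le, Real.norm_of_nonneg (Real.exp_pos _).le]
    exact exp_mul_sq_le_of_le hs z)

theorem integral_exp_mul_sq_gaussianReal_le {s : ℝ} (hs : s ≤ 1 / 12) :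
    ∫ z, Real.exp (s * z ^ 2) ∂(gaussianReal 0 1) ≤ gaussianExpSqMoment :=
  integral_mono (integrable_exp_mul_sq_gaussianReal hs) integrable_exp_sq_div_gaussianReal
    fun z => exp_mul_sq_le_of_le hs z

theorem gaussianExpSqMoment_nonneg : 0 ≤ gaussianExpSqMoment :=
  integral_nonneg fun _ => (Real.exp_pos _).le

/-- A one-dimensional marginal of the standard Gaussian. -/
theorem map_inner_stdGaussian {r : ℕ} (v : EuclideanSpace ℝ (Fin r)) :
    (stdGaussian (EuclideanSpace ℝ (Fin r))).map (fun e => ⟪v, e⟫) =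
      (gaussianReal 0 1).map (fun z => ‖v‖ * z) := by
  have h := IsGaussian.map_eq_gaussianReal (μ := stdGaussian (EuclideanSpace ℝ (Fin r)))
    (innerSL ℝ v)
  rw [integral_strongDual_stdGaussian, variance_dual_stdGaussian, innerSL_apply_norm] at h
  rw [gaussianReal_map_const_mul, mul_zero, mul_one]
  have e : (innerSL ℝ v : EuclideanSpace ℝ (Fin r) → ℝ) = fun e => ⟪v, e⟫ := by
    ext e; simp
  rw [e] at h
  rw [h]
  congr 1
  ext
  simp

theorem integrable_exp_inner_sq_stdGaussian {r : ℕ} (v : EuclideanSpace ℝ (Fin r)) {s : ℝ}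
    (hs : s * ‖v‖ ^ 2 ≤ 1 / 12) :
    Integrable (fun e => Real.exp (s * ⟪v, e⟫ ^ 2)) (stdGaussian (EuclideanSpace ℝ (Fin r))) ∧
    ∫ e, Real.exp (s * ⟪v, e⟫ ^ 2) ∂(stdGaussian (EuclideanSpace ℝ (Fin r))) ≤
      gaussianExpSqMoment := by
  have h1 : Integrable (fun z : ℝ => Real.exp (s * z ^ 2))
      ((stdGaussian (EuclideanSpace ℝ (Fin r))).map (fun e => ⟪v, e⟫)) := by
    rw [map_inner_stdGaussian, integrable_map_measure (by fun_prop) (by fun_prop)]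
    refine (integrable_exp_mul_sq_gaussianReal hs).congr (Filter.Eventually.of_forall fun z => ?_)
    simp only [Function.comp_apply]
    ring_nf
  have h2 : ∫ e, Real.exp (s * ⟪v, e⟫ ^ 2) ∂(stdGaussian (EuclideanSpace ℝ (Fin r))) =
      ∫ z, Real.exp (s * z ^ 2)
        ∂((stdGaussian (EuclideanSpace ℝ (Fin r))).map (fun e => ⟪v, e⟫)) := by
    rw [integral_map (by fun_prop) (by fun_prop)]
  have hm : AEMeasurable (fun e : EuclideanSpace ℝ (Fin r) => ⟪v, e⟫)
      (stdGaussian (EuclideanSpace ℝ (Fin r))) := by fun_prop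
  refine ⟨(integrable_map_measure (f := fun e => ⟪v, e⟫) (by fun_prop) hm).1 h1, ?_⟩
  rw [h2, map_inner_stdGaussian, integral_map (by fun_prop) (by fun_prop)]
  refine le_of_eq_of_le (integral_congr_ae (Filter.Eventually.of_forall fun z => ?_))
    (integral_exp_mul_sq_gaussianReal_le hs)
  simp only
  ring_nf

end GaussianMoments

namespace Contrastive

/-! ### The truncated squared loss. -/

section TruncatedLoss

theorem truncLoss_eq_min (L a y : ℝ) : truncLoss L a y = min ((y - a) ^ 2) L := by
  rw [truncLoss, min_def]

theorem truncLoss_nonneg {L : ℝ} (hL : 0 ≤ L) (a y : ℝ) : 0 ≤ truncLoss L a y := by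
  rw [truncLoss_eq_min]; exact le_min (sq_nonneg _) hL

theorem truncLoss_le (L a y : ℝ) : truncLoss L a y ≤ L := by
  rw [truncLoss_eq_min]; exact min_le_right _ _

theorem truncLoss_le_sqLoss (L a y : ℝ) : truncLoss L a y ≤ sqLoss a y := by
  rw [truncLoss_eq_min]; exact min_le_left _ _

/-- As the square of a 1-Lipschitz function of `a` with values in `[0, √L]`, the loss is visibly `2
√L`-Lipschitz in `a`. -/
theorem truncLoss_eq_sq {L : ℝ} (hL : 0 ≤ L) (a y : ℝ) :
    truncLoss L a y = (min |y - a| (Real.sqrt L)) ^ 2 := by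
  rw [truncLoss_eq_min]
  rcases le_total |y - a| (Real.sqrt L) with h | h
  · have : (y - a) ^ 2 ≤ L := by
      rw [← sq_abs, ← Real.sq_sqrt hL]; exact pow_le_pow_left₀ (abs_nonneg _) h 2
    rw [min_eq_left h, min_eq_left this, sq_abs]
  · have : L ≤ (y - a) ^ 2 := by
      rw [← sq_abs, ← Real.sq_sqrt hL]; exact pow_le_pow_left₀ (Real.sqrt_nonneg _) h 2
    rw [min_eq_right h, min_eq_right this, Real.sq_sqrt hL]

theorem abs_truncLoss_sub_le {L : ℝ} (hL : 0 ≤ L) (a a' y : ℝ) :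
    |truncLoss L a y - truncLoss L a' y| ≤ 2 * Real.sqrt L * |a - a'| := by
  rw [truncLoss_eq_sq hL, truncLoss_eq_sq hL]
  set u := min |y - a| (Real.sqrt L)
  set v := min |y - a'| (Real.sqrt L)
  have hu : 0 ≤ u := le_min (abs_nonneg _) (Real.sqrt_nonneg _)
  have hv : 0 ≤ v := le_min (abs_nonneg _) (Real.sqrt_nonneg _)
  have hu' : u ≤ Real.sqrt L := min_le_right _ _
  have hv' : v ≤ Real.sqrt L := min_le_right _ _
  have huv : |u - v| ≤ |a - a'| := by
    have h1 := abs_min_sub_min_le_max |y - a| (Real.sqrt L) |y - a'| (Real.sqrt L)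
    rw [sub_self, abs_zero, max_eq_left (abs_nonneg _)] at h1
    have h2 := abs_abs_sub_abs_le_abs_sub (y - a) (y - a')
    rw [sub_sub_sub_cancel_left, abs_sub_comm a'] at h2
    exact h1.trans h2
  have : u ^ 2 - v ^ 2 = (u + v) * (u - v) := by ring
  rw [this, abs_mul, abs_of_nonneg (add_nonneg hu hv)]
  exact mul_le_mul (by linarith) huv (abs_nonneg _) (by positivity)

theorem measurable_truncLoss (L : ℝ) : Measurable fun q : ℝ × ℝ => truncLoss L q.1 q.2 := by
  have : (fun q : ℝ × ℝ => truncLoss L q.1 q.2) = fun q => min ((q.2 - q.1) ^ 2) L :=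
    funext fun q => truncLoss_eq_min _ _ _
  rw [this]
  fun_prop

/-- The inequality `u ≤ exp u` at `u = (x - L) / s`; it converts an exponential moment of the loss
into a bound on the part removed by truncation. -/
theorem sub_le_mul_exp {x L s : ℝ} (hs : 0 < s) :
    x - L ≤ s * (Real.exp (x / s) * Real.exp (-(L / s))) := by
  rw [← Real.exp_add]
  have h := Real.add_one_le_exp (x / s + -(L / s))
  have : x - L = s * (x / s + -(L / s)) := by field_simp; ring
  rw [this]
  exact mul_le_mul_of_nonneg_left (by linarith) hs.le

end TruncatedLoss

/-! ### The labeled law: the squared risk and the cost of truncation. -/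

section Labeled

variable {X : Type*} [MeasurableSpace X] {r : ℕ}

instance isProbabilityMeasure_noiseLaw : IsProbabilityMeasure (noiseLaw r) := by
  unfold noiseLaw; infer_instance

theorem measurable_label {f : X → Rep r} (hf : Measurable f) (β : Rep r) :
    Measurable fun q : X × (Rep r × ℝ) => (q.1, ⟪β, f q.1 + q.2.1⟫ + q.2.2) := by
  fun_prop

theorem isProbabilityMeasure_labeledLaw (P : Measure X) [IsProbabilityMeasure P] {f : X → Rep r}
    (hf : Measurable f) (β : Rep r) : IsProbabilityMeasure (labeledLaw P f β) :=
  Measure.isProbabilityMeasure_map (measurable_label hf β).aemeasurable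

theorem memLp_noise (β : Rep r) :
    MemLp (fun e : Rep r × ℝ => ⟪β, e.1⟫ + e.2) 2 (noiseLaw r) := by
  have h1 : MemLp (fun e : Rep r => ⟪β, e⟫) 2 (stdGaussian (Rep r)) :=
    (IsGaussian.memLp_two_id (μ := stdGaussian (Rep r))).const_inner β
  have h2 : MemLp (fun e : Rep r × ℝ => e.2) 2 (noiseLaw r) :=
    (IsGaussian.memLp_two_id (μ := gaussianReal 0 1)).comp_snd _
  exact MemLp.add (h1.comp_fst _) h2

theorem integral_noise (β : Rep r) : ∫ e, (⟪β, e.1⟫ + e.2) ∂(noiseLaw r) = 0 := by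
  have h := predictor_eq (fun _ : Unit => (0 : Rep r)) β ()
  rw [predictor, responseLaw, integral_map (by fun_prop) (by fun_prop)] at h
  simpa using h

variable (P : Measure X) [IsProbabilityMeasure P]

theorem integrable_sq_add_noise {h : X → ℝ} (hh : Measurable h) {C : ℝ} (hC : ∀ x, |h x| ≤ C)
    (β : Rep r) :
    Integrable (fun q : X × (Rep r × ℝ) => (h q.1 + (⟪β, q.2.1⟫ + q.2.2)) ^ 2)
      (P.prod (noiseLaw r)) := by
  have h1 : MemLp (fun q : X × (Rep r × ℝ) => h q.1) 2 (P.prod (noiseLaw r)) :=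
    MemLp.of_bound (hh.comp measurable_fst).aestronglyMeasurable C
      (Filter.Eventually.of_forall fun q => hC _)
  have h2 : MemLp (fun q : X × (Rep r × ℝ) => ⟪β, q.2.1⟫ + q.2.2) 2 (P.prod (noiseLaw r)) :=
    (memLp_noise β).comp_snd P
  exact (h1.add h2).integrable_sq

/-- The cross term vanishes because the noise is centered and independent of the input. The noise
variance is then common to all predictors and cancels in the excess risk. -/
theorem integral_sq_add_noise {h : X → ℝ} (hh : Measurable h) {C : ℝ} (hC : ∀ x, |h x| ≤ C)
    (β : Rep r) :
    ∫ q : X × (Rep r × ℝ), (h q.1 + (⟪β, q.2.1⟫ + q.2.2)) ^ 2 ∂(P.prod (noiseLaw r)) =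
      ∫ x, h x ^ 2 ∂P + ∫ e, (⟪β, e.1⟫ + e.2) ^ 2 ∂(noiseLaw r) := by
  have i1 : Integrable (fun x => h x ^ 2) P :=
    Integrable.of_bound (by fun_prop) (C ^ 2) (Filter.Eventually.of_forall fun x => by
      rw [Real.norm_eq_abs, abs_pow]; exact pow_le_pow_left₀ (abs_nonneg _) (hC x) 2)
  have i2 : Integrable (fun e : Rep r × ℝ => (⟪β, e.1⟫ + e.2) ^ 2) (noiseLaw r) :=
    (memLp_noise β).integrable_sq
  have i3 : Integrable h P :=
    Integrable.of_bound (by fun_prop) C (Filter.Eventually.of_forall hC)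
  have i4 : Integrable (fun e : Rep r × ℝ => ⟪β, e.1⟫ + e.2) (noiseLaw r) :=
    (memLp_noise β).integrable one_le_two
  have j1 : Integrable (fun q : X × (Rep r × ℝ) => h q.1 ^ 2) (P.prod (noiseLaw r)) :=
    i1.comp_fst _
  have j2 : Integrable (fun q : X × (Rep r × ℝ) => (⟪β, q.2.1⟫ + q.2.2) ^ 2)
    (P.prod (noiseLaw r)) := i2.comp_snd _
  have j3 : Integrable (fun q : X × (Rep r × ℝ) => h q.1 * (⟪β, q.2.1⟫ + q.2.2))
    (P.prod (noiseLaw r)) := i3.mul_prod i4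
  have j12 : Integrable (fun q : X × (Rep r × ℝ) => h q.1 ^ 2 + (⟪β, q.2.1⟫ + q.2.2) ^ 2)
    (P.prod (noiseLaw r)) := j1.add j2
  have hexp : ∀ q : X × (Rep r × ℝ), (h q.1 + (⟪β, q.2.1⟫ + q.2.2)) ^ 2 =
      h q.1 ^ 2 + (⟪β, q.2.1⟫ + q.2.2) ^ 2 + 2 * (h q.1 * (⟪β, q.2.1⟫ + q.2.2)) := fun q => by ring
  simp only [hexp]
  rw [integral_add j12 (j3.const_mul 2), integral_add j1 j2, integral_const_mul,
    integral_prod_mul (fun x => h x) (fun e : Rep r × ℝ => ⟪β, e.1⟫ + e.2), integral_noise,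
    integral_fun_fst (f := fun x => h x ^ 2),
    integral_fun_snd (f := fun e : Rep r × ℝ => (⟪β, e.1⟫ + e.2) ^ 2)]
  simp

theorem measurable_sqLoss_inner {f : X → Rep r} (hf : Measurable f) (β : Rep r) :
    Measurable fun q : X × ℝ => sqLoss ⟪β, f q.1⟫ q.2 := by
  unfold sqLoss; fun_prop

theorem measurable_truncLoss_inner {f : X → Rep r} (hf : Measurable f) (L : ℝ) (β : Rep r) :
    Measurable fun q : X × ℝ => truncLoss L ⟪β, f q.1⟫ q.2 :=
  (measurable_truncLoss L).comp (by fun_prop : Measurable fun q : X × ℝ => (⟪β, f q.1⟫, q.2))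

theorem abs_inner_sub_inner_le {D : ℝ} {β β' a b : Rep r} (hβ : ‖β‖ ≤ D) (hβ' : ‖β'‖ ≤ D)
    (ha : ‖a‖ ≤ 1) (hb : ‖b‖ ≤ 1) : |⟪β', b⟫ - ⟪β, a⟫| ≤ 2 * D := by
  have h1 := abs_inner_le_norm_of_norm_le_one ha β
  have h2 := abs_inner_le_norm_of_norm_le_one hb β'
  rw [real_inner_comm] at h1 h2
  exact (abs_sub _ _).trans (by linarith)

variable {fs f : X → Rep r} {βs β : Rep r} {D : ℝ}

theorem integrable_sqLoss (hfs : Measurable fs) (hf : Measurable f) (hfs1 : ∀ x, ‖fs x‖ ≤ 1)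
    (hf1 : ∀ x, ‖f x‖ ≤ 1) (hβs : ‖βs‖ ≤ D) (hβ : ‖β‖ ≤ D) :
    Integrable (fun q : X × ℝ => sqLoss ⟪β, f q.1⟫ q.2) (labeledLaw P fs βs) := by
  rw [labeledLaw, integrable_map_measure (measurable_sqLoss_inner hf β).aestronglyMeasurable
    (measurable_label hfs βs).aemeasurable]
  refine (integrable_sq_add_noise P (h := fun x => ⟪βs, fs x⟫ - ⟪β, f x⟫) (by fun_prop)
    (fun x => abs_inner_sub_inner_le hβ hβs (hf1 x) (hfs1 x)) βs).congr
    (Filter.Eventually.of_forall fun q => ?_)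
  simp only [Function.comp_apply, sqLoss, inner_add_right]
  ring

theorem integral_sqLoss (hfs : Measurable fs) (hf : Measurable f) (hfs1 : ∀ x, ‖fs x‖ ≤ 1)
    (hf1 : ∀ x, ‖f x‖ ≤ 1) (hβs : ‖βs‖ ≤ D) (hβ : ‖β‖ ≤ D) :
    ∫ q, sqLoss ⟪β, f q.1⟫ q.2 ∂(labeledLaw P fs βs) =
      ∫ x, (⟪βs, fs x⟫ - ⟪β, f x⟫) ^ 2 ∂P + ∫ e, (⟪βs, e.1⟫ + e.2) ^ 2 ∂(noiseLaw r) := by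
  rw [labeledLaw, integral_map (measurable_label hfs βs).aemeasurable
    (measurable_sqLoss_inner hf β).aestronglyMeasurable,
    ← integral_sq_add_noise P (h := fun x => ⟪βs, fs x⟫ - ⟪β, f x⟫) (by fun_prop)
    (fun x => abs_inner_sub_inner_le hβ hβs (hf1 x) (hfs1 x)) βs]
  refine integral_congr_ae (Filter.Eventually.of_forall fun q => ?_)
  simp only [sqLoss, inner_add_right]
  ring

/-- The excess risk is the squared `L²` distance to the optimal predictor. -/
theorem excessRisk_eq (hfs : Measurable fs) (hf : Measurable f) (hfs1 : ∀ x, ‖fs x‖ ≤ 1)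
    (hf1 : ∀ x, ‖f x‖ ≤ 1) (hβs : ‖βs‖ ≤ D) (hβ : ‖β‖ ≤ D) :
    excessRisk P fs βs f β = ∫ x, (⟪βs, fs x⟫ - ⟪β, f x⟫) ^ 2 ∂P := by
  simp only [excessRisk, predictor_eq]
  rw [integral_sqLoss P hfs hf hfs1 hf1 hβs hβ, integral_sqLoss P hfs hfs hfs1 hfs1 hβs hβs]
  simp

/-- The risk of the truncated squared loss. -/
noncomputable def truncRisk (P : Measure X) (fs : X → Rep r) (βs : Rep r) (L : ℝ) (f : X → Rep r)
    (β : Rep r) : ℝ :=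
  ∫ q, truncLoss L ⟪β, f q.1⟫ q.2 ∂(labeledLaw P fs βs)

theorem integrable_truncLoss (hfs : Measurable fs) (hf : Measurable f) {L : ℝ} (hL : 0 ≤ L)
    (β : Rep r) :
    Integrable (fun q : X × ℝ => truncLoss L ⟪β, f q.1⟫ q.2) (labeledLaw P fs βs) := by
  have := isProbabilityMeasure_labeledLaw P hfs βs
  exact Integrable.of_bound (measurable_truncLoss_inner hf L β).aestronglyMeasurable L
    (Filter.Eventually.of_forall fun q => by
      rw [Real.norm_eq_abs, abs_of_nonneg (truncLoss_nonneg hL _ _)]; exact truncLoss_le _ _ _)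

theorem truncRisk_le (hfs : Measurable fs) (hf : Measurable f) (hfs1 : ∀ x, ‖fs x‖ ≤ 1)
    (hf1 : ∀ x, ‖f x‖ ≤ 1) (hβs : ‖βs‖ ≤ D) (hβ : ‖β‖ ≤ D) {L : ℝ} (hL : 0 ≤ L) :
    truncRisk P fs βs L f β ≤ ∫ q, sqLoss ⟪β, f q.1⟫ q.2 ∂(labeledLaw P fs βs) :=
  integral_mono (integrable_truncLoss P hfs hf hL β)
    (integrable_sqLoss P hfs hf hfs1 hf1 hβs hβ) fun _ => truncLoss_le_sqLoss _ _ _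

/-- Truncating at level `36 (D² + 1) log n` changes the risk by `O((D² + 1) / n)`. -/
theorem integral_sqLoss_le_truncRisk_add (hfs : Measurable fs) (hf : Measurable f)
    (hfs1 : ∀ x, ‖fs x‖ ≤ 1) (hf1 : ∀ x, ‖f x‖ ≤ 1) (hβs : ‖βs‖ ≤ D) (hβ : ‖β‖ ≤ D) {L : ℝ}
    {n : ℕ} (hn : 1 ≤ n) (hL : L = 36 * (D ^ 2 + 1) * Real.log n) :
    ∫ q, sqLoss ⟪β, f q.1⟫ q.2 ∂(labeledLaw P fs βs) ≤ truncRisk P fs βs L f β +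
      36 * (D ^ 2 + 1) * (Real.exp 1 * gaussianExpSqMoment ^ 2) / n := by
  set c := D ^ 2 + 1
  have hc : 0 < c := by positivity
  have hn0 : (0 : ℝ) < n := by exact_mod_cast hn
  have hL0 : 0 ≤ L := by
    rw [hL]; exact mul_nonneg (by positivity) (Real.log_natCast_nonneg n)
  have hLn : Real.exp (-(L / (36 * c))) = 1 / n := by
    rw [hL, mul_div_cancel_left₀ _ (by positivity), Real.exp_neg, Real.exp_log hn0, one_div]
  -- The residual satisfies `W² ≤ 3 ((2 D)² + ⟪βs, μ⟫² + ν²)`. Divided by `36 c`, the bounded part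
  -- is at most `1`, giving the factor `e`, and each noise term has coefficient `1 / (12 c)`. Since
  -- `‖βs‖² ≤ c`, both Gaussian factors are controlled by `gaussianExpSqMoment`.
  set U : X × (Rep r × ℝ) → ℝ := fun q =>
    Real.exp 1 * (Real.exp ((1 / (12 * c)) * ⟪βs, q.2.1⟫ ^ 2) *
      Real.exp ((1 / (12 * c)) * q.2.2 ^ 2))
  have hs1 : 1 / (12 * c) * ‖βs‖ ^ 2 ≤ 1 / 12 := by
    have : ‖βs‖ ^ 2 ≤ c := by
      have := pow_le_pow_left₀ (norm_nonneg _) hβs 2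
      simp only [c]; linarith
    rw [div_mul_eq_mul_div, one_mul, div_le_div_iff₀ (by positivity) (by norm_num)]
    linarith
  have hs2 : 1 / (12 * c) ≤ 1 / 12 := by
    apply one_div_le_one_div_of_le (by norm_num)
    have : 1 ≤ c := by simp only [c]; nlinarith [sq_nonneg D]
    linarith
  obtain ⟨g1, g2⟩ := integrable_exp_inner_sq_stdGaussian βs hs1
  have g3 := integrable_exp_mul_sq_gaussianReal hs2
  have g4 := integral_exp_mul_sq_gaussianReal_le hs2
  have hV : Integrable (fun e : Rep r × ℝ => Real.exp 1 *
      (Real.exp ((1 / (12 * c)) * ⟪βs, e.1⟫ ^ 2) * Real.exp ((1 / (12 * c)) * e.2 ^ 2)))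
      (noiseLaw r) := (g1.mul_prod g3).const_mul _
  have hUi : Integrable U (P.prod (noiseLaw r)) := hV.comp_snd _
  have hUle : ∫ q, U q ∂(P.prod (noiseLaw r)) ≤ Real.exp 1 * gaussianExpSqMoment ^ 2 := by
    have : ∫ q, U q ∂(P.prod (noiseLaw r)) = Real.exp 1 *
        ((∫ e, Real.exp (1 / (12 * c) * ⟪βs, e⟫ ^ 2) ∂(stdGaussian (Rep r))) *
          ∫ z, Real.exp (1 / (12 * c) * z ^ 2) ∂(gaussianReal 0 1)) := by
      simp only [U]
      rw [integral_fun_snd (f := fun e : Rep r × ℝ => Real.exp 1 *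
        (Real.exp ((1 / (12 * c)) * ⟪βs, e.1⟫ ^ 2) * Real.exp ((1 / (12 * c)) * e.2 ^ 2))),
        integral_const_mul, noiseLaw, integral_prod_mul
          (fun e : Rep r => Real.exp ((1 / (12 * c)) * ⟪βs, e⟫ ^ 2))
          (fun z : ℝ => Real.exp ((1 / (12 * c)) * z ^ 2))]
      simp
    rw [this, sq]
    refine mul_le_mul_of_nonneg_left ?_ (Real.exp_pos _).le
    exact mul_le_mul g2 g4 (integral_nonneg fun _ => (Real.exp_pos _).le)
      gaussianExpSqMoment_nonneg
  have hpt : ∀ q : X × (Rep r × ℝ),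
      sqLoss ⟪β, f q.1⟫ (⟪βs, fs q.1 + q.2.1⟫ + q.2.2) ≤
        truncLoss L ⟪β, f q.1⟫ (⟪βs, fs q.1 + q.2.1⟫ + q.2.2) + 36 * c / n * U q := by
    intro q
    have hU0 : 0 ≤ 36 * c / n * U q := by simp only [U]; positivity
    rw [truncLoss_eq_min]
    set W := ⟪βs, fs q.1 + q.2.1⟫ + q.2.2 - ⟪β, f q.1⟫
    change W ^ 2 ≤ min (W ^ 2) L + _
    rcases le_total (W ^ 2) L with h | h
    · rw [min_eq_left h]; linarith
    rw [min_eq_right h]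
    have hd := abs_le.1 (abs_inner_sub_inner_le hβ hβs (hf1 q.1) (hfs1 q.1))
    have hW : W = (⟪βs, fs q.1⟫ - ⟪β, f q.1⟫) + ⟪βs, q.2.1⟫ + q.2.2 := by
      simp only [W, inner_add_right]; ring
    have hW2 : W ^ 2 ≤ 3 * ((2 * D) ^ 2 + ⟪βs, q.2.1⟫ ^ 2 + q.2.2 ^ 2) := by
      have h1 : (⟪βs, fs q.1⟫ - ⟪β, f q.1⟫) ^ 2 ≤ (2 * D) ^ 2 := by nlinarith
      rw [hW]
      set x := ⟪βs, fs q.1⟫ - ⟪β, f q.1⟫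
      set y := ⟪βs, q.2.1⟫
      nlinarith [sq_nonneg (x - y), sq_nonneg (x - q.2.2), sq_nonneg (y - q.2.2)]
    have hexp : Real.exp (W ^ 2 / (36 * c)) ≤ U q := by
      simp only [U]
      rw [← Real.exp_add, ← Real.exp_add]
      refine Real.exp_le_exp.2 ?_
      rw [div_le_iff₀ (by positivity)]
      have : (1 + (1 / (12 * c) * ⟪βs, q.2.1⟫ ^ 2 + 1 / (12 * c) * q.2.2 ^ 2)) * (36 * c) =
          36 * c + 3 * ⟪βs, q.2.1⟫ ^ 2 + 3 * q.2.2 ^ 2 := by field_simp; ring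
      rw [this]
      simp only [c]
      nlinarith [sq_nonneg D]
    -- At scale `36 c`, the level `L = 36 c log n` makes `exp (-L / (36 c))` equal to `1 / n`.
    have hsub := sub_le_mul_exp (x := W ^ 2) (L := L) (s := 36 * c) (by positivity)
    rw [hLn] at hsub
    have : 36 * c * (Real.exp (W ^ 2 / (36 * c)) * (1 / n)) ≤ 36 * c / n * U q := by
      rw [show 36 * c * (Real.exp (W ^ 2 / (36 * c)) * (1 / n)) =
        36 * c / n * Real.exp (W ^ 2 / (36 * c)) by ring]
      exact mul_le_mul_of_nonneg_left hexp (by positivity)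
    linarith
  have hsq := integrable_sqLoss P hfs hf hfs1 hf1 hβs hβ
  have htr := integrable_truncLoss P (βs := βs) hfs hf hL0 β
  rw [labeledLaw, integrable_map_measure (measurable_sqLoss_inner hf β).aestronglyMeasurable
    (measurable_label hfs βs).aemeasurable] at hsq
  rw [labeledLaw, integrable_map_measure (measurable_truncLoss_inner hf L β).aestronglyMeasurable
    (measurable_label hfs βs).aemeasurable] at htr
  rw [truncRisk, labeledLaw, integral_map (measurable_label hfs βs).aemeasurable
    (measurable_sqLoss_inner hf β).aestronglyMeasurable,
    integral_map (measurable_label hfs βs).aemeasurable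
    (measurable_truncLoss_inner hf L β).aestronglyMeasurable]
  refine (integral_mono hsq (htr.add (hUi.const_mul (36 * c / n))) hpt).trans ?_
  simp only [Function.comp_def, Pi.add_apply] at htr ⊢
  rw [integral_add htr (hUi.const_mul _), integral_const_mul]
  have := mul_le_mul_of_nonneg_left hUle (show 0 ≤ 36 * c / n by positivity)
  rw [show 36 * c * (Real.exp 1 * gaussianExpSqMoment ^ 2) / n =
    36 * c / n * (Real.exp 1 * gaussianExpSqMoment ^ 2) by ring]
  linarith

end Labeled

/-! ### The smallest singular value of the second moment is at most one. -/

section Conditioning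

variable {X : Type*} [MeasurableSpace X] {r : ℕ}

theorem toEuclideanLin_secondMoment (P : Measure X) [IsProbabilityMeasure P] {f : X → Rep r}
    (hf : Measurable f) (hf1 : ∀ x, ‖f x‖ ≤ 1) (v : Rep r) :
    Matrix.toEuclideanLin (secondMoment P f) v = crossMoment P hf hf hf1 hf1 v := by
  ext i
  have h := inner_crossMoment P hf hf hf1 hf1 (EuclideanSpace.single i (1 : ℝ)) v
  simp only [EuclideanSpace.inner_single_right, one_mul, conj_trivial] at h
  have hij : ∀ j, Integrable (fun x => f x i * f x j) P := fun j =>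
    Integrable.of_bound (by fun_prop) 1 (Filter.Eventually.of_forall fun x => by
      have hc : ∀ k, ‖f x k‖ ≤ 1 := fun k => (PiLp.norm_apply_le (f x) k).trans (hf1 x)
      rw [norm_mul]
      exact mul_le_one₀ (hc i) (norm_nonneg _) (hc j))
  rw [h]
  simp only [Matrix.toLpLin_apply, Matrix.mulVec, dotProduct, secondMoment, Matrix.of_apply]
  simp only [← integral_mul_const]
  rw [← integral_finsetSum _ fun j _ => (hij j).mul_const _]
  refine integral_congr_ae (Filter.Eventually.of_forall fun x => ?_)
  simp only [PiLp.inner_apply, Finset.sum_mul]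
  refine Finset.sum_congr rfl fun j _ => ?_
  simp
  ring

/-- The second moment of vectors in the unit ball is a contraction. The lemma yields `κ ≥ 1`. -/
theorem sigmaMin_secondMoment_le_one (P : Measure X) [IsProbabilityMeasure P] {f : X → Rep r}
    (hf : Measurable f) (hf1 : ∀ x, ‖f x‖ ≤ 1) : sigmaMin (secondMoment P f) ≤ 1 := by
  rw [sigmaMin]
  set T := Matrix.toEuclideanLin (secondMoment P f)
  -- For `r = 0` the index `r - 1` truncates to `0`, and singular values beyond the dimension are
  -- `0` by convention.
  rcases Nat.eq_zero_or_pos r with rfl | hr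
  · rw [T.singularValues_of_finrank_le (by simp)]; exact zero_le_one
  obtain ⟨v, hv⟩ := (T.hasEigenvalue_adjoint_comp_self_sq_singularValues
    (n := r - 1) (by rw [finrank_euclideanSpace_fin]; omega)).exists_hasEigenvector
  set σ := T.singularValues (r - 1)
  have h1 : ‖T v‖ ^ 2 = σ ^ 2 * ‖v‖ ^ 2 := by
    have := hv.apply_eq_smul
    rw [← real_inner_self_eq_norm_sq, ← LinearMap.adjoint_inner_right, ← LinearMap.comp_apply, this,
      inner_smul_right, real_inner_self_eq_norm_sq]
    rfl
  have h2 : ‖T v‖ ≤ ‖v‖ := by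
    rw [show T v = _ from toEuclideanLin_secondMoment P hf hf1 v]
    have := norm_integral_le_of_norm_le_const (μ := P) (f := fun x => ⟪f x, v⟫ • f x) (C := ‖v‖)
      (Filter.Eventually.of_forall fun x => by
        rw [norm_smul]
        exact (mul_le_of_le_one_right (norm_nonneg _) (hf1 x)).trans
          (abs_inner_le_norm_of_norm_le_one (hf1 x) v))
    simpa [crossMoment] using this
  have hv0 : 0 < ‖v‖ := norm_pos_iff.2 hv.2
  have h3 : σ ^ 2 * ‖v‖ ^ 2 ≤ 1 * ‖v‖ ^ 2 := by
    rw [← h1, one_mul]; exact pow_le_pow_left₀ (norm_nonneg _) h2 2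
  have h4 : σ ^ 2 ≤ 1 := le_of_mul_le_mul_right h3 (by positivity)
  nlinarith [T.singularValues_nonneg (r - 1)]

end Conditioning

/-! ### Empirical risk minimization with a learned representation. -/

section Regression

variable {X : Type*} [MeasurableSpace X] {r n : ℕ} (P : Measure X) [IsProbabilityMeasure P]
  {fs f : X → Rep r} {βs : Rep r} {D L : ℝ}

/-- Uniform deviation of the empirical truncated risk over a finite set of parameters. -/
theorem measure_exists_le_abs_sum_le (hfs : Measurable fs) (hf : Measurable f)
    (hf1 : ∀ x, ‖f x‖ ≤ 1) (hL : 0 ≤ L) (hD0 : 0 ≤ D) {F : Finset (Rep r)}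
    (hD : ∀ β ∈ F, ‖β‖ ≤ D) {s : ℝ} (hs : 0 ≤ s) :
    (Measure.pi fun _ : Fin n => labeledLaw P fs βs) {l | ∃ β ∈ F,
        2 * (2 * Real.sqrt L) * D * Real.sqrt n + s ≤
          |∑ j, (truncRisk P fs βs L f β - truncLoss L ⟪β, f (l j).1⟫ (l j).2)|} ≤
      ENNReal.ofReal (2 * Real.exp (-(2 * s ^ 2 / (n * L ^ 2)))) := by
  have hQ := isProbabilityMeasure_labeledLaw P hfs βs
  set Q := labeledLaw P fs βs
  have hφ : Measurable fun q : X × ℝ => f q.1 := hf.comp measurable_fst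
  have hm := fun β => measurable_truncLoss_inner hf L β
  have hB : ∀ (β : Rep r) (q : X × ℝ), |truncLoss L ⟪β, f q.1⟫ q.2| ≤ L := fun β q => by
    rw [abs_of_nonneg (truncLoss_nonneg hL _ _)]; exact truncLoss_le _ _ _
  have hLL : ∀ (β : Rep r) (q w : X × ℝ),
      |truncLoss L ⟪β, f q.1⟫ q.2 - truncLoss L ⟪β, f w.1⟫ w.2| ≤ L := fun β q w => by
    rw [abs_le]
    constructor <;> linarith [truncLoss_nonneg hL ⟪β, f q.1⟫ q.2, truncLoss_le L ⟪β, f q.1⟫ q.2,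
      truncLoss_nonneg hL ⟪β, f w.1⟫ w.2, truncLoss_le L ⟪β, f w.1⟫ w.2]
  have hlip : ∀ (β β' : Rep r) (q : X × ℝ),
      |truncLoss L ⟪β, f q.1⟫ q.2 - truncLoss L ⟪β', f q.1⟫ q.2| ≤
        2 * Real.sqrt L * |⟪β - β', f q.1⟫| := fun β β' q => by
    rw [inner_sub_left]; exact abs_truncLoss_sub_le hL _ _ _
  have h1 := measure_exists_le_sum_le Q hφ (fun q => hf1 q.1) hD0 hD (by positivity) hm hB hLL hlip
    (n := n) hs
  have h2 := measure_exists_le_sum_le Q (K := 2 * Real.sqrt L) (ℓ := fun β q => -truncLoss L ⟪β, f q.1⟫ q.2) hφ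
    (fun q => hf1 q.1) hD0 hD (by positivity) (fun β => (hm β).neg)
    (fun β q => by rw [abs_neg]; exact hB β q)
    (fun β q w => by rw [neg_sub_neg, abs_sub_comm]; exact hLL β q w)
    (fun β β' q => by rw [neg_sub_neg, abs_sub_comm]; exact hlip β β' q) (n := n) hs
  refine le_trans (measure_mono ?_) ((measure_union_le _ _).trans ((add_le_add h1 h2).trans_eq ?_))
  · rintro l ⟨β, hβ, h⟩
    rcases le_abs.1 h with h | h
    · exact Or.inl ⟨β, hβ, h⟩
    · refine Or.inr ⟨β, hβ, h.trans_eq ?_⟩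
      rw [← Finset.sum_neg_distrib]
      refine Finset.sum_congr rfl fun j _ => ?_
      rw [integral_neg, truncRisk]
      ring
  · rw [← ENNReal.ofReal_add (Real.exp_pos _).le (Real.exp_pos _).le]
    congr 1
    ring

/-- The uniform deviation bound for a representation that depends on an independent sample. -/
theorem measure_prod_exists_le_abs_sum_le {U : Type*} [MeasurableSpace U] (μ : Measure U)
    [IsProbabilityMeasure μ] {g : U → X → Rep r} (hg : Measurable fun q : U × X => g q.1 q.2)
    (hg1 : ∀ u x, ‖g u x‖ ≤ 1) (hfs : Measurable fs) (hL : 0 ≤ L) (hD0 : 0 ≤ D)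
    {F : Finset (Rep r)} (hD : ∀ β ∈ F, ‖β‖ ≤ D) {s : ℝ} (hs : 0 ≤ s) :
    (μ.prod (Measure.pi fun _ : Fin n => labeledLaw P fs βs)) {w | ∃ β ∈ F,
        2 * (2 * Real.sqrt L) * D * Real.sqrt n + s ≤
          |∑ j, (truncRisk P fs βs L (g w.1) β - truncLoss L ⟪β, g w.1 (w.2 j).1⟫ (w.2 j).2)|} ≤
      ENNReal.ofReal (2 * Real.exp (-(2 * s ^ 2 / (n * L ^ 2)))) := by
  have hQ := isProbabilityMeasure_labeledLaw P hfs βs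
  have hrisk : ∀ β, Measurable fun u => truncRisk P fs βs L (g u) β := by
    intro β
    have hm : Measurable fun q : U × (X × ℝ) => truncLoss L ⟪β, g q.1 q.2.1⟫ q.2.2 := by
      have h1 : Measurable fun q : U × (X × ℝ) => g q.1 q.2.1 :=
        hg.comp (measurable_fst.prodMk (measurable_fst.comp measurable_snd))
      exact (measurable_truncLoss L).comp
        (by fun_prop : Measurable fun q : U × (X × ℝ) => (⟪β, g q.1 q.2.1⟫, q.2.2))
    have : StronglyMeasurable (Function.uncurry fun (u : U) (q : X × ℝ) =>
        truncLoss L ⟪β, g u q.1⟫ q.2) := hm.stronglyMeasurable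
    exact this.integral_prod_right.measurable
  have hloss : ∀ β (j : Fin n), Measurable fun w : U × (Fin n → X × ℝ) =>
      truncLoss L ⟪β, g w.1 (w.2 j).1⟫ (w.2 j).2 := by
    intro β j
    have h1 : Measurable fun w : U × (Fin n → X × ℝ) => g w.1 (w.2 j).1 :=
      hg.comp (by fun_prop : Measurable fun w : U × (Fin n → X × ℝ) => (w.1, (w.2 j).1))
    exact (measurable_truncLoss L).comp (by fun_prop :
      Measurable fun w : U × (Fin n → X × ℝ) => (⟪β, g w.1 (w.2 j).1⟫, (w.2 j).2))
  -- Finiteness of `F` makes the event measurable, so that its probability can be computed by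
  -- conditioning on the first sample.
  have hset : MeasurableSet {w : U × (Fin n → X × ℝ) | ∃ β ∈ F,
        2 * (2 * Real.sqrt L) * D * Real.sqrt n + s ≤
          |∑ j, (truncRisk P fs βs L (g w.1) β -
            truncLoss L ⟪β, g w.1 (w.2 j).1⟫ (w.2 j).2)|} := by
    have : {w : U × (Fin n → X × ℝ) | ∃ β ∈ F,
        2 * (2 * Real.sqrt L) * D * Real.sqrt n + s ≤
          |∑ j, (truncRisk P fs βs L (g w.1) β -
            truncLoss L ⟪β, g w.1 (w.2 j).1⟫ (w.2 j).2)|} =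
        ⋃ β ∈ F, {w | 2 * (2 * Real.sqrt L) * D * Real.sqrt n + s ≤
          |∑ j, (truncRisk P fs βs L (g w.1) β -
            truncLoss L ⟪β, g w.1 (w.2 j).1⟫ (w.2 j).2)|} := by
      ext w; simp
    rw [this]
    refine Finset.measurableSet_biUnion _ fun β _ => measurableSet_le measurable_const ?_
    have := fun j => (((hrisk β).comp measurable_fst).sub (hloss β j))
    exact (Finset.measurable_sum Finset.univ fun j _ => this j).abs
  rw [Measure.prod_apply hset]
  refine (lintegral_mono (g := fun _ =>
    ENNReal.ofReal (2 * Real.exp (-(2 * s ^ 2 / (n * L ^ 2))))) fun u => ?_).trans (by simp)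
  exact measure_exists_le_abs_sum_le P hfs (hg.comp measurable_prodMk_left) (hg1 u) hL hD0 hD hs

theorem abs_truncLoss_inner_sub_le (hL : 0 ≤ L) {a β β' : Rep r} {η : ℝ} (ha : ‖a‖ ≤ 1)
    (hββ : ‖β - β'‖ ≤ η) (y : ℝ) :
    |truncLoss L ⟪β, a⟫ y - truncLoss L ⟪β', a⟫ y| ≤ 2 * Real.sqrt L * η := by
  refine (abs_truncLoss_sub_le hL _ _ _).trans (mul_le_mul_of_nonneg_left ?_ (by positivity))
  rw [← inner_sub_left, real_inner_comm]
  exact (abs_inner_le_norm_of_norm_le_one ha _).trans hββ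

/-- On the event that empirical truncated risks over a net concentrate, the empirical minimizer
has nearly minimal truncated risk. -/
theorem truncRisk_le_of_isERM (hfs : Measurable fs) (hf : Measurable f) (hf1 : ∀ x, ‖f x‖ ≤ 1)
    (hL : 0 ≤ L) {𝓑 : Set (Rep r)} {F : Finset (Rep r)} {η t : ℝ}
    (hnet : ∀ β ∈ 𝓑, ∃ β' ∈ F, ‖β - β'‖ ≤ η) {l : Fin n → X × ℝ}
    (hdev : ∀ β ∈ F, |∑ j, (truncRisk P fs βs L f β - truncLoss L ⟪β, f (l j).1⟫ (l j).2)| ≤ t)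
    {βhat : Rep r} (herm : IsERM L f 𝓑 l βhat) {β : Rep r} (hβ : β ∈ 𝓑) :
    n * truncRisk P fs βs L f βhat ≤ n * truncRisk P fs βs L f β + 2 * t +
      8 * n * (Real.sqrt L * η) := by
  have hQ := isProbabilityMeasure_labeledLaw P hfs βs
  -- Moving `β` to the net changes both `n` times the risk and the empirical sum by at most `2 n √L
  -- η`; the comparison below uses this bound at two parameters.
  have key : ∀ β ∈ 𝓑, |n * truncRisk P fs βs L f β - ∑ j, truncLoss L ⟪β, f (l j).1⟫ (l j).2| ≤
      t + 4 * n * (Real.sqrt L * η) := by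
    intro β hβ
    obtain ⟨β', hβ', hd⟩ := hnet β hβ
    have h1 := hdev β' hβ'
    rw [Finset.sum_sub_distrib, Finset.sum_const, Finset.card_univ, Fintype.card_fin,
      nsmul_eq_mul] at h1
    have h2 : |truncRisk P fs βs L f β - truncRisk P fs βs L f β'| ≤ 2 * Real.sqrt L * η := by
      rw [truncRisk, truncRisk, ← integral_sub (integrable_truncLoss P hfs hf hL _)
        (integrable_truncLoss P hfs hf hL _)]
      exact abs_integral_le_of_abs_le _ fun q => abs_truncLoss_inner_sub_le hL (hf1 q.1) hd q.2
    have h3 : |∑ j, truncLoss L ⟪β, f (l j).1⟫ (l j).2 - ∑ j, truncLoss L ⟪β', f (l j).1⟫ (l j).2| ≤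
        n * (2 * Real.sqrt L * η) := by
      rw [← Finset.sum_sub_distrib]
      refine (Finset.abs_sum_le_sum_abs _ _).trans ((Finset.sum_le_card_nsmul _ _ _ fun j _ =>
        abs_truncLoss_inner_sub_le hL (hf1 (l j).1) hd (l j).2).trans_eq ?_)
      rw [Finset.card_univ, Fintype.card_fin, nsmul_eq_mul]
    have hn : (0 : ℝ) ≤ n := Nat.cast_nonneg n
    have h2' := mul_le_mul_of_nonneg_left h2 hn
    rw [abs_le] at h1 h3 ⊢
    have h4 := mul_le_mul_of_nonneg_left (abs_le.1 h2).1 hn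
    have h5 := mul_le_mul_of_nonneg_left (abs_le.1 h2).2 hn
    constructor <;> linarith
  obtain ⟨hhat, hmin⟩ := herm
  have hmin' := hmin β hβ
  simp only [predictor_eq] at hmin'
  have k1 := abs_le.1 (key βhat hhat)
  have k2 := abs_le.1 (key β hβ)
  linarith [k1.2, k2.1]

/-- The cardinality of the net never enters the deviation bound, so no quantitative covering number
is needed. The net only makes the suprema finite, hence measurable. -/
theorem exists_finset_net {𝓑 : Set (Rep r)} (hD : ∀ β ∈ 𝓑, ‖β‖ ≤ D) {η : ℝ} (hη : 0 < η) :
    ∃ F : Finset (Rep r), (∀ β ∈ F, ‖β‖ ≤ D) ∧ ∀ β ∈ 𝓑, ∃ β' ∈ F, ‖β - β'‖ ≤ η := by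
  have htb : TotallyBounded 𝓑 := (isCompact_closedBall (0 : Rep r) D).totallyBounded.subset
    fun β hβ => by simpa using hD β hβ
  obtain ⟨t, ht, hfin, hcov⟩ := Metric.finite_approx_of_totallyBounded htb η hη
  refine ⟨hfin.toFinset, fun β hβ => hD β (ht (by simpa using hβ)), fun β hβ => ?_⟩
  have h := hcov hβ
  simp only [Set.mem_iUnion, Metric.mem_ball, dist_eq_norm] at h
  obtain ⟨β', hβ', h⟩ := h
  exact ⟨β', by simpa using hβ', h.le⟩

/-- Deterministic bound on the excess risk of the two-phase estimator. -/
theorem excessRisk_le_of_isERM (hfs : Measurable fs) (hf : Measurable f)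
    (hfs1 : ∀ x, ‖fs x‖ ≤ 1) (hf1 : ∀ x, ‖f x‖ ≤ 1) {𝓑 : Set (Rep r)}
    (hD : ∀ β ∈ 𝓑, ‖β‖ ≤ D) (hO : ∀ O : Rep r ≃ₗᵢ[ℝ] Rep r, ∀ β ∈ 𝓑, O β ∈ 𝓑) (hβs : βs ∈ 𝓑)
    (hn : 1 ≤ n) (hL : L = 36 * (D ^ 2 + 1) * Real.log n) {F : Finset (Rep r)} {η t ε : ℝ}
    (hnet : ∀ β ∈ 𝓑, ∃ β' ∈ F, ‖β - β'‖ ≤ η) {l : Fin n → X × ℝ}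
    (hdev : ∀ β ∈ F, |∑ j, (truncRisk P fs βs L f β - truncLoss L ⟪β, f (l j).1⟫ (l j).2)| ≤ t)
    {βhat : Rep r} (herm : IsERM L f 𝓑 l βhat) (hε : 0 ≤ ε) (hk : kernelDist P f fs ≤ ε ^ 2) :
    excessRisk P fs βs f βhat ≤ 2 * ε * D ^ 2 + 2 * t / n + 8 * (Real.sqrt L * η) +
      36 * (D ^ 2 + 1) * (Real.exp 1 * gaussianExpSqMoment ^ 2) / n := by
  have hn0 : (0 : ℝ) < n := by exact_mod_cast hn
  have hL0 : 0 ≤ L := by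
    rw [hL]; exact mul_nonneg (by positivity) (Real.log_natCast_nonneg n)
  obtain ⟨O, hOu⟩ := exists_isometry_integral_inner_sub_sq_le P hf hfs hf1 hfs1 hε hk
  -- The empirical minimizer is compared with the rotated truth `O βs`, since the learned
  -- representation is close to the true one only after rotation.
  have hβ0 : O βs ∈ 𝓑 := hO O βs hβs
  have hhat : βhat ∈ 𝓑 := herm.1
  have h1 := truncRisk_le_of_isERM P hfs hf hf1 hL0 hnet hdev herm hβ0
  have h2 := integral_sqLoss_le_truncRisk_add P hfs hf hfs1 hf1 (hD _ hβs) (hD _ hhat) hn hL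
  have h3 := truncRisk_le P hfs hf hfs1 hf1 (hD _ hβs) (hD _ hβ0) hL0
  rw [integral_sqLoss P hfs hf hfs1 hf1 (hD _ hβs) (hD _ hβ0)] at h3
  rw [integral_sqLoss P hfs hf hfs1 hf1 (hD _ hβs) (hD _ hhat)] at h2
  rw [excessRisk_eq P hfs hf hfs1 hf1 (hD _ hβs) (hD _ hhat)]
  have h4 : ∫ x, (⟪βs, fs x⟫ - ⟪O βs, f x⟫) ^ 2 ∂P ≤ 2 * ε * D ^ 2 := by
    have h5 : 2 * ε * ‖βs‖ ^ 2 ≤ 2 * ε * D ^ 2 :=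
      mul_le_mul_of_nonneg_left (pow_le_pow_left₀ (norm_nonneg _) (hD _ hβs) 2) (by positivity)
    refine le_trans (le_of_eq (integral_congr_ae (Filter.Eventually.of_forall fun x => ?_)))
      ((hOu βs).trans h5)
    simp only; ring
  have h6 : truncRisk P fs βs L f βhat ≤ truncRisk P fs βs L f (O βs) + 2 * t / n +
      8 * (Real.sqrt L * η) := by
    have e : n * (truncRisk P fs βs L f (O βs) + 2 * t / n + 8 * (Real.sqrt L * η)) =
        n * truncRisk P fs βs L f (O βs) + 2 * t + 8 * n * (Real.sqrt L * η) := by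
      field_simp
    rw [← e] at h1
    exact le_of_mul_le_mul_left h1 hn0
  linarith

end Regression

/-! ### Combination of the two phases. -/

/-- If the first phase recovers the similarity kernel up to `ε`, the two-phase estimator has small
excess risk. -/
theorem measure_excessRisk_gt_le {X : Type*} [MeasurableSpace X] {U : Type*} [MeasurableSpace U]
    {r n : ℕ} (P : Measure X) [IsProbabilityMeasure P] (μ : Measure U) [IsProbabilityMeasure μ]
    {g : U → X → Rep r} (hg : Measurable fun q : U × X => g q.1 q.2) (hg1 : ∀ u x, ‖g u x‖ ≤ 1)
    {fs : X → Rep r} (hfs : Measurable fs) (hfs1 : ∀ x, ‖fs x‖ ≤ 1) {βs : Rep r} {D L δ ε : ℝ}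
    {𝓑 : Set (Rep r)} (hD : ∀ β ∈ 𝓑, ‖β‖ ≤ D)
    (hO : ∀ O : Rep r ≃ₗᵢ[ℝ] Rep r, ∀ β ∈ 𝓑, O β ∈ 𝓑) (hβs : βs ∈ 𝓑) (hn : 2 ≤ n)
    (hδ : 0 < δ) (hδ1 : δ < 1) (hL : L = 36 * (D ^ 2 + 1) * Real.log n) (hε : 0 ≤ ε)
    (hk : μ {u | ε ^ 2 < kernelDist P (g u) fs} ≤ ENNReal.ofReal (δ / 2))
    {βhat : U → (Fin n → X × ℝ) → Rep r}
    (herm : ∀ᵐ w ∂(μ.prod (Measure.pi fun _ : Fin n => labeledLaw P fs βs)),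
      IsERM L (g w.1) 𝓑 w.2 (βhat w.1 w.2)) :
    (μ.prod (Measure.pi fun _ : Fin n => labeledLaw P fs βs))
      {w | ¬ excessRisk P fs βs (g w.1) (βhat w.1 w.2) ≤ 2 * ε * L +
        (18 + 36 * (Real.exp 1 * gaussianExpSqMoment ^ 2)) * (1 + Real.log (1 / δ)) *
          (L * Real.sqrt (1 / n))} ≤ ENNReal.ofReal δ := by
  have hQ := isProbabilityMeasure_labeledLaw P hfs βs
  have hn0 : (0 : ℝ) < n := by exact_mod_cast (by omega : 0 < n)
  have hD0 : 0 ≤ D := (norm_nonneg _).trans (hD _ hβs)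
  have hlogn : 0.69 ≤ Real.log n := by
    have h1 : Real.log 2 ≤ Real.log n := Real.log_le_log two_pos (by exact_mod_cast hn)
    linarith [Real.log_two_gt_d9]
  have hcL : D ^ 2 + 1 ≤ L := by rw [hL]; nlinarith [sq_nonneg D]
  have hLpos : 0 < L := by nlinarith [sq_nonneg D]
  set ℒ := 1 + Real.log (1 / δ)
  have hlogδ : 0 ≤ Real.log (1 / δ) := Real.log_nonneg (by rw [le_div_iff₀ hδ]; linarith)
  have hℒ : 1 ≤ ℒ := by simp only [ℒ]; linarith
  set a := Real.sqrt (1 / n)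
  have ha0 : 0 < a := Real.sqrt_pos.2 (by positivity)
  have hasq : a ^ 2 = 1 / n := Real.sq_sqrt (by positivity)
  have ha1 : a ≤ 1 := Real.sqrt_le_one.2 (by
    rw [div_le_one hn0]; exact_mod_cast (by omega : 1 ≤ n))
  have hsn : Real.sqrt n / n = a := by
    rw [Real.sqrt_div_self, ← Real.sqrt_inv, ← one_div]
  -- With this `s` the deviation event has probability at most `2 exp (-2 ℒ²) ≤ 2 e⁻² δ ≤ δ / 2`.
  set s := L * ℒ * Real.sqrt n
  have hs : 0 ≤ s := by positivity
  set t := 2 * (2 * Real.sqrt L) * D * Real.sqrt n + s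
  -- The mesh `√L / √n` makes the discretization error of the same order `L / √n` as the deviation.
  have hη : 0 < Real.sqrt L * a := mul_pos (Real.sqrt_pos.2 hLpos) ha0
  obtain ⟨F, hF, hnet⟩ := exists_finset_net hD hη
  set S₂ : Set (U × (Fin n → X × ℝ)) := {w | ∃ β ∈ F, t ≤
    |∑ j, (truncRisk P fs βs L (g w.1) β - truncLoss L ⟪β, g w.1 (w.2 j).1⟫ (w.2 j).2)|}
  have hS₂ : (μ.prod (Measure.pi fun _ : Fin n => labeledLaw P fs βs)) S₂ ≤
      ENNReal.ofReal (δ / 2) := by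
    refine (measure_prod_exists_le_abs_sum_le P μ hg hg1 hfs hLpos.le hD0 hF hs).trans
      (ENNReal.ofReal_le_ofReal ?_)
    have h1 : 2 * s ^ 2 / (n * L ^ 2) = 2 * ℒ ^ 2 := by
      simp only [s]
      rw [mul_pow, Real.sq_sqrt hn0.le]
      field_simp
    have h2 : Real.exp (-(2 * ℒ ^ 2)) ≤ Real.exp (-2) * δ := by
      have : Real.exp (-2) * δ = Real.exp (-2 + Real.log δ) := by
        rw [Real.exp_add, Real.exp_log hδ]
      rw [this]
      refine Real.exp_le_exp.2 ?_
      have : Real.log δ = -Real.log (1 / δ) := by rw [one_div, Real.log_inv, neg_neg]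
      rw [this]
      simp only [ℒ]
      nlinarith
    have h3 : Real.exp (-2) ≤ 1 / 4 := by
      have h4 : 2 ≤ Real.exp 1 := by linarith [Real.add_one_le_exp (1 : ℝ)]
      rw [Real.exp_neg, ← one_div]
      refine one_div_le_one_div_of_le (by norm_num) ?_
      have : Real.exp 2 = Real.exp 1 * Real.exp 1 := by rw [← Real.exp_add]; norm_num
      rw [this]
      nlinarith
    rw [h1]
    nlinarith
  have hsub : (μ.prod (Measure.pi fun _ : Fin n => labeledLaw P fs βs))
      {w | ¬ excessRisk P fs βs (g w.1) (βhat w.1 w.2) ≤ 2 * ε * L +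
        (18 + 36 * (Real.exp 1 * gaussianExpSqMoment ^ 2)) * ℒ * (L * a)} ≤
      (μ.prod (Measure.pi fun _ : Fin n => labeledLaw P fs βs))
        ({u | ε ^ 2 < kernelDist P (g u) fs} ×ˢ Set.univ ∪ S₂) := by
    refine measure_mono_ae ?_
    filter_upwards [herm] with w hw
    intro hbad
    by_contra hnot
    obtain ⟨h1, h2⟩ := not_or.1 hnot
    have hker : kernelDist P (g w.1) fs ≤ ε ^ 2 := by
      by_contra! h
      exact h1 ⟨h, Set.mem_univ _⟩
    have hdev : ∀ β ∈ F, |∑ j, (truncRisk P fs βs L (g w.1) β -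
        truncLoss L ⟪β, g w.1 (w.2 j).1⟫ (w.2 j).2)| ≤ t := by
      intro β hβ
      by_contra! h
      exact h2 ⟨β, hβ, h.le⟩
    have hmain := excessRisk_le_of_isERM P hfs (hg.comp measurable_prodMk_left) hfs1 (hg1 w.1) hD
      hO hβs (by omega) hL hnet hdev hw hε hker
    refine hbad (hmain.trans ?_)
    have e1 : 2 * ε * D ^ 2 ≤ 2 * ε * L := mul_le_mul_of_nonneg_left (by linarith) (by positivity)
    have hDL : Real.sqrt L * D ≤ L := by
      have : D ≤ Real.sqrt L := Real.le_sqrt_of_sq_le (by linarith)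
      calc Real.sqrt L * D ≤ Real.sqrt L * Real.sqrt L := by gcongr
        _ = L := Real.mul_self_sqrt hLpos.le
    have e2 : 2 * t / n = 8 * (Real.sqrt L * D) * a + 2 * L * ℒ * a := by
      rw [← hsn]; simp only [t, s]; ring
    have hLa : 0 ≤ L * a := by positivity
    have e3 : 8 * (Real.sqrt L * D) * a ≤ 8 * (L * a) := by
      nlinarith [mul_le_mul_of_nonneg_right hDL ha0.le]
    have e4 : 8 * (Real.sqrt L * (Real.sqrt L * a)) = 8 * (L * a) := by
      rw [← mul_assoc (Real.sqrt L), Real.mul_self_sqrt hLpos.le]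
    set A := Real.exp 1 * gaussianExpSqMoment ^ 2
    have hA : 0 ≤ A := by positivity
    have e5 : 36 * (D ^ 2 + 1) * A / n ≤ 36 * A * (L * a) := by
      rw [div_eq_mul_one_div, ← hasq]
      have h6 : (D ^ 2 + 1) * a ^ 2 ≤ L * a := by
        rw [sq a, ← mul_assoc]
        exact (mul_le_of_le_one_right (by positivity) ha1).trans
          (mul_le_mul_of_nonneg_right hcL ha0.le)
      nlinarith [mul_le_mul_of_nonneg_left h6 hA]
    -- The constant `18` consists of `8` from the expected deviation, `8` from the net and `2` from
    -- McDiarmid's inequality; only the last carries `ℒ` already.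
    have e6 : (16 + 36 * A) * (L * a) ≤ (16 + 36 * A) * ℒ * (L * a) := by
      rw [mul_right_comm]
      exact le_mul_of_one_le_right (by positivity) hℒ
    rw [e2, e4]
    linarith
  refine hsub.trans ((measure_union_le _ _).trans ?_)
  rw [Measure.prod_prod, measure_univ, mul_one]
  refine (add_le_add hk hS₂).trans_eq ?_
  rw [← ENNReal.ofReal_add (by positivity) (by positivity), add_halves]

end Contrastive

/-! ### The main bound, with the kernel error chosen according to the bracketing number. -/

theorem theorem7 :
    ∃ C : ℝ, 0 < C ∧ ∃ k : ℕ,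
      ∀ (X : Type*) [MeasurableSpace X] (Θ : Type*) (r m n : ℕ)
        -- the input distribution: density `p` with respect to `ρ`
        (ρ : Measure X) [SigmaFinite ρ] (p : X → ℝ)
        -- the representation class, the regression parameters, the true parameters
        (f : Θ → X → Contrastive.Rep r) (𝓑 : Set (Contrastive.Rep r))
        (θs : Θ) (βs : Contrastive.Rep r)
        (D δ L κ : ℝ) (N : ℕ)
        -- the outputs of the two phases, as functions of the data
        (θhat : (Fin m → Contrastive.Triple X) → Θ)
        (βhat : (Fin m → Contrastive.Triple X) → (Fin n → X × ℝ) → Contrastive.Rep r),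
        1 ≤ m → 2 ≤ n → 0 < δ → δ < 1 →
        Measurable p → (∀ x, 0 ≤ p x) → ∫⁻ x, ENNReal.ofReal (p x) ∂ρ = 1 →
        (∀ θ, Measurable (f θ)) → (∀ θ x, ‖f θ x‖ ≤ 1) →
        (∀ β ∈ 𝓑, ‖β‖ ≤ D) →
        (∀ O : Contrastive.Rep r ≃ₗᵢ[ℝ] Contrastive.Rep r, ∀ β ∈ 𝓑, O β ∈ 𝓑) →
        βs ∈ 𝓑 →
        L = 36 * (D ^ 2 + 1) * Real.log n →
        0 < Contrastive.sigmaMin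
          (Contrastive.secondMoment (Contrastive.inputLaw ρ p) (f θs)) →
        κ = Real.sqrt (1 / Contrastive.sigmaMin
          (Contrastive.secondMoment (Contrastive.inputLaw ρ p) (f θs))) →
        Contrastive.bracketingNumber (Contrastive.refMeasure ρ)
          (Set.range fun θ => Contrastive.tripleDensity p (f θ)) (1 / (m : ℝ) ^ 2) = (N : ℕ∞) →
        (n ≤ m ∨ 2 ≤ N) →
        Measurable (fun q : (Fin m → Contrastive.Triple X) × X => f (θhat q.1) q.2) →
        -- phase one: maximum likelihood on the unlabeled sample
        (∀ᵐ u ∂(Measure.pi fun _ : Fin m =>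
            Contrastive.tripleLaw ρ p (f θs)), Contrastive.IsMLE p f u (θhat u)) →
        -- phase two: empirical risk minimization on the independent labeled sample
        (∀ᵐ w ∂((Measure.pi fun _ : Fin m => Contrastive.tripleLaw ρ p (f θs)).prod
            (Measure.pi fun _ : Fin n =>
              Contrastive.labeledLaw (Contrastive.inputLaw ρ p) (f θs) βs)),
          Contrastive.IsERM L (f (θhat w.1)) 𝓑 w.2 (βhat w.1 w.2)) →
        -- the bound fails with probability at most `δ`
        ((Measure.pi fun _ : Fin m => Contrastive.tripleLaw ρ p (f θs)).prod
            (Measure.pi fun _ : Fin n =>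
              Contrastive.labeledLaw (Contrastive.inputLaw ρ p) (f θs) βs))
          {w | ¬ Contrastive.excessRisk (Contrastive.inputLaw ρ p) (f θs) βs
                (f (θhat w.1)) (βhat w.1 w.2) ≤
              C * (1 + Real.log (1 / δ)) ^ k *
                (κ * L * Real.sqrt (Real.log N / m) + L * Real.sqrt (1 / n))}
          ≤ ENNReal.ofReal δ 
    := by
  refine ⟨500 + 36 * (Real.exp 1 * gaussianExpSqMoment ^ 2), by positivity, 1, ?_⟩
  intro X _ Θ r m n ρ _ p f 𝓑 θs βs D δ L κ N θhat βhat hm hn hδ hδ1 hp hp0 hp1 hf hf1 hD hO hβs hL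
    hσ hκ hbr hcase hθ hmle herm
  have hP := Contrastive.isProbabilityMeasure_inputLaw hp1
  have hT := Contrastive.isProbabilityMeasure_tripleLaw ρ hp hp0 hp1 (hf θs)
  have hm0 : (0 : ℝ) < m := by exact_mod_cast hm
  have hn0 : (0 : ℝ) < n := by exact_mod_cast (by omega : 0 < n)
  have hκ1 : 1 ≤ κ := by
    rw [hκ]
    refine Real.one_le_sqrt.2 ?_
    rw [le_div_iff₀ hσ, one_mul]
    exact Contrastive.sigmaMin_secondMoment_le_one _ (hf θs) (hf1 θs)
  have hL0 : 0 ≤ L := by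
    rw [hL]; exact mul_nonneg (by positivity) (Real.log_natCast_nonneg n)
  have hlogδ : 0 ≤ Real.log (1 / δ) := Real.log_nonneg (by rw [le_div_iff₀ hδ]; linarith)
  set ℒ := 1 + Real.log (1 / δ)
  have hℒ : 1 ≤ ℒ := by simp only [ℒ]; linarith
  set A := Real.exp 1 * gaussianExpSqMoment ^ 2
  have hA : 0 ≤ A := by positivity
  set a := Real.sqrt (1 / n)
  have ha0 : 0 ≤ a := Real.sqrt_nonneg _
  set b := Real.sqrt (Real.log N / m)
  have hb0 : 0 ≤ b := Real.sqrt_nonneg _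
  have hLb : L * b ≤ κ * L * b := by
    rw [mul_assoc]; exact le_mul_of_one_le_left (by positivity) hκ1
  obtain ⟨ε, hε, hεle, hk⟩ : ∃ ε : ℝ, 0 ≤ ε ∧ ε ≤ ℒ * (200 * b + 10 * a) ∧
      (Measure.pi fun _ : Fin m => Contrastive.tripleLaw ρ p (f θs))
        {u | ε ^ 2 < Contrastive.kernelDist (Contrastive.inputLaw ρ p) (f (θhat u)) (f θs)} ≤
        ENNReal.ofReal (δ / 2) := by
    by_cases hN : 2 ≤ N
    · have hN2 : (2 : ℝ) ≤ N := by exact_mod_cast hN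
      have hlogN : 0.69 ≤ Real.log N := by
        have h1 : Real.log 2 ≤ Real.log N := Real.log_le_log two_pos hN2
        linarith [Real.log_two_gt_d9]
      have hlog : Real.log (N / (δ / 2)) = Real.log 2 + Real.log N + Real.log (1 / δ) := by
        have : (N : ℝ) / (δ / 2) = 2 * N * (1 / δ) := by field_simp
        rw [this, Real.log_mul (by positivity) (by positivity),
          Real.log_mul (by positivity) (by positivity)]
      set e := 9216 * (1 + Real.log (N / (δ / 2))) / m
      have he0 : 0 ≤ e := by
        simp only [e]
        rw [hlog]
        have := Real.log_two_gt_d9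
        exact div_nonneg (by linarith) hm0.le
      refine ⟨Real.sqrt e, Real.sqrt_nonneg _, ?_, ?_⟩
      · have h1 : e ≤ (ℒ * 200 * b) ^ 2 := by
          rw [mul_pow, Real.sq_sqrt (by positivity), ← mul_div_assoc]
          refine div_le_div_of_nonneg_right ?_ hm0.le
          rw [hlog]
          have h2 := Real.log_two_lt_d9
          -- For `N ≥ 2`, `log N` is bounded below and absorbs the additive constants. The factor
          -- `200` is safe because `4 · 9216 ≤ 200²`.
          have h3 : 1 + (Real.log 2 + Real.log N + Real.log (1 / δ)) ≤ 4 * ℒ * Real.log N := by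
            simp only [ℒ]
            nlinarith [mul_le_mul_of_nonneg_right hlogN hlogδ]
          have h4 : ℒ * Real.log N ≤ ℒ ^ 2 * Real.log N := by
            refine mul_le_mul_of_nonneg_right ?_ (by linarith)
            nlinarith
          nlinarith
        have h5 : Real.sqrt e ≤ ℒ * 200 * b := Real.sqrt_le_iff.2 ⟨by positivity, h1⟩
        have h6 : 0 ≤ ℒ * (10 * a) := by positivity
        linarith
      · rw [Real.sq_sqrt he0]
        exact Contrastive.measure_kernelDist_mle_le ρ hp hp0 hp1 hf hf1 hm (by omega) hbr hmle
          (by positivity)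
    -- For `N ≤ 1` the term with `log N` vanishes, so the kernel error has to be absorbed by `√(1 /
    -- n)`. The single bracket gives `96 / m²`, which is at most `100 / n` because `n ≤ m`.
    · have hnm : n ≤ m := hcase.resolve_right hN
      refine ⟨10 * a, by positivity, ?_, ?_⟩
      · have h1 : 10 * a ≤ ℒ * (10 * a) := le_mul_of_one_le_left (by positivity) hℒ
        have h2 : 0 ≤ ℒ * (200 * b) := by positivity
        linarith
      · refine (measure_mono_null (t := ∅) (Set.subset_empty_iff.2 ?_)
          measure_empty).le.trans zero_le
        rw [Set.eq_empty_iff_forall_notMem]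
        intro u hu
        have h1 := Contrastive.kernelDist_le_of_bracketingNumber_le_one ρ hp hp0 hp1 hf hf1
          (by omega : N ≤ 1) hbr (θhat u) θs
        have h2 : (96 : ℝ) / (m : ℝ) ^ 2 ≤ (10 * a) ^ 2 := by
          rw [mul_pow, Real.sq_sqrt (by positivity), mul_one_div]
          have h3 : (n : ℝ) ≤ m := by exact_mod_cast hnm
          have h4 : (1 : ℝ) ≤ m := by exact_mod_cast hm
          rw [div_le_div_iff₀ (by positivity) hn0]
          nlinarith
        exact absurd (lt_of_lt_of_le hu h1) (not_lt.2 h2)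
  refine le_trans (measure_mono fun w hw => ?_) (Contrastive.measure_excessRisk_gt_le
    (Contrastive.inputLaw ρ p) (Measure.pi fun _ : Fin m => Contrastive.tripleLaw ρ p (f θs))
    hθ (fun u => hf1 (θhat u)) (hf θs) (hf1 θs) hD hO hβs hn hδ hδ1 hL hε hk herm)
  intro hle
  refine hw (hle.trans ?_)
  rw [pow_one]
  have h1 : 2 * ε * L ≤ ℒ * (400 * (κ * L * b) + 20 * (L * a)) := by
    have h2 := mul_le_mul_of_nonneg_right hεle hL0
    have h3 := mul_le_mul_of_nonneg_left hLb (by linarith : 0 ≤ ℒ)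
    linarith
  have h4 : 0 ≤ ℒ * (κ * L * b) := by positivity
  have h5 : 0 ≤ ℒ * (L * a) := by positivity
  have h6 : 0 ≤ A * (ℒ * (κ * L * b)) := by positivity
  change 2 * ε * L + (18 + 36 * A) * ℒ * (L * a) ≤ (500 + 36 * A) * ℒ * (κ * L * b + L * a)
  linarith
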